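/- **Trees.** Consider plane binary trees $\tau$ (finite or infinite; every vertex is a leaf, of degree 1, or a cubic vertex, of degree 3) rooted at a leaf. An *allowed angle assignment* gives each cubic vertex $u$ angles $a_u,b_u\in(0,\pi)$ at its first and last corner in the contour order (between the parent edge and the left edge, resp. between the right edge and the parent edge) with $a_u+b_u>\pi$, the third angle being $2\pi-a_u-b_u$, such that the two angles facing any edge joining two cubic vertices have sum $>\pi$: $a_v+b_v<b_u+\pi$ if $v$ is the left child of $u$, and $a_v+b_v<a_u+\pi$ if $v$ is the right child of $u$. A labeled tree is a tree with an allowed angle assignment; $|\tau|$ is its number of leaves, including the root. Let $\mathsf{Bin}_n$ be the set of these unlabeled trees with $n$ leaves, and for $\tau\in \mathsf{Bin}_n$, $\theta\in[0,\pi)$, let $A_{\theta,\tau}\subset\mathbb R^{2n-4}$ be the set of allowed angle assignments of $\tau$ such that $a+b+\theta<2\pi$ for the angles $a,b$ at the cubic vertex next to the root (for $n=2$, $A_{\theta,\tau}$ is one point, of unit mass). **Laws.** Let $J_0,J_1$ be Bessel functions of the first kind, $c_0$ the first positive zero of $J_0$, $x_c=\frac{c_0}{2\pi^2}J_1(c_0)$,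 and $$F(\theta)=\sum_{n\ge2}x_c^{n-1}\sum_{\tau\in\mathsf{Bin}_n}\mathrm{Leb}(A_{\theta,\tau}),\qquad \mathbb P_\theta=\frac1{F(\theta)}\sum_{n\ge2}x_c^{n-1}\sum_{\tau\in\mathsf{Bin}_n}\mathrm{Leb}_{A_{\theta,\tau}},\qquad F_\infty(\theta)=J_0\!\left(\tfrac{\theta}{\pi}c_0\right),$$ and $\mathbb P_\theta^n=\mathbb P_\theta(\,\cdot\mid|\tau|=n)$ for $n\ge2$. **Theorem (local limit from a leaf).** There is a unique measurable family $(\mathbb P_\theta^\infty)_{\theta\in[0,\pi)}$ of probability laws on labeled binary trees with the following Markov property at the root. Under $\mathbb P^\infty_\theta$, almost surely the vertex next to the root is cubic, and exactly one of its left and right subtrees is infinite. Write $\pi-\alpha$ and $\pi-\beta$ for the angles at that vertex facing the left edge and the right edge. On the event that the left subtree is finite and the right one infinite, $(\alpha,\beta)$ has the density $$\mathbf 1_{\theta<\alpha+\beta<\pi}\,\frac{F(\alpha)F_\infty(\beta)}{F_\infty(\theta)}\,d\alpha\,d\beta,$$ and given $(\alpha,\beta)$ the left and right subtrees are independent with laws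 $\mathbb P_\alpha$ and $\mathbb P_\beta^\infty$; on the event that the left subtree is infinite and the right one finite, $(\alpha,\beta)$ has the density $\mathbf 1_{\theta<\alpha+\beta<\pi}\frac{F_\infty(\alpha)F(\beta)}{F_\infty(\theta)}\,d\alpha\,d\beta$, and given $(\alpha,\beta)$ the subtrees are independent with laws $\mathbb P_\alpha^\infty$ and $\mathbb P_\beta$. Moreover, for every $\theta\in[0,\pi)$, $\mathbb P_\theta^\infty$ is supported by infinite labeled trees with exactly one spine (infinite branch from the root), whose first cubic vertex satisfies $a+b+\theta<2\pi$, and $\mathbb P_\theta^n\to\mathbb P_\theta^\infty$ locally in distribution as $n\to\infty$, the labels being matched exactly: for every $r\ge0$, the law of the first $r$ generations of the labeled tree under $\mathbb P_\theta^n$ converges in total variation to that under $\mathbb P_\theta^\infty$. -/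

import Mathlib

open MeasureTheory ProbabilityTheory Filter Topology

noncomputable section

namespace AngleTree

/-! ### Plane binary trees with angles -/

/-- The σ-algebra of the disjoint union of a point `none` and of the plane. -/
instance instMeasurableSpaceLabel : MeasurableSpace (Option (ℝ × ℝ)) :=
  MeasurableSpace.map some inferInstance

/-- A (finite or infinite) plane binary tree, rooted at a leaf, with angles at its corners.
Apart from the root leaf, a vertex is addressed by the word of turns (`false` is left, `true` is
right) that leads to it from the neighbour `[]` of the root leaf. The value at `u` is
`some (a, b)` if `u` is a cubic vertex whose first and last corners in the contour order (between
the parent edge and the left edge, and between the right edge and the parent edge) have the angles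
`a` and `b`; the angle of the third corner is `2π - a - b`. The value at `u` is `none` if `u` is a
leaf or not a vertex. The conditions that make such a map a tree with allowed angles are in
`IsAllowed`. -/
abbrev LTree : Type := List Bool → Option (ℝ × ℝ)

/-- The addresses of the cubic vertices. -/
def cubic (t : LTree) : Set (List Bool) := {u | t u ≠ none}

/-- The leaves other than the root leaf: the addresses that are not cubic, and that are `[]` or a
child of a cubic vertex. -/
def nonrootLeaves (t : LTree) : Set (List Bool) :=
  {u | t u = none ∧ ∀ v d, u = v ++ [d] → t v ≠ none}

/-- The number `|t|` of leaves, the root leaf included. -/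
def numLeaves (t : LTree) : ℕ∞ := (nonrootLeaves t).encard + 1

/-- A set of addresses is closed under taking the parent. -/
def ParentClosed (S : Set (List Bool)) : Prop := ∀ u d, u ++ [d] ∈ S → u ∈ S

/-- `t` is a tree with an allowed angle assignment, such that moreover the two recorded angles
`a, b` at the first cubic vertex (if there is one) satisfy `a + b + θ < 2π`. -/
structure IsAllowed (θ : ℝ) (t : LTree) : Prop where
  parentClosed : ParentClosed (cubic t)
  angles : ∀ u a b, t u = some (a, b) →
    0 < a ∧ a < Real.pi ∧ 0 < b ∧ b < Real.pi ∧ Real.pi < a + b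
  left_edge : ∀ u a b a' b', t u = some (a, b) → t (u ++ [false]) = some (a', b') →
    a' + b' < b + Real.pi
  right_edge : ∀ u a b a' b', t u = some (a, b) → t (u ++ [true]) = some (a', b') →
    a' + b' < a + Real.pi
  root_edge : ∀ a b, t [] = some (a, b) → a + b + θ < 2 * Real.pi

/-- The subtree on the left of the first cubic vertex (rooted at a copy of that vertex). -/
def leftTree (t : LTree) : LTree := fun u => t (false :: u)

/-- The subtree on the right of the first cubic vertex (rooted at a copy of that vertex). -/
def rightTree (t : LTree) : LTree := fun u => t (true :: u)

/-- The tree whose first cubic vertex has first angle `p.1` and last angle `p.2`, and whose left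
and right subtrees are `l` and `r`. -/
def graft (p : ℝ × ℝ) (l r : LTree) : LTree
  | [] => some p
  | false :: u => l u
  | true :: u => r u

/-- The tree has finitely many vertices. -/
def IsFinite (t : LTree) : Prop := (cubic t).Finite

/-- The tree has exactly one infinite branch from the root (one spine). -/
def OneSpine (t : LTree) : Prop :=
  ∃! s : ℕ → Bool, ∀ k : ℕ, (List.range k).map s ∈ cubic t

/-- The first `r` generations of the tree, where the root leaf is generation `0`. The vertex with
address `u` is in generation `|u| + 1`, and the vertices of generation `r` become leaves. -/
def trunc (r : ℕ) (t : LTree) : LTree := fun u => if u.length + 2 ≤ r then t u else none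

/-! ### Lebesgue measure on the allowed angle assignments -/

/-- `Bin_n`: the plane binary trees with `n` leaves (the root leaf included) and `n - 2` cubic
vertices, given by the set of addresses of the cubic vertices. -/
def Bin (n : ℕ) : Type :=
  {S : Finset (List Bool) // ParentClosed (S : Set (List Bool)) ∧ S.card + 2 = n}

/-- The tree with set of cubic vertices `S` and angles `x`. -/
def label (S : Finset (List Bool)) (x : S → ℝ × ℝ) : LTree :=
  fun u => if h : u ∈ S then some (x ⟨u, h⟩) else none

lemma measurable_label (S : Finset (List Bool)) : Measurable (label S) := by
  refine measurable_pi_lambda _ fun u => ?_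
  by_cases h : u ∈ S
  · simp only [label, h, dite_true]
    have hs : Measurable (some : ℝ × ℝ → Option (ℝ × ℝ)) := fun _ hs => hs
    exact hs.comp (measurable_pi_apply _)
  · simp only [label, h, dite_false]
    exact measurable_const

/-- The set `A_{θ,τ}` of allowed angle assignments of `τ`, a subset of `ℝ^(2n-4)`. -/
def allowedAngles {n : ℕ} (θ : ℝ) (τ : Bin n) : Set (τ.1 → ℝ × ℝ) :=
  {x | IsAllowed θ (label τ.1 x)}

/-- Lebesgue measure on `A_{θ,τ}`, as a measure on labeled trees. If `n = 2` this is the unit mass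
at the tree with a single edge. -/
def leb {n : ℕ} (θ : ℝ) (τ : Bin n) : Measure LTree :=
  (volume.restrict (allowedAngles θ τ)).map (label τ.1)

/-! ### Bessel functions, generating functions, and the laws of random trees -/

/-- The Bessel function of the first kind `J_n`. -/
def besselJ (n : ℕ) (x : ℝ) : ℝ :=
  ∑' k : ℕ, (-1) ^ k / ((k.factorial : ℝ) * ((k + n).factorial : ℝ)) * (x / 2) ^ (2 * k + n)

/-- The first positive zero of `J_0`. -/
def c₀ : ℝ := sInf {x : ℝ | 0 < x ∧ besselJ 0 x = 0}

/-- The critical weight per leaf. -/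
def xc : ℝ := c₀ / (2 * Real.pi ^ 2) * besselJ 1 c₀

/-- `F(x; θ) = ∑_{n ≥ 2} x^(n-1) ∑_{τ ∈ Bin_n} |A_{θ,τ}|` for `x ≥ 0` (with `n = m + 2`). -/
def genF (x θ : ℝ) : ENNReal :=
  ∑' m : ℕ, ENNReal.ofReal x ^ (m + 1) * ∑' τ : Bin (m + 2), volume (allowedAngles θ τ)

/-- `F(θ) = F(x_c; θ)`. -/
def F (θ : ℝ) : ENNReal := genF xc θ

/-- `F_∞(θ) = J_0(θ c₀ / π)`. -/
def Finf (θ : ℝ) : ℝ := besselJ 0 (θ / Real.pi * c₀)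

/-- The Boltzmann law `P_{x,θ}` on finite labeled trees. -/
def boltzmann (x θ : ℝ) : Measure LTree :=
  (genF x θ)⁻¹ • Measure.sum fun m : ℕ =>
    ENNReal.ofReal x ^ (m + 1) • Measure.sum fun τ : Bin (m + 2) => leb θ τ

/-- The critical Boltzmann law `P_θ`. -/
def critLaw (θ : ℝ) : Measure LTree := boltzmann xc θ

/-- The law `P_θ^n`: the law `P_θ` conditioned on the tree having `n` leaves. -/
def condLaw (θ : ℝ) (n : ℕ) : Measure LTree :=
  ProbabilityTheory.cond (critLaw θ) {t | numLeaves t = n}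

/-! ### Local convergence and the splitting at the root -/

/-- Total variation distance of two probability measures. -/
def tvDist {X : Type*} [MeasurableSpace X] (μ ν : Measure X) : ℝ :=
  ⨆ A : {A : Set X // MeasurableSet A}, |μ.real A.1 - ν.real A.1|

/-- Local convergence in distribution, labels being matched exactly: for every `r`, the law of the
first `r` generations converges in total variation. -/
def LocalTendsto (μ : ℕ → Measure LTree) (ν : Measure LTree) : Prop :=
  ∀ r : ℕ, Tendsto (fun n => tvDist ((μ n).map (trunc r)) (ν.map (trunc r))) atTop (𝓝 0)

/-- The types `θ ∈ [0, π)`. -/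
abbrev AngleType : Type := Set.Ico (0 : ℝ) Real.pi

/-- The Lebesgue measure `dα dβ` on pairs of types. -/
def lebPairs : Measure (AngleType × AngleType) :=
  (Measure.comap (fun α : AngleType => (α : ℝ)) volume).prod
    (Measure.comap (fun β : AngleType => (β : ℝ)) volume)

/-- The pairs of types `(α, β)` with `θ < α + β < π`. -/
def splitRegion (θ : AngleType) : Set (AngleType × AngleType) :=
  {p | (θ : ℝ) < (p.1 : ℝ) + (p.2 : ℝ) ∧ (p.1 : ℝ) + (p.2 : ℝ) < Real.pi}

/-- There is a cubic vertex next to the root, with a finite left and an infinite right subtree. -/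
def FinInf : Set LTree := {t | t [] ≠ none ∧ IsFinite (leftTree t) ∧ ¬ IsFinite (rightTree t)}

/-- There is a cubic vertex next to the root, with an infinite left and a finite right subtree. -/
def InfFin : Set LTree := {t | t [] ≠ none ∧ ¬ IsFinite (leftTree t) ∧ IsFinite (rightTree t)}

/-- The Markov property at the root of a family `(P_θ^∞)` of laws, `θ ∈ [0, π)`. Almost surely one
of the two events `FinInf`, `InfFin` occurs. On the first one, the pair of types `(α, β)` of the
left and right subtrees has the density `1_{θ < α + β < π} F(α) F_∞(β) / F_∞(θ)`, the angles at the
first cubic vertex that face the left and the right edge are `π - α` and `π - β`, and given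
`(α, β)` the two subtrees are independent with laws `P_α` and `P_β^∞`; symmetrically on the
second. -/
structure RootMarkov (P : Kernel AngleType LTree) : Prop where
  split : ∀ θ, ∀ᵐ t ∂(P θ), t ∈ FinInf ∪ InfFin
  finInf : ∀ θ, ∀ φ : LTree → ENNReal, Measurable φ →
    ∫⁻ t in FinInf, φ t ∂(P θ) =
      ∫⁻ p in splitRegion θ, F p.1 * ENNReal.ofReal (Finf p.2 / Finf θ) *
        ∫⁻ l, ∫⁻ r, φ (graft (Real.pi - p.2, Real.pi - p.1) l r) ∂(P p.2) ∂(critLaw p.1) ∂lebPairs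
  infFin : ∀ θ, ∀ φ : LTree → ENNReal, Measurable φ →
    ∫⁻ t in InfFin, φ t ∂(P θ) =
      ∫⁻ p in splitRegion θ, ENNReal.ofReal (Finf p.1 / Finf θ) * F p.2 *
        ∫⁻ l, ∫⁻ r, φ (graft (Real.pi - p.2, Real.pi - p.1) l r) ∂(critLaw p.2) ∂(P p.1) ∂lebPairs

end AngleTree

end

open AngleTree

/-!
The starting point is the decomposition of a tree at its first cubic vertex. The angles there are
`π - β` and `π - α` exactly when the left and right subtrees have types `α` and `β`, and all the
constraints at the root amount to `θ < α + β < π` (`isAllowed_graft`). So Lebesgue measure on the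
labelings of trees with `m + 1` cubic vertices is an integral over `α`, `β` of products of the same
measures for `m` cubic vertices in total (`lintegral_nuK_succ`), and the generating function solves
`F(x; θ) = x + ∬_{θ < α + β < π} F(x; α) F(x; β)`.

Let `A(z) = ∑ (-z)^k / (k!)²` and `U(z) = ∑ (-z)^k / (k! (k + 1)!)`, so that `J₀(x) = A(x²/4)`,
`J₁(x) = (x/2) U(x²/4)` and `(z U(z))' = A(z)`. Multiplication of Laplace transforms, in the form of
an identity for convolutions of even entire functions, shows that `y U(yθ²)` solves the equation for
`x = y U(yπ²)`, and that `A(yθ²)` solves the linearized equation up to the constant `A(yπ²)`. As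
long as this constant is positive the linearized operator is a contraction for a suitable weight,
and `F(x; θ) = y U(yθ²)` follows (`genF_genU`). The critical point is `yπ² = z₀`, the first zero of
`A`; there `F_∞(θ) = A(y θ²)` satisfies `F_∞(θ) = 2 ∬ F(α) F_∞(β)`, which says that the densities in
the Markov property have total mass one.

The Markov property prescribes the law of the direction, of the types and of the finite subtree at
the root, and repeats itself in the infinite subtree. Iterating it along a sequence of independent
uniform variables constructs the laws (`rootMarkov_limitK`). Conversely it determines the law of the
first `r` generations by induction on `r`, whence uniqueness (`RootMarkov.unique`); in the same way
it shows that the labels are allowed and that there is one spine.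

The local limit rests on the asymptotics of the total weight of the trees with `N` cubic vertices:
it is equivalent to `D N^(-3/2) F_∞(θ)`, with `D` independent of `θ` (`exists_tendsto_mass`). With
`w = z U(z)` the generating function is `z U(z s)`, where `s = (θ/π)²`, so Lagrange inversion gives
the coefficient as a contour integral of `A(z s) (z U(z))^(-N)`. The circle `|z| = z₀` passes through
the saddle point `z₀`. Since `1 / U` has nonnegative coefficients, the modulus of the integrand is
largest there, and Laplace's method applies (`exists_tendsto_coeff`). The ratios of these weights
then converge, so the law of a tree conditioned on its size satisfies, up to an error which tends to
zero by dominated convergence, the same recursion at the root as the limit law, and an induction on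
the number of generations concludes (`IsErrorBound.next`).
-/

noncomputable section

namespace AngleTree

/-! ### Everywhere convergent power series -/

/-- An everywhere absolutely convergent power series may be differentiated term by term: on the ball
of radius `R` the derived series is dominated by the given one at `2 R`, since `k + 1 ≤ 2 ^ (k +
1)`. -/
lemma hasDerivAt_entire {𝕜 : Type*} [RCLike 𝕜] {a : ℕ → 𝕜}
    (h : ∀ r : ℝ, Summable fun k => ‖a k‖ * r ^ k) (z : 𝕜) :
    HasDerivAt (fun w => ∑' k, a k * w ^ k) (∑' k : ℕ, ((k : 𝕜) + 1) * a (k + 1) * z ^ k) z := by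
  set R : ℝ := ‖z‖ + 1 with hR
  have hR0 : 0 < R := by positivity
  have hz : z ∈ Metric.ball (0 : 𝕜) R := by simp [hR]
  have hsum : Summable fun k : ℕ => ‖a k‖ * ((k : ℝ) * R ^ (k - 1)) := by
    have h2 := h (2 * R)
    refine Summable.of_nonneg_of_le (fun k => by positivity) (fun k => ?_) (h2.mul_left (R⁻¹))
    rcases k with _ | k
    · simp; positivity
    · have h3 : ((k + 1 : ℕ) : ℝ) ≤ 2 ^ (k + 1) := by
        exact_mod_cast (Nat.lt_two_pow_self (n := k + 1)).le
      have h4 : R⁻¹ * (‖a (k + 1)‖ * (2 * R) ^ (k + 1)) = ‖a (k + 1)‖ * (2 ^ (k + 1) * R ^ k) := by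
        rw [mul_pow, pow_succ R]; field_simp
      rw [h4]
      simp only [Nat.add_sub_cancel]
      gcongr
  have key := hasDerivAt_tsum_of_isPreconnected (𝕜 := 𝕜) (g := fun k w => a k * w ^ k)
    (g' := fun k w => a k * ((k : 𝕜) * w ^ (k - 1))) (t := Metric.ball (0 : 𝕜) R) (y₀ := 0)
    (y := z) hsum Metric.isOpen_ball (convex_ball (0 : 𝕜) R).isPreconnected
    (fun k y _ => by simpa using (hasDerivAt_pow k y).const_mul (a k))
    (fun k y hy => by
      have hy' : ‖y‖ ≤ R := by simpa using (Metric.mem_ball.1 hy).le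
      rw [norm_mul, norm_mul, norm_pow, RCLike.norm_natCast]
      gcongr) (by simp [hR0]) (by
      refine summable_of_ne_finset_zero (s := {0}) fun k hk => ?_
      have : k ≠ 0 := by simpa using hk
      simp [this]) hz
  have hs2 : Summable fun k : ℕ => a k * ((k : 𝕜) * z ^ (k - 1)) := by
    refine Summable.of_norm_bounded hsum fun k => ?_
    have hy' : ‖z‖ ≤ R := by simp [hR]
    rw [norm_mul, norm_mul, norm_pow, RCLike.norm_natCast]
    gcongr
  refine key.congr_deriv ?_
  rw [hs2.tsum_eq_zero_add]
  simp only [Nat.cast_zero, zero_mul, mul_zero, zero_add, Nat.cast_add, Nat.cast_one,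
    Nat.add_sub_cancel]
  exact tsum_congr fun k => by ring

/-- The entire function `A(z) = ∑ (-z)^k / (k!)^2`, so that `J_0(x) = A(x² / 4)`. -/
def serA {𝕜 : Type*} [RCLike 𝕜] (z : 𝕜) : 𝕜 :=
  ∑' k : ℕ, (-1) ^ k / ((k.factorial : 𝕜) * (k.factorial : 𝕜)) * z ^ k

/-- The entire function `U(z) = ∑ (-z)^k / (k! (k+1)!)`, so that `J_1(x) = (x / 2) U(x² / 4)`. -/
def serU {𝕜 : Type*} [RCLike 𝕜] (z : 𝕜) : 𝕜 :=
  ∑' k : ℕ, (-1) ^ k / ((k.factorial : 𝕜) * ((k + 1).factorial : 𝕜)) * z ^ k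

lemma summable_norm_serA {𝕜 : Type*} [RCLike 𝕜] (r : ℝ) : Summable fun k : ℕ =>
    ‖((-1) ^ k / ((k.factorial : 𝕜) * (k.factorial : 𝕜)) : 𝕜)‖ * r ^ k := by
  refine Summable.of_norm_bounded (Real.summable_pow_div_factorial |r|) fun k => ?_
  simp only [norm_mul, norm_div, norm_pow, norm_neg, norm_one, one_pow, RCLike.norm_natCast,
    Real.norm_eq_abs, one_div, abs_mul, abs_inv, Nat.abs_cast]
  have h1 : (1 : ℝ) ≤ k.factorial := by exact_mod_cast k.factorial_pos
  rw [div_eq_inv_mul]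
  gcongr
  nlinarith

lemma summable_norm_serU {𝕜 : Type*} [RCLike 𝕜] (r : ℝ) : Summable fun k : ℕ =>
    ‖((-1) ^ k / ((k.factorial : 𝕜) * ((k + 1).factorial : 𝕜)) : 𝕜)‖ * r ^ k := by
  refine Summable.of_norm_bounded (Real.summable_pow_div_factorial |r|) fun k => ?_
  simp only [norm_mul, norm_div, norm_pow, norm_neg, norm_one, one_pow, RCLike.norm_natCast,
    Real.norm_eq_abs, one_div, abs_mul, abs_inv, Nat.abs_cast]
  have h1 : (1 : ℝ) ≤ k.factorial := by exact_mod_cast k.factorial_pos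
  have h2 : (1 : ℝ) ≤ (k + 1).factorial := by exact_mod_cast (k + 1).factorial_pos
  rw [div_eq_inv_mul]
  gcongr
  nlinarith

lemma summable_of_entire {𝕜 : Type*} [RCLike 𝕜] {a : ℕ → 𝕜}
    (h : ∀ r : ℝ, Summable fun k => ‖a k‖ * r ^ k) (z : 𝕜) : Summable fun k => a k * z ^ k := by
  refine Summable.of_norm ?_
  simpa [norm_mul, norm_pow] using h ‖z‖

lemma hasDerivAt_serA {𝕜 : Type*} [RCLike 𝕜] (z : 𝕜) : HasDerivAt serA (-serU z) z := by
  refine (hasDerivAt_entire (summable_norm_serA (𝕜 := 𝕜)) z).congr_deriv ?_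
  rw [serU, ← tsum_neg]
  refine tsum_congr fun k => ?_
  rw [Nat.factorial_succ]
  have h1 : (k.factorial : 𝕜) ≠ 0 := by exact_mod_cast k.factorial_ne_zero
  have h2 : ((k : 𝕜) + 1) ≠ 0 := by exact_mod_cast k.succ_ne_zero
  push_cast
  field_simp
  ring

lemma hasDerivAt_mul_serU {𝕜 : Type*} [RCLike 𝕜] (z : 𝕜) :
    HasDerivAt (fun w => w * serU w) (serA z) z := by
  have hU := hasDerivAt_entire (summable_norm_serU (𝕜 := 𝕜)) z
  have h := (hasDerivAt_id z).mul hU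
  refine h.congr_deriv (Eq.symm ?_)
  have hs : Summable fun k : ℕ =>
      (-1) ^ k / ((k.factorial : 𝕜) * ((k + 1).factorial : 𝕜)) * z ^ k :=
    summable_of_entire summable_norm_serU z
  have hsA : Summable fun k : ℕ => (-1) ^ k / ((k.factorial : 𝕜) * (k.factorial : 𝕜)) * z ^ k :=
    summable_of_entire summable_norm_serA z
  have e : ∀ k : ℕ, (-1) ^ k / ((k.factorial : 𝕜) * (k.factorial : 𝕜)) * z ^ k
      - (-1) ^ k / ((k.factorial : 𝕜) * ((k + 1).factorial : 𝕜)) * z ^ k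
      = (k : 𝕜) * ((-1) ^ k / ((k.factorial : 𝕜) * ((k + 1).factorial : 𝕜))) * z ^ k := by
    intro k
    have h1 : (k.factorial : 𝕜) ≠ 0 := by exact_mod_cast k.factorial_ne_zero
    have h2 : ((k : 𝕜) + 1) ≠ 0 := by exact_mod_cast k.succ_ne_zero
    rw [Nat.factorial_succ]
    push_cast
    field_simp
    ring
  have hd := hsA.sub hs
  have e2 : serA z - serU z = ∑' k : ℕ,
      (k : 𝕜) * ((-1) ^ k / ((k.factorial : 𝕜) * ((k + 1).factorial : 𝕜))) * z ^ k := by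
    rw [serA, serU, ← hsA.tsum_sub hs]
    exact tsum_congr e
  rw [← sub_eq_iff_eq_add', one_mul]
  change serA z - serU z = _
  rw [e2, Summable.tsum_eq_zero_add (by simpa only [e] using hd)]
  simp only [Nat.cast_zero, zero_mul, zero_add, id, ← tsum_mul_left]
  refine tsum_congr fun k => ?_
  push_cast
  ring

lemma continuous_serA {𝕜 : Type*} [RCLike 𝕜] : Continuous (serA : 𝕜 → 𝕜) :=
  continuous_iff_continuousAt.2 fun z => (hasDerivAt_serA z).continuousAt

lemma differentiable_serU {𝕜 : Type*} [RCLike 𝕜] : Differentiable 𝕜 (serU : 𝕜 → 𝕜) :=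
  fun z => (hasDerivAt_entire (summable_norm_serU (𝕜 := 𝕜)) z).differentiableAt

lemma continuous_serU {𝕜 : Type*} [RCLike 𝕜] : Continuous (serU : 𝕜 → 𝕜) :=
  differentiable_serU.continuous

@[simp] lemma serA_zero {𝕜 : Type*} [RCLike 𝕜] : serA (0 : 𝕜) = 1 := by
  rw [serA, tsum_eq_single 0 (fun k hk => by simp [hk])]; simp

@[simp] lemma serU_zero {𝕜 : Type*} [RCLike 𝕜] : serU (0 : 𝕜) = 1 := by
  rw [serU, tsum_eq_single 0 (fun k hk => by simp [hk])]; simp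

lemma serA_ofReal (x : ℝ) : serA (x : ℂ) = (serA x : ℝ) := by
  rw [serA, serA, Complex.ofReal_tsum]; push_cast; rfl

lemma serU_ofReal (x : ℝ) : serU (x : ℂ) = (serU x : ℝ) := by
  rw [serU, serU, Complex.ofReal_tsum]; push_cast; rfl

lemma besselJ_zero_eq (x : ℝ) : besselJ 0 x = serA (x ^ 2 / 4) := by
  rw [besselJ, serA]
  refine tsum_congr fun k => ?_
  rw [add_zero, add_zero, pow_mul]
  congr 2; ring

lemma besselJ_one_eq (x : ℝ) : besselJ 1 x = x / 2 * serU (x ^ 2 / 4) := by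
  rw [besselJ, serU, ← tsum_mul_left]
  refine tsum_congr fun k => ?_
  rw [pow_succ, pow_mul, show (x / 2) ^ 2 = x ^ 2 / 4 by ring]; ring

/-! ### The first zero of `J_0` -/

/-- The first four terms of the series of `A(2)` add up to `-2/9`, and the remainder is dominated by
a geometric series of sum `1/18`. -/
lemma serA_two_neg : serA (2 : ℝ) < 0 := by
  have hs : Summable fun k : ℕ => (-1) ^ k / ((k.factorial : ℝ) * (k.factorial : ℝ)) * 2 ^ k :=
    summable_of_entire summable_norm_serA 2
  have hb : ∀ k : ℕ, ‖(-1) ^ (k + 4) / (((k + 4).factorial : ℝ) * ((k + 4).factorial : ℝ))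
      * 2 ^ (k + 4)‖ ≤ 1 / 36 * (1 / 2) ^ k := by
    intro k
    induction k with
    | zero => norm_num [Nat.factorial]
    | succ k ih =>
      have e : ‖(-1) ^ (k + 1 + 4) / (((k + 1 + 4).factorial : ℝ) * ((k + 1 + 4).factorial : ℝ))
          * 2 ^ (k + 1 + 4)‖ = ‖(-1) ^ (k + 4) / (((k + 4).factorial : ℝ) * ((k + 4).factorial : ℝ))
          * 2 ^ (k + 4)‖ * (2 / ((k : ℝ) + 5) ^ 2) := by
        rw [show k + 1 + 4 = (k + 4) + 1 by ring, Nat.factorial_succ]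
        have h5 : ‖(k : ℝ) + 4 + 1‖ = (k : ℝ) + 5 := by
          rw [Real.norm_of_nonneg (by positivity)]; ring
        push_cast
        simp only [norm_mul, norm_div, norm_pow, norm_neg, norm_one, one_pow, RCLike.norm_natCast,
          RCLike.norm_ofNat, h5]
        field_simp
        ring
      rw [e, pow_succ (1 / 2 : ℝ) k]
      have h5 : 2 / ((k : ℝ) + 5) ^ 2 ≤ 1 / 2 := by
        rw [div_le_div_iff₀ (by positivity) (by norm_num)]
        have : (0 : ℝ) ≤ k := k.cast_nonneg
        nlinarith
      exact (mul_le_mul ih h5 (by positivity) (by positivity)).trans_eq (by ring)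
  have ht : ‖∑' k : ℕ, (-1) ^ (k + 4) / (((k + 4).factorial : ℝ) * ((k + 4).factorial : ℝ))
      * 2 ^ (k + 4)‖ ≤ 1 / 18 := by
    have hg := (hasSum_geometric_of_lt_one (r := (1 / 2 : ℝ)) (by norm_num) (by norm_num)).mul_left
      (1 / 36)
    refine (tsum_of_norm_bounded hg hb).trans (by norm_num)
  rw [serA, ← hs.sum_add_tsum_nat_add 4]
  have := (abs_le.1 (Real.norm_eq_abs _ ▸ ht)).2
  norm_num [Finset.sum_range_succ, Nat.factorial] at this ⊢
  linarith

/-- The infimum defining `c₀` is a positive zero of `J₀`, and `A(x² / 4)` is positive before it.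
That there is a zero below `√8` follows from `A(2) < 0`. -/
lemma c₀_spec : 0 < c₀ ∧ c₀ ^ 2 / 4 < 2 ∧ serA (c₀ ^ 2 / 4) = 0 ∧
    ∀ x, 0 ≤ x → x < c₀ → 0 < serA (x ^ 2 / 4) := by
  set S : Set ℝ := {x : ℝ | 0 < x ∧ besselJ 0 x = 0} with hS
  have hc : Continuous fun x : ℝ => serA (x ^ 2 / 4) := continuous_serA.comp (by fun_prop)
  have hbdd : BddBelow S := ⟨0, fun x hx => hx.1.le⟩
  have h2 : serA ((Real.sqrt 8) ^ 2 / 4) < 0 := by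
    rw [Real.sq_sqrt (by norm_num)]; norm_num; exact serA_two_neg
  have hne : ∃ x ∈ S, x < Real.sqrt 8 := by
    have h0 : (0 : ℝ) ≤ Real.sqrt 8 := Real.sqrt_nonneg 8
    obtain ⟨x, hx, hx0⟩ := intermediate_value_Icc' h0 hc.continuousOn
      (show (0 : ℝ) ∈ Set.Icc _ _ from ⟨h2.le, by simp⟩)
    have hx0 : serA (x ^ 2 / 4) = 0 := hx0
    refine ⟨x, ⟨?_, by rw [besselJ_zero_eq, hx0]⟩, ?_⟩
    · rcases hx.1.eq_or_lt with h | h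
      · rw [← h] at hx0; simp at hx0
      · exact h
    · rcases hx.2.eq_or_lt with h | h
      · rw [h] at hx0; linarith
      · exact h
  obtain ⟨w, hwS, hw⟩ := hne
  have hclosed : serA (c₀ ^ 2 / 4) = 0 := by
    have hcl : IsClosed {x : ℝ | serA (x ^ 2 / 4) = 0} := isClosed_eq hc continuous_const
    have hmem : c₀ ∈ closure S := csInf_mem_closure ⟨w, hwS⟩ hbdd
    have : S ⊆ {x : ℝ | serA (x ^ 2 / 4) = 0} := fun x hx => by
      have := hx.2; rwa [besselJ_zero_eq] at this
    exact (hcl.closure_subset_iff.2 this) hmem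
  have h0 : 0 ≤ c₀ := le_csInf ⟨w, hwS⟩ fun x hx => hx.1.le
  have hpos : 0 < c₀ := by
    rcases h0.eq_or_lt with h | h
    · rw [← h] at hclosed; simp at hclosed
    · exact h
  have hle : c₀ ≤ w := csInf_le hbdd hwS
  refine ⟨hpos, ?_, hclosed, fun x hx hxc => ?_⟩
  · have : c₀ ^ 2 < 8 := by
      calc c₀ ^ 2 < (Real.sqrt 8) ^ 2 := by gcongr; linarith
        _ = 8 := Real.sq_sqrt (by norm_num)
    linarith
  · by_contra hcon
    push Not at hcon
    obtain ⟨y, hy, hy0⟩ := intermediate_value_Icc' hx hc.continuousOn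
      (show (0 : ℝ) ∈ Set.Icc _ _ from ⟨hcon, by simp⟩)
    have hy0 : serA (y ^ 2 / 4) = 0 := hy0
    have hyp : 0 < y := by
      rcases hy.1.eq_or_lt with h | h
      · rw [← h] at hy0; simp at hy0
      · exact h
    have : c₀ ≤ y := csInf_le hbdd ⟨hyp, by rw [besselJ_zero_eq, hy0]⟩
    linarith [hy.2]

/-- The first zero `c₀² / 4` of `A`. -/
def z₀ : ℝ := c₀ ^ 2 / 4

lemma z₀_pos : 0 < z₀ := by have := c₀_spec.1; unfold z₀; positivity

lemma z₀_lt_two : z₀ < 2 := c₀_spec.2.1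

lemma serA_z₀ : serA z₀ = 0 := c₀_spec.2.2.1

lemma serA_pos {z : ℝ} (h0 : 0 ≤ z) (h : z < z₀) : 0 < serA z := by
  have hs : (2 * Real.sqrt z) ^ 2 / 4 = z := by rw [mul_pow, Real.sq_sqrt h0]; ring
  have := c₀_spec.2.2.2 (2 * Real.sqrt z) (by positivity) (by
    refine lt_of_pow_lt_pow_left₀ 2 c₀_spec.1.le ?_
    unfold z₀ at h; linarith)
  rwa [hs] at this

lemma serA_nonneg {z : ℝ} (h0 : 0 ≤ z) (h : z ≤ z₀) : 0 ≤ serA z := by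
  rcases h.eq_or_lt with h | h
  · rw [h, serA_z₀]
  · exact (serA_pos h0 h).le

/-- The derivative `A` of `z U(z)` is positive before its first zero `z₀`. -/
lemma strictMonoOn_mul_serU : StrictMonoOn (fun z : ℝ => z * serU z) (Set.Icc 0 z₀) := by
  refine strictMonoOn_of_deriv_pos (convex_Icc _ _) (continuous_id.mul continuous_serU).continuousOn
    fun z hz => ?_
  rw [interior_Icc] at hz
  rw [(hasDerivAt_mul_serU z).deriv]
  exact serA_pos hz.1.le hz.2

lemma serU_pos {z : ℝ} (h0 : 0 ≤ z) (h : z ≤ z₀) : 0 < serU z := by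
  rcases h0.eq_or_lt with h0 | h0
  · rw [← h0]; simp
  · have := strictMonoOn_mul_serU ⟨le_rfl, z₀_pos.le⟩ ⟨h0.le, h⟩ h0
    simp only [zero_mul] at this
    exact pos_of_mul_pos_right this h0.le

lemma antitoneOn_serA : AntitoneOn (serA : ℝ → ℝ) (Set.Icc 0 z₀) := by
  refine antitoneOn_of_deriv_nonpos (convex_Icc _ _) continuous_serA.continuousOn
    (fun z _ => (hasDerivAt_serA z).differentiableAt.differentiableWithinAt) fun z hz => ?_
  rw [interior_Icc] at hz
  rw [(hasDerivAt_serA z).deriv]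
  exact neg_nonpos.2 (serU_pos hz.1.le hz.2.le).le

lemma serA_le_one {z : ℝ} (h0 : 0 ≤ z) (h : z ≤ z₀) : serA z ≤ 1 := by
  simpa using antitoneOn_serA ⟨le_rfl, z₀_pos.le⟩ ⟨h0, h⟩ h0

lemma serU_le_one {z : ℝ} (h0 : 0 ≤ z) (h : z ≤ z₀) : serU z ≤ 1 := by
  rcases h0.eq_or_lt with h0' | h0'
  · rw [← h0']; simp
  -- the mean value theorem for `z * U z`, whose derivative `A` is at most `1`
  have := Convex.image_sub_le_mul_sub_of_deriv_le (convex_Icc 0 z₀) (C := 1)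
    (f := fun z : ℝ => z * serU z) (continuous_id.mul continuous_serU).continuousOn
    (fun z _ => (hasDerivAt_mul_serU z).differentiableAt.differentiableWithinAt)
    (fun z hz => by
      rw [interior_Icc] at hz
      rw [(hasDerivAt_mul_serU z).deriv]
      exact serA_le_one hz.1.le hz.2.le) 0 ⟨le_rfl, z₀_pos.le⟩ z ⟨h0, h⟩ h0
  simp only [zero_mul, sub_zero, one_mul] at this
  nlinarith

lemma xc_eq : xc = z₀ * serU z₀ / Real.pi ^ 2 := by
  rw [xc, besselJ_one_eq, z₀]; field_simp; ring

lemma xc_pos : 0 < xc := by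
  rw [xc_eq]
  have := serU_pos z₀_pos.le le_rfl
  have := z₀_pos
  positivity

lemma Finf_eq (θ : ℝ) : Finf θ = serA (z₀ / Real.pi ^ 2 * θ ^ 2) := by
  rw [Finf, besselJ_zero_eq, z₀]; congr 1; field_simp

/-! ### Convolutions of even entire functions -/

/-- Euler's Beta integral with integer parameters, on `[0, s]`. -/
lemma integral_pow_mul_sub_pow (p q : ℕ) (s : ℝ) :
    ∫ t in (0 : ℝ)..s, t ^ p * (s - t) ^ q
      = p.factorial * q.factorial / (p + q + 1).factorial * s ^ (p + q + 1) := by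
  induction q generalizing p with
  | zero =>
    simp only [pow_zero, mul_one, integral_pow, Nat.factorial_zero, Nat.cast_one, add_zero,
      Nat.factorial_succ]
    have h1 : (p.factorial : ℝ) ≠ 0 := by exact_mod_cast p.factorial_ne_zero
    push_cast
    field_simp
    simp
  | succ q ih =>
    have hp : ((p : ℝ) + 1) ≠ 0 := by positivity
    have hu : ∀ x ∈ Set.uIcc 0 s, HasDerivAt (fun t : ℝ => (s - t) ^ (q + 1))
        (-(((q : ℝ) + 1) * (s - x) ^ q)) x := fun x _ => by
      have := ((hasDerivAt_id x).const_sub s).pow (q + 1)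
      exact this.congr_deriv (by push_cast; simp)
    have hv : ∀ x ∈ Set.uIcc 0 s, HasDerivAt (fun t : ℝ => t ^ (p + 1) / ((p : ℝ) + 1))
        (x ^ p) x := fun x _ => by
      have := (hasDerivAt_pow (p + 1) x).div_const ((p : ℝ) + 1)
      refine this.congr_deriv ?_
      push_cast
      field_simp
    have h := intervalIntegral.integral_mul_deriv_eq_deriv_mul hu hv
      (Continuous.intervalIntegrable (by fun_prop) _ _)
      (Continuous.intervalIntegrable (by fun_prop) _ _)
    have e1 : ∫ t in (0 : ℝ)..s, t ^ p * (s - t) ^ (q + 1)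
        = ∫ t in (0 : ℝ)..s, (s - t) ^ (q + 1) * t ^ p := by
      congr 1; ext t; ring
    have e2 : ∫ x in (0 : ℝ)..s, -(((q : ℝ) + 1) * (s - x) ^ q) * (x ^ (p + 1) / ((p : ℝ) + 1))
        = -(((q : ℝ) + 1) / (p + 1)) * ∫ t in (0 : ℝ)..s, t ^ (p + 1) * (s - t) ^ q := by
      rw [← intervalIntegral.integral_const_mul]
      congr 1; ext t; field_simp
    rw [e1, h, e2, ih (p + 1)]
    have h3 : ((p + 1 + q + 1).factorial : ℝ) ≠ 0 := by
      exact_mod_cast (p + 1 + q + 1).factorial_ne_zero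
    rw [show p + (q + 1) + 1 = p + 1 + q + 1 by ring, Nat.factorial_succ p, Nat.factorial_succ q]
    simp only [sub_self, ne_eq, Nat.add_eq_zero_iff, one_ne_zero, and_false, not_false_eq_true,
      zero_pow, zero_mul, zero_div, mul_zero]
    push_cast
    field_simp
    ring

/-- The even function `∑ a_k s^(2k) / (2k)!`. -/
def evenSer (a : ℕ → ℝ) (s : ℝ) : ℝ := ∑' k : ℕ, a k * s ^ (2 * k) / (2 * k).factorial

lemma summable_pow_div_two_mul_factorial (C M r : ℝ) :
    Summable fun k : ℕ => C * M ^ k * |r| ^ k / (2 * k).factorial := by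
  refine Summable.of_norm_bounded ((Real.summable_pow_div_factorial (|M| * |r|)).mul_left |C|)
    fun k => ?_
  rw [norm_div, norm_mul, norm_mul, norm_pow, norm_pow, Real.norm_eq_abs, Real.norm_eq_abs,
    Real.norm_eq_abs, abs_abs, mul_assoc, ← mul_pow, mul_div_assoc]
  simp only [RCLike.norm_natCast]
  have : ((k.factorial : ℕ) : ℝ) ≤ (2 * k).factorial := by
    exact_mod_cast Nat.factorial_le (by omega)
  gcongr

lemma summable_evenSer {a : ℕ → ℝ} {C M : ℝ} (ha : ∀ k, |a k| ≤ C * M ^ k) (s : ℝ) :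
    Summable fun k : ℕ => ‖a k * s ^ (2 * k) / (2 * k).factorial‖ := by
  refine Summable.of_nonneg_of_le (fun k => norm_nonneg _) (fun k => ?_)
    (summable_pow_div_two_mul_factorial C M (s ^ 2))
  rw [norm_div, norm_mul, norm_pow, Real.norm_eq_abs, Real.norm_eq_abs, RCLike.norm_natCast,
    pow_mul, abs_pow]
  gcongr
  exact ha k

lemma hasDerivAt_evenSer {a : ℕ → ℝ} {C M : ℝ} (ha : ∀ k, |a k| ≤ C * M ^ k) (s : ℝ) :
    HasDerivAt (evenSer a)
      (∑' k : ℕ, a (k + 1) * s ^ (2 * k + 1) / (2 * k + 1).factorial) s := by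
  have hent : ∀ r : ℝ, Summable fun k => ‖a k / (2 * k).factorial‖ * r ^ k := by
    intro r
    refine Summable.of_norm_bounded (summable_pow_div_two_mul_factorial C M r) fun k => ?_
    rw [norm_mul, norm_norm, norm_div, norm_pow, Real.norm_eq_abs, Real.norm_eq_abs r,
      RCLike.norm_natCast, div_mul_eq_mul_div]
    gcongr
    exact ha k
  have h := (hasDerivAt_entire hent (s ^ 2)).comp s (hasDerivAt_pow 2 s)
  have hfun : evenSer a
      = (fun w => ∑' k : ℕ, a k / (2 * k).factorial * w ^ k) ∘ (fun s => s ^ 2) := by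
    ext s
    simp only [evenSer, Function.comp]
    exact tsum_congr fun k => by rw [pow_mul]; ring
  rw [hfun]
  refine h.congr_deriv ?_
  rw [← tsum_mul_right]
  refine tsum_congr fun k => ?_
  rw [show 2 * (k + 1) = 2 * k + 1 + 1 by ring, Nat.factorial_succ (2 * k + 1)]
  have h3 : ((2 * k + 1).factorial : ℝ) ≠ 0 := by exact_mod_cast Nat.factorial_ne_zero _
  push_cast
  rw [← pow_mul]
  field_simp
  ring

/-- Convolving two even functions amounts to taking the Cauchy product of their coefficients. -/
lemma integral_evenSer_mul_evenSer {a b : ℕ → ℝ} {C M C' M' : ℝ}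
    (ha : ∀ k, |a k| ≤ C * M ^ k) (hb : ∀ k, |b k| ≤ C' * M' ^ k) {s : ℝ} (hs : 0 ≤ s) :
    ∫ t in (0 : ℝ)..s, evenSer a t * evenSer b (s - t)
      = ∑' k : ℕ, (∑ p ∈ Finset.HasAntidiagonal.antidiagonal k, a p.1 * b p.2) * s ^ (2 * k + 1)
          / (2 * k + 1).factorial := by
  set f : ℕ × ℕ → ℝ → ℝ := fun p t => (a p.1 * t ^ (2 * p.1) / (2 * p.1).factorial)
    * (b p.2 * (s - t) ^ (2 * p.2) / (2 * p.2).factorial) with hf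
  have hmaj : Summable fun p : ℕ × ℕ => ‖a p.1 * s ^ (2 * p.1) / (2 * p.1).factorial‖
      * ‖b p.2 * s ^ (2 * p.2) / (2 * p.2).factorial‖ :=
    (summable_evenSer ha s).mul_of_nonneg (summable_evenSer hb s)
      (fun _ => norm_nonneg _) (fun _ => norm_nonneg _)
  have hint : HasSum (fun p => ∫ t in (0 : ℝ)..s, f p t)
      (∫ t in (0 : ℝ)..s, evenSer a t * evenSer b (s - t)) := by
    refine intervalIntegral.hasSum_integral_of_dominated_convergence
      (fun p _ => ‖a p.1 * s ^ (2 * p.1) / (2 * p.1).factorial‖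
      * ‖b p.2 * s ^ (2 * p.2) / (2 * p.2).factorial‖) (fun p => ?_) (fun p => ?_) ?_ ?_ ?_
    · exact Continuous.aestronglyMeasurable (by fun_prop)
    · refine Eventually.of_forall fun t ht => ?_
      rw [Set.uIoc_of_le hs] at ht
      have h1 : |t| ≤ |s| := by rw [abs_of_pos ht.1, abs_of_nonneg hs]; exact ht.2
      have h2 : |s - t| ≤ |s| := by
        rw [abs_of_nonneg (by linarith [ht.2]), abs_of_nonneg hs]; linarith [ht.1]
      simp only [hf, norm_mul, norm_div, norm_pow, Real.norm_eq_abs]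
      gcongr
    · exact Eventually.of_forall fun t _ => hmaj
    · exact intervalIntegrable_const
    · refine Eventually.of_forall fun t _ => ?_
      have h1 := summable_evenSer ha t
      have h2 := summable_evenSer hb (s - t)
      have := (summable_mul_of_summable_norm h1 h2).hasSum
      rwa [← tsum_mul_tsum_of_summable_norm h1 h2] at this
  have hval : ∀ p : ℕ × ℕ, ∫ t in (0 : ℝ)..s, f p t
      = a p.1 * b p.2 * s ^ (2 * (p.1 + p.2) + 1) / (2 * (p.1 + p.2) + 1).factorial := by
    intro p
    have e : ∀ t, f p t = (a p.1 * b p.2 / ((2 * p.1).factorial * (2 * p.2).factorial))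
        * (t ^ (2 * p.1) * (s - t) ^ (2 * p.2)) := fun t => by simp only [hf]; field_simp
    simp only [e, intervalIntegral.integral_const_mul, integral_pow_mul_sub_pow]
    rw [show 2 * p.1 + 2 * p.2 + 1 = 2 * (p.1 + p.2) + 1 by ring]
    have h1 : ((2 * p.1).factorial : ℝ) ≠ 0 := by exact_mod_cast Nat.factorial_ne_zero _
    have h2 : ((2 * p.2).factorial : ℝ) ≠ 0 := by exact_mod_cast Nat.factorial_ne_zero _
    field_simp
  -- the double series over `(i, j)` is summed along the antidiagonals `i + j = k`
  simp only [hval] at hint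
  rw [← hint.tsum_eq, ← Finset.HasAntidiagonal.sigmaAntidiagonalEquivProd.tsum_eq]
  have hsum := (Finset.HasAntidiagonal.sigmaAntidiagonalEquivProd.summable_iff.2 hint.summable)
  refine hsum.tsum_sigma.trans ?_
  refine tsum_congr fun k => ?_
  rw [tsum_fintype, Finset.sum_mul, Finset.sum_div]
  refine Eq.trans ?_ (Finset.sum_coe_sort _ _)
  refine Finset.sum_congr rfl fun p _ => ?_
  have := Finset.HasAntidiagonal.mem_antidiagonal.1 p.2
  simp only [Function.comp, Finset.HasAntidiagonal.sigmaAntidiagonalEquivProd_apply, this]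

/-! ### The integral equations for `F` and for `F_∞` -/

/-- The function `y U(y θ²)`, which is `F(x; θ)` if `x` is its value at `θ = π`. -/
def genU (y θ : ℝ) : ℝ := y * serU (y * θ ^ 2)

lemma factorial_two_mul_eq (k : ℕ) :
    ((2 * k).factorial : ℝ) = k.centralBinom * (k.factorial * k.factorial) := by
  have := Nat.add_choose_mul_factorial_mul_factorial k k
  rw [← two_mul, ← Nat.centralBinom_eq_two_mul_choose] at this
  rw [← this]; push_cast; ring

lemma serA_eq_evenSer (y θ : ℝ) :
    serA (y * θ ^ 2) = evenSer (fun k => (-y) ^ k * k.centralBinom) θ := by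
  rw [serA, evenSer]
  refine tsum_congr fun k => ?_
  rw [factorial_two_mul_eq]
  have h1 : (k.factorial : ℝ) ≠ 0 := by exact_mod_cast k.factorial_ne_zero
  have h2 : (k.centralBinom : ℝ) ≠ 0 := by exact_mod_cast k.centralBinom_ne_zero
  rw [mul_pow, pow_mul, neg_pow y]
  field_simp

lemma genU_eq_evenSer (y θ : ℝ) :
    genU y θ = evenSer (fun k => y * ((-y) ^ k * catalan k)) θ := by
  rw [genU, serU, evenSer, ← tsum_mul_left]
  refine tsum_congr fun k => ?_
  have h3 : ((k : ℝ) + 1) * catalan k = k.centralBinom := by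
    exact_mod_cast succ_mul_catalan_eq_centralBinom k
  rw [factorial_two_mul_eq, Nat.factorial_succ, ← h3]
  have h1 : (k.factorial : ℝ) ≠ 0 := by exact_mod_cast k.factorial_ne_zero
  have h2 : (catalan k : ℝ) ≠ 0 := by
    have := k.centralBinom_ne_zero
    rw [← succ_mul_catalan_eq_centralBinom] at this
    exact_mod_cast (mul_ne_zero_iff.1 this).2
  have h4 : ((k : ℝ) + 1) ≠ 0 := by positivity
  push_cast
  rw [mul_pow, pow_mul, neg_pow y]
  field_simp

lemma abs_coeff_serA_le (y : ℝ) (k : ℕ) :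
    |(-y) ^ k * (k.centralBinom : ℝ)| ≤ 1 * (4 * |y|) ^ k := by
  rw [abs_mul, abs_pow, abs_neg, mul_pow, one_mul, mul_comm, Nat.abs_cast]
  gcongr
  have h := Nat.choose_le_two_pow (2 * k) k
  rw [← Nat.centralBinom_eq_two_mul_choose, pow_mul] at h
  exact_mod_cast h

lemma abs_coeff_genU_le (y : ℝ) (k : ℕ) :
    |y * ((-y) ^ k * (catalan k : ℝ))| ≤ |y| * (4 * |y|) ^ k := by
  rw [abs_mul]
  gcongr
  refine le_trans ?_ ((abs_coeff_serA_le y k).trans_eq (one_mul _))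
  rw [abs_mul, abs_mul, Nat.abs_cast, Nat.abs_cast]
  gcongr
  rw [← succ_mul_catalan_eq_centralBinom]
  exact Nat.le_mul_of_pos_left _ k.succ_pos

/-- Since `centralBinom j = (j + 1) * catalan j`, twice the sum is, by symmetry in `(i, j)`, the sum
of `(k + 2) * catalan i * catalan j`, which the recursion of the Catalan numbers evaluates. -/
lemma sum_antidiagonal_catalan_mul_centralBinom (k : ℕ) :
    2 * ∑ p ∈ Finset.HasAntidiagonal.antidiagonal k, catalan p.1 * p.2.centralBinom
      = (k + 1).centralBinom := by
  have h1 : ∑ p ∈ Finset.HasAntidiagonal.antidiagonal k, catalan p.1 * p.2.centralBinom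
      = ∑ p ∈ Finset.HasAntidiagonal.antidiagonal k, (p.2 + 1) * (catalan p.1 * catalan p.2) :=
    Finset.sum_congr rfl fun p _ => by
      rw [← succ_mul_catalan_eq_centralBinom]; ring
  have h2 : ∑ p ∈ Finset.HasAntidiagonal.antidiagonal k, (p.2 + 1) * (catalan p.1 * catalan p.2)
      = ∑ p ∈ Finset.HasAntidiagonal.antidiagonal k, (p.1 + 1) * (catalan p.1 * catalan p.2) := by
    rw [← Finset.Nat.sum_antidiagonal_swap]
    exact Finset.sum_congr rfl fun p _ => by simp only [Prod.fst_swap, Prod.snd_swap]; ring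
  have h3 : ∑ p ∈ Finset.HasAntidiagonal.antidiagonal k, (p.2 + 1) * (catalan p.1 * catalan p.2)
      + ∑ p ∈ Finset.HasAntidiagonal.antidiagonal k, (p.1 + 1) * (catalan p.1 * catalan p.2)
      = (k + 2) * catalan (k + 1) := by
    rw [← Finset.sum_add_distrib, catalan_succ', Finset.mul_sum]
    refine Finset.sum_congr rfl fun p hp => ?_
    rw [← Finset.HasAntidiagonal.mem_antidiagonal.1 hp]; ring
  rw [two_mul]
  nth_rewrite 2 [h1]
  rw [h1, ← succ_mul_catalan_eq_centralBinom, ← h3]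
  omega

/-- The integral equation of `F`, differentiated in `θ`. On coefficients it is the recursion of the
Catalan numbers. -/
lemma hasDerivAt_genU (y : ℝ) {s : ℝ} (hs : 0 ≤ s) :
    HasDerivAt (genU y) (-∫ t in (0 : ℝ)..s, genU y t * genU y (s - t)) s := by
  have hfun : genU y = evenSer (fun k => y * ((-y) ^ k * catalan k)) :=
    funext fun θ => genU_eq_evenSer y θ
  rw [hfun]
  refine (hasDerivAt_evenSer (abs_coeff_genU_le y) s).congr_deriv ?_
  rw [integral_evenSer_mul_evenSer (abs_coeff_genU_le y) (abs_coeff_genU_le y) hs, ← tsum_neg]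
  refine tsum_congr fun k => ?_
  have : ∑ p ∈ Finset.HasAntidiagonal.antidiagonal k,
      y * ((-y) ^ p.1 * (catalan p.1 : ℝ)) * (y * ((-y) ^ p.2 * (catalan p.2 : ℝ)))
      = -(y * ((-y) ^ (k + 1) * (catalan (k + 1) : ℝ))) := by
    rw [catalan_succ', Nat.cast_sum, Finset.mul_sum, Finset.mul_sum, ← Finset.sum_neg_distrib]
    refine Finset.sum_congr rfl fun p hp => ?_
    rw [pow_succ, ← Finset.HasAntidiagonal.mem_antidiagonal.1 hp, pow_add]
    push_cast
    ring
  rw [this]; ring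

/-- `A(y s²)` solves the linearization of the equation of `genU`. On coefficients this is
`sum_antidiagonal_catalan_mul_centralBinom`. -/
lemma hasDerivAt_serA_sq (y : ℝ) {s : ℝ} (hs : 0 ≤ s) :
    HasDerivAt (fun s => serA (y * s ^ 2))
      (-(2 * ∫ t in (0 : ℝ)..s, genU y t * serA (y * (s - t) ^ 2))) s := by
  have hfun : (fun s => serA (y * s ^ 2)) = evenSer (fun k => (-y) ^ k * k.centralBinom) :=
    funext fun θ => serA_eq_evenSer y θ
  rw [hfun]
  refine (hasDerivAt_evenSer (abs_coeff_serA_le y) s).congr_deriv ?_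
  simp only [genU_eq_evenSer, serA_eq_evenSer]
  rw [integral_evenSer_mul_evenSer (abs_coeff_genU_le y) (abs_coeff_serA_le y) hs,
    ← tsum_mul_left, ← tsum_neg]
  refine tsum_congr fun k => ?_
  have : 2 * ∑ p ∈ Finset.HasAntidiagonal.antidiagonal k,
      y * ((-y) ^ p.1 * (catalan p.1 : ℝ)) * ((-y) ^ p.2 * (p.2.centralBinom : ℝ))
      = -((-y) ^ (k + 1) * ((k + 1).centralBinom : ℝ)) := by
    rw [← sum_antidiagonal_catalan_mul_centralBinom]
    push_cast
    rw [Finset.mul_sum, Finset.mul_sum, Finset.mul_sum, ← Finset.sum_neg_distrib]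
    refine Finset.sum_congr rfl fun p hp => ?_
    rw [pow_succ, ← Finset.HasAntidiagonal.mem_antidiagonal.1 hp, pow_add]
    ring
  rw [mul_div_assoc, mul_div_assoc, ← mul_assoc, this, neg_mul, neg_neg]

lemma continuous_genU (y : ℝ) : Continuous (genU y) :=
  continuous_const.mul (continuous_serU.comp (by fun_prop))

/-! ### Positivity of the coefficients of `1 / U` -/

/-- The power series `U`. -/
def psU : PowerSeries ℝ :=
  PowerSeries.mk fun k => (-1) ^ k / ((k.factorial : ℝ) * ((k + 1).factorial : ℝ))

/-- The coefficients of the power series `1 / U`. -/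
def phi (k : ℕ) : ℝ := PowerSeries.coeff k psU⁻¹

/-- The power series `-U' / U`. -/
def psV : PowerSeries ℝ := -(PowerSeries.derivative ℝ psU) * psU⁻¹

lemma psU_mul_inv : psU * psU⁻¹ = 1 :=
  PowerSeries.mul_inv_cancel _ (by simp [psU])

lemma derivative_inv_psU :
    PowerSeries.derivative ℝ psU⁻¹ = psV * psU⁻¹ := by
  have h := congrArg (PowerSeries.derivative ℝ) psU_mul_inv
  simp only [Derivation.leibniz, smul_eq_mul, Derivation.map_one_eq_zero] at h
  have h1 := psU_mul_inv
  rw [psV]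
  linear_combination psU⁻¹ * h - (PowerSeries.derivative ℝ psU⁻¹) * h1

/-- The Riccati equation of `V = -U' / U`, which comes from the equation `z U'' + 2 U' + U = 0`. -/
lemma psV_riccati :
    PowerSeries.X * PowerSeries.derivative ℝ psV + 2 * psV = 1 + PowerSeries.X * psV ^ 2 := by
  have hode : PowerSeries.X * PowerSeries.derivative ℝ (PowerSeries.derivative ℝ psU)
      + 2 * PowerSeries.derivative ℝ psU + psU = 0 := by
    ext k
    have e2 : (2 : PowerSeries ℝ) = PowerSeries.C 2 := (map_ofNat PowerSeries.C 2).symm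
    rw [map_add, map_add, e2, PowerSeries.coeff_C_mul]
    have hk : ∀ k : ℕ, (k.factorial : ℝ) ≠ 0 := fun k => by exact_mod_cast k.factorial_ne_zero
    rcases k with _ | k
    · simp [psU, PowerSeries.coeff_derivative]; norm_num
    · rw [PowerSeries.coeff_succ_X_mul]
      simp only [psU, PowerSeries.coeff_derivative, PowerSeries.coeff_mk, map_zero]
      have h1 := hk k
      have h3 : ((k : ℝ) + 1) ≠ 0 := by positivity
      have h4 : ((k : ℝ) + 1 + 1) ≠ 0 := by positivity
      have h5 : ((k : ℝ) + 1 + 1 + 1) ≠ 0 := by positivity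
      simp only [Nat.factorial_succ]
      push_cast
      field_simp
      ring
  have h1 := psU_mul_inv
  have hv : PowerSeries.derivative ℝ psV
      = -(PowerSeries.derivative ℝ (PowerSeries.derivative ℝ psU)) * psU⁻¹ + psV ^ 2 := by
    conv_lhs => rw [psV]
    rw [Derivation.leibniz, derivative_inv_psU]
    simp only [smul_eq_mul, map_neg]
    rw [psV]; ring
  rw [hv]
  have h2 : psV = -(PowerSeries.derivative ℝ psU) * psU⁻¹ := rfl
  linear_combination (-psU⁻¹) * hode + 2 * h2 + h1

lemma coeff_psV_rec (k : ℕ) : ((k : ℝ) + 3) * PowerSeries.coeff (k + 1) psV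
    = ∑ p ∈ Finset.HasAntidiagonal.antidiagonal k,
      PowerSeries.coeff p.1 psV * PowerSeries.coeff p.2 psV := by
  have h := congrArg (PowerSeries.coeff (k + 1)) psV_riccati
  have e2 : (2 : PowerSeries ℝ) = PowerSeries.C 2 := (map_ofNat PowerSeries.C 2).symm
  rw [map_add, map_add, PowerSeries.coeff_succ_X_mul, PowerSeries.coeff_succ_X_mul, e2,
    PowerSeries.coeff_C_mul, PowerSeries.coeff_derivative, sq, PowerSeries.coeff_mul] at h
  simp only [PowerSeries.coeff_one, Nat.add_eq_zero_iff, one_ne_zero, and_false, if_false,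
    zero_add] at h
  rw [← h]; ring

lemma coeff_psV_zero : PowerSeries.coeff 0 psV = 1 / 2 := by
  have h := congrArg (PowerSeries.coeff 0) psV_riccati
  have e2 : (2 : PowerSeries ℝ) = PowerSeries.C 2 := (map_ofNat PowerSeries.C 2).symm
  rw [map_add, map_add, PowerSeries.coeff_zero_X_mul, PowerSeries.coeff_zero_X_mul, e2,
    PowerSeries.coeff_C_mul] at h
  simp only [PowerSeries.coeff_one, if_true] at h
  linarith

/-- The Riccati equation expresses each coefficient of `V` by products of earlier ones, with
positive factors. -/
lemma coeff_psV_bounds (k : ℕ) :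
    0 ≤ PowerSeries.coeff k psV ∧ PowerSeries.coeff k psV ≤ (1 / 2) ^ (k + 1) := by
  induction k using Nat.strong_induction_on with
  | _ k ih =>
    rcases k with _ | k
    · rw [coeff_psV_zero]; norm_num
    · have h := coeff_psV_rec k
      have hk : (0 : ℝ) < (k : ℝ) + 3 := by positivity
      have hlt : ∀ p ∈ Finset.HasAntidiagonal.antidiagonal k, p.1 < k + 1 ∧ p.2 < k + 1 :=
        fun p hp => by
          have := Finset.HasAntidiagonal.mem_antidiagonal.1 hp; omega
      have h0 : 0 ≤ ∑ p ∈ Finset.HasAntidiagonal.antidiagonal k,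
          PowerSeries.coeff p.1 psV * PowerSeries.coeff p.2 psV :=
        Finset.sum_nonneg fun p hp => mul_nonneg (ih _ (hlt p hp).1).1 (ih _ (hlt p hp).2).1
      have h1 : ∑ p ∈ Finset.HasAntidiagonal.antidiagonal k,
          PowerSeries.coeff p.1 psV * PowerSeries.coeff p.2 psV
          ≤ ∑ p ∈ Finset.HasAntidiagonal.antidiagonal k, (1 / 2 : ℝ) ^ (k + 2) := by
        refine Finset.sum_le_sum fun p hp => ?_
        have := Finset.HasAntidiagonal.mem_antidiagonal.1 hp
        rw [show k + 2 = (p.1 + 1) + (p.2 + 1) by omega, pow_add]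
        exact mul_le_mul (ih _ (hlt p hp).1).2 (ih _ (hlt p hp).2).2 (ih _ (hlt p hp).2).1
          (by positivity)
      rw [Finset.sum_const, Finset.Nat.card_antidiagonal, nsmul_eq_mul] at h1
      push_cast at h1
      constructor
      · exact nonneg_of_mul_nonneg_right (h ▸ h0) hk
      · rw [← h] at h1
        have h2 : (0 : ℝ) ≤ (1 / 2) ^ (k + 2) := by positivity
        refine le_of_mul_le_mul_left (h1.trans ?_) hk
        nlinarith

lemma phi_zero : phi 0 = 1 := by
  simp [phi, PowerSeries.constantCoeff_inv, psU]

lemma phi_rec (k : ℕ) : ((k : ℝ) + 1) * phi (k + 1)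
    = ∑ p ∈ Finset.HasAntidiagonal.antidiagonal k, PowerSeries.coeff p.1 psV * phi p.2 := by
  have h := congrArg (PowerSeries.coeff k) derivative_inv_psU
  rw [PowerSeries.coeff_derivative, PowerSeries.coeff_mul] at h
  simp only [phi]
  rw [← h]; ring

lemma phi_one : phi 1 = 1 / 2 := by
  have := phi_rec 0
  simp only [CharP.cast_eq_zero, zero_add, one_mul, Finset.Nat.antidiagonal_zero,
    Finset.sum_singleton, coeff_psV_zero, phi_zero] at this
  linarith

/-- The coefficients of `1 / U` are nonnegative because those of `V = (1 / U)' / (1 / U)` are. The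
upper bound gives a radius of convergence of at least `2`, which exceeds `z₀`. -/
lemma phi_bounds (k : ℕ) : 0 ≤ phi k ∧ phi k ≤ (1 / 2) ^ k := by
  induction k using Nat.strong_induction_on with
  | _ k ih =>
    rcases k with _ | k
    · rw [phi_zero]; norm_num
    · have h := phi_rec k
      have hk : (0 : ℝ) < (k : ℝ) + 1 := by positivity
      have hlt : ∀ p ∈ Finset.HasAntidiagonal.antidiagonal k, p.2 < k + 1 := fun p hp => by
        have := Finset.HasAntidiagonal.mem_antidiagonal.1 hp; omega
      have h0 : 0 ≤ ∑ p ∈ Finset.HasAntidiagonal.antidiagonal k,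
          PowerSeries.coeff p.1 psV * phi p.2 :=
        Finset.sum_nonneg fun p hp => mul_nonneg (coeff_psV_bounds _).1 (ih _ (hlt p hp)).1
      have h1 : ∑ p ∈ Finset.HasAntidiagonal.antidiagonal k, PowerSeries.coeff p.1 psV * phi p.2
          ≤ ∑ p ∈ Finset.HasAntidiagonal.antidiagonal k, (1 / 2 : ℝ) ^ (k + 1) := by
        refine Finset.sum_le_sum fun p hp => ?_
        have := Finset.HasAntidiagonal.mem_antidiagonal.1 hp
        rw [show k + 1 = (p.1 + 1) + p.2 by omega, pow_add]
        exact mul_le_mul (coeff_psV_bounds _).2 (ih _ (hlt p hp)).2 (ih _ (hlt p hp)).1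
          (by positivity)
      rw [Finset.sum_const, Finset.Nat.card_antidiagonal, nsmul_eq_mul] at h1
      push_cast at h1
      rw [← h] at h0 h1
      exact ⟨nonneg_of_mul_nonneg_right h0 hk, le_of_mul_le_mul_left h1 hk⟩

lemma summable_phi {r : ℝ} (h0 : 0 ≤ r) (h2 : r < 2) : Summable fun k => phi k * r ^ k := by
  have hg := summable_geometric_of_lt_one (r := r / 2) (by positivity) (by linarith)
  refine Summable.of_nonneg_of_le (fun k => mul_nonneg (phi_bounds k).1 (by positivity))
    (fun k => ?_) hg
  rw [div_eq_mul_inv, mul_pow, mul_comm (r ^ k), ← one_div]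
  gcongr
  exact (phi_bounds k).2

lemma norm_phi_mul_pow (z : ℂ) (k : ℕ) : ‖(phi k : ℂ) * z ^ k‖ = phi k * ‖z‖ ^ k := by
  rw [norm_mul, norm_pow, Complex.norm_real, Real.norm_of_nonneg (phi_bounds k).1]

/-- The formal inverse of `U` is its inverse as a function on the disc of radius `2`. -/
lemma tsum_phi_mul_serU {z : ℂ} (h2 : ‖z‖ < 2) : (∑' k, (phi k : ℂ) * z ^ k) * serU z = 1 := by
  have h1 : Summable fun k => ‖(phi k : ℂ) * z ^ k‖ := by
    simpa only [norm_phi_mul_pow] using summable_phi (norm_nonneg z) h2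
  have h3 : Summable fun k : ℕ =>
      ‖(-1) ^ k / ((k.factorial : ℂ) * ((k + 1).factorial : ℂ)) * z ^ k‖ := by
    simpa only [norm_mul, norm_pow] using summable_norm_serU (𝕜 := ℂ) ‖z‖
  rw [serU, tsum_mul_tsum_eq_tsum_sum_antidiagonal_of_summable_norm h1 h3]
  have e : ∀ n, (∑ p ∈ Finset.HasAntidiagonal.antidiagonal n, (phi p.1 : ℂ) * z ^ p.1 *
      ((-1) ^ p.2 / ((p.2.factorial : ℂ) * ((p.2 + 1).factorial : ℂ)) * z ^ p.2))
      = if n = 0 then 1 else 0 := by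
    intro n
    have h := congrArg (PowerSeries.coeff n) psU_mul_inv
    rw [mul_comm, PowerSeries.coeff_mul, PowerSeries.coeff_one] at h
    have h' := congrArg (fun x : ℝ => (x : ℂ) * z ^ n) h
    simp only [psU, PowerSeries.coeff_mk] at h'
    push_cast at h'
    rw [Finset.sum_mul] at h'
    have : ((if n = 0 then (1 : ℂ) else 0) : ℂ) = (if n = 0 then (1 : ℂ) else 0) * z ^ n := by
      split_ifs with h <;> simp [h]
    rw [this]
    convert h' using 1
    · refine Finset.sum_congr rfl fun p hp => ?_
      rw [← Finset.HasAntidiagonal.mem_antidiagonal.1 hp, pow_add, phi, psU]; ring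
    · split_ifs <;> simp
  simp only [e, tsum_ite_eq]

lemma serU_ne_zero {z : ℂ} (h2 : ‖z‖ < 2) : serU z ≠ 0 :=
  right_ne_zero_of_mul_eq_one (tsum_phi_mul_serU h2)

/-- The square of the right-hand side exceeds the square of the left-hand side, which is
`(1 + p)² - 2 p (1 - cos t)`, by the square of the correction term. -/
lemma norm_one_add_exp_le {p : ℝ} (hp : 0 < p) (t : ℝ) :
    ‖1 + (p : ℂ) * Complex.exp (t * Complex.I)‖ ≤ (1 + p) - p / (1 + p) * (1 - Real.cos t) := by
  have hcos := Real.neg_one_le_cos t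
  have hcos' := Real.cos_le_one t
  have hr : 0 < 1 + p := by positivity
  have hsq : ‖1 + (p : ℂ) * Complex.exp (t * Complex.I)‖ ^ 2
      = (1 + p) ^ 2 - 2 * p * (1 - Real.cos t) := by
    rw [← Complex.normSq_eq_norm_sq, Complex.normSq_apply, Complex.exp_mul_I,
      ← Complex.ofReal_cos, ← Complex.ofReal_sin]
    simp only [Complex.add_re, Complex.one_re, Complex.mul_re, Complex.ofReal_re, Complex.ofReal_im,
      Complex.I_re, Complex.I_im, Complex.add_im, Complex.one_im, Complex.mul_im]
    linear_combination p ^ 2 * Real.sin_sq_add_cos_sq t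
  have hle : p / (1 + p) * (1 - Real.cos t) ≤ 1 + p := by
    rw [div_mul_eq_mul_div, div_le_iff₀ hr]; nlinarith
  refine (sq_le_sq₀ (norm_nonneg _) (by linarith)).1 ?_
  have e : ((1 + p) - p / (1 + p) * (1 - Real.cos t)) ^ 2
      = (1 + p) ^ 2 - 2 * p * (1 - Real.cos t) + (p / (1 + p) * (1 - Real.cos t)) ^ 2 := by
    field_simp; ring
  rw [hsq, e]
  exact le_add_of_nonneg_right (sq_nonneg _)

/-- On a circle of radius `r < 2` the function `1 / |U|` has a maximum at `r`, and it is not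
flat there: all the coefficients of `1 / U` are nonnegative and the first two are positive. -/
lemma norm_inv_serU_le {r : ℝ} (h0 : 0 < r) (h2 : r < 2) : ∃ c > 0, ∀ t : ℝ,
    ‖(serU (r * Complex.exp (t * Complex.I)))⁻¹ * serU (r : ℂ)‖ ≤ 1 - c * (1 - Real.cos t) := by
  have hs := summable_phi h0.le h2
  set P : ℝ := ∑' k, phi k * r ^ k with hP
  have hnr : ‖(r : ℂ)‖ = r := by rw [Complex.norm_real, Real.norm_of_nonneg h0.le]
  have hPU : (P : ℂ) * serU (r : ℂ) = 1 := by
    rw [← tsum_phi_mul_serU (z := (r : ℂ)) (by rw [hnr]; exact h2), hP, Complex.ofReal_tsum]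
    push_cast; rfl
  have hP1 : P = 1 + r / 2 + ∑' k, phi (k + 2) * r ^ (k + 2) := by
    rw [hP, ← hs.sum_add_tsum_nat_add 2]
    simp [Finset.sum_range_succ, phi_zero, phi_one]; ring
  have htail : 0 ≤ ∑' k, phi (k + 2) * r ^ (k + 2) :=
    tsum_nonneg fun k => mul_nonneg (phi_bounds _).1 (by positivity)
  have hP0 : 0 < P := by rw [hP1]; positivity
  refine ⟨r / 2 / (1 + r / 2) / P, by positivity, fun t => ?_⟩
  set z : ℂ := r * Complex.exp (t * Complex.I) with hz
  have hnz : ‖z‖ = r := by rw [hz, norm_mul, hnr, Complex.norm_exp_ofReal_mul_I, mul_one]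
  have h1 := tsum_phi_mul_serU (z := z) (by rw [hnz]; exact h2)
  have h3 : (serU z)⁻¹ = ∑' k, (phi k : ℂ) * z ^ k := (eq_inv_of_mul_eq_one_left h1).symm
  have h4 : serU (r : ℂ) = (P : ℂ)⁻¹ := eq_inv_of_mul_eq_one_right hPU
  have hsn : Summable fun k => ‖(phi k : ℂ) * z ^ k‖ := by
    simpa only [norm_phi_mul_pow, hnz] using hs
  have hs2 : Summable fun k => phi (k + 2) * r ^ (k + 2) :=
    (summable_nat_add_iff (f := fun k => phi k * r ^ k) 2).2 hs
  have hsn2 : Summable fun k => ‖(phi (k + 2) : ℂ) * z ^ (k + 2)‖ := by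
    simpa only [norm_phi_mul_pow, hnz] using hs2
  have h5 : ‖∑' k, (phi k : ℂ) * z ^ k‖ ≤ ‖1 + z / 2‖ + ∑' k, phi (k + 2) * r ^ (k + 2) := by
    rw [← hsn.of_norm.sum_add_tsum_nat_add 2]
    refine (norm_add_le _ _).trans (add_le_add (le_of_eq ?_) ?_)
    · simp [Finset.sum_range_succ, phi_zero, phi_one]; ring_nf
    · refine (norm_tsum_le_tsum_norm hsn2).trans_eq ?_
      simp only [norm_phi_mul_pow, hnz]
  have hz2 : ((r / 2 : ℝ) : ℂ) * Complex.exp (t * Complex.I) = z / 2 := by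
    rw [hz, Complex.ofReal_div, Complex.ofReal_ofNat, div_mul_eq_mul_div]
  have h6 := norm_one_add_exp_le (half_pos h0) t
  rw [hz2] at h6
  rw [h3, h4, norm_mul, norm_inv, Complex.norm_real, Real.norm_of_nonneg hP0.le,
    ← div_eq_mul_inv, div_le_iff₀ hP0]
  have : (1 - r / 2 / (1 + r / 2) / P * (1 - Real.cos t)) * P
      = P - r / 2 / (1 + r / 2) * (1 - Real.cos t) := by field_simp
  rw [this, hP1]
  linarith

/-! ### Laplace's method on a circle -/

/-- Laplace's method: if `χ` has modulus at most `exp (-c t²)` on `[-π, π]` and a second order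
expansion at `0`, the integral of `h χ^n` is of order `n^(-1/2)`. -/
lemma tendsto_sqrt_mul_integral_pow {χ h k : ℝ → ℂ} {c : ℝ} (hc : 0 < c)
    (hχ : Continuous χ) (hh : Continuous h) (hk : ContinuousAt k 0)
    (hχk : ∀ t, χ t = 1 + t ^ 2 * k t)
    (hbound : ∀ t, |t| ≤ Real.pi → ‖χ t‖ ≤ Real.exp (-c * t ^ 2)) :
    Tendsto (fun n : ℕ => (Real.sqrt n : ℂ) * ∫ t in (-Real.pi)..Real.pi, h t * χ t ^ n) atTop
      (𝓝 (h 0 * ∫ x : ℝ, Complex.exp (k 0 * x ^ 2))) := by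
  obtain ⟨B, hB⟩ := (isCompact_Icc (a := -Real.pi) (b := Real.pi)).exists_bound_of_continuousOn
    hh.continuousOn
  have hπ := Real.pi_pos
  have hB0 : 0 ≤ B := (norm_nonneg _).trans (hB 0 ⟨by linarith, hπ.le⟩)
  -- the integrand after the substitution `t = x / √n`, extended by zero to the whole line
  set G : ℕ → ℝ → ℂ := fun n x =>
    (Set.Ioc (-Real.pi * Real.sqrt n) (Real.pi * Real.sqrt n)).indicator
      (fun x => h (x / Real.sqrt n) * χ (x / Real.sqrt n) ^ n) x with hG
  have hsq : ∀ᶠ n : ℕ in atTop, 0 < Real.sqrt n := by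
    filter_upwards [eventually_gt_atTop 0] with n hn
    exact Real.sqrt_pos.2 (by exact_mod_cast hn)
  have hinf : Tendsto (fun n : ℕ => Real.sqrt n) atTop atTop :=
    Real.tendsto_sqrt_atTop.comp tendsto_natCast_atTop_atTop
  have hlim : Tendsto (fun n => ∫ x, G n x) atTop
      (𝓝 (∫ x : ℝ, h 0 * Complex.exp (k 0 * x ^ 2))) := by
    refine tendsto_integral_of_dominated_convergence (fun x => B * Real.exp (-c * x ^ 2))
      (fun n => ?_) ((integrable_exp_neg_mul_sq hc).const_mul B) (fun n => ?_) ?_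
    · exact (Continuous.aestronglyMeasurable (by fun_prop)).indicator measurableSet_Ioc
    · refine Eventually.of_forall fun x => ?_
      simp only [hG]
      by_cases hx : x ∈ Set.Ioc (-Real.pi * Real.sqrt n) (Real.pi * Real.sqrt n)
      · rw [Set.indicator_of_mem hx]
        have hn : 0 < Real.sqrt n := by
          rcases (Real.sqrt_nonneg n).eq_or_lt with h0 | h0
          · rw [← h0] at hx; simp at hx
          · exact h0
        have hn' : (n : ℝ) ≠ 0 := (Real.sqrt_pos.1 hn).ne'
        have hy : |x / Real.sqrt n| ≤ Real.pi := by
          rw [abs_le, le_div_iff₀ hn, div_le_iff₀ hn]; exact ⟨hx.1.le, hx.2⟩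
        rw [norm_mul, norm_pow]
        have h1 := hbound _ hy
        have h2 : Real.exp (-c * x ^ 2) = Real.exp (-c * (x / Real.sqrt n) ^ 2) ^ n := by
          rw [← Real.exp_nat_mul, div_pow, Real.sq_sqrt n.cast_nonneg]
          congr 1; field_simp
        rw [h2]
        gcongr
        exact hB _ (abs_le.1 hy)
      · rw [Set.indicator_of_notMem hx, norm_zero]; positivity
    · refine Eventually.of_forall fun x => ?_
      have hx0 : Tendsto (fun n : ℕ => x / Real.sqrt n) atTop (𝓝 0) :=
        hinf.const_div_atTop x
      have hind : ∀ᶠ n : ℕ in atTop, h (x / Real.sqrt n) * χ (x / Real.sqrt n) ^ n = G n x := by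
        filter_upwards [hinf.eventually_gt_atTop (|x| / Real.pi)] with n hn
        rw [div_lt_iff₀ hπ] at hn
        have := abs_lt.1 hn
        simp only [hG]
        rw [Set.indicator_of_mem]
        exact ⟨by linarith [this.1], by linarith [this.2]⟩
      refine Tendsto.congr' hind (Tendsto.mul (hh.continuousAt.tendsto.comp hx0) ?_)
      simp only [hχk]
      refine Complex.tendsto_one_add_pow_exp_of_tendsto ?_
      have h3 : Tendsto (fun n : ℕ => k (x / Real.sqrt n) * (x : ℂ) ^ 2) atTop
          (𝓝 (k 0 * x ^ 2)) := (hk.tendsto.comp hx0).mul_const _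
      refine h3.congr' ?_
      filter_upwards [hsq] with n hn
      have h4 : ((Real.sqrt n : ℝ) : ℂ) ^ 2 = (n : ℂ) := by
        rw [← Complex.ofReal_pow, Real.sq_sqrt n.cast_nonneg]; simp
      have h5 : (n : ℂ) ≠ 0 := by
        have := (Real.sqrt_pos.1 hn).ne'; exact_mod_cast this
      rw [Complex.ofReal_div, div_pow, h4]
      field_simp
  rw [integral_const_mul] at hlim
  refine hlim.congr' ?_
  filter_upwards [hsq] with n hn
  simp only [hG]
  rw [integral_indicator measurableSet_Ioc, ← intervalIntegral.integral_of_le (by nlinarith),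
    intervalIntegral.integral_comp_div (fun t => h t * χ t ^ n) hn.ne',
    mul_div_cancel_right₀ _ hn.ne', mul_div_cancel_right₀ _ hn.ne', Complex.real_smul]

/-- In the setting of Laplace's method the limiting Gaussian integral does not vanish. -/
lemma integral_exp_ne_zero {χ k : ℝ → ℂ} {c : ℝ} (hc : 0 < c) (hk : ContinuousAt k 0)
    (hχk : ∀ t, χ t = 1 + t ^ 2 * k t)
    (hbound : ∀ t, |t| ≤ Real.pi → ‖χ t‖ ≤ Real.exp (-c * t ^ 2)) :
    ∫ x : ℝ, Complex.exp (k 0 * x ^ 2) ≠ 0 := by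
  -- the bound on `‖χ‖` near `0` forces the Gaussian to decay
  have hre : (k 0).re ≤ -c := by
    have h1 : Tendsto (fun t => (k t).re) (𝓝[≠] 0) (𝓝 (k 0).re) :=
      (Complex.continuous_re.continuousAt.comp hk).tendsto.mono_left nhdsWithin_le_nhds
    have h2 : Tendsto (fun t : ℝ => -c / (1 + c * t ^ 2)) (𝓝[≠] 0) (𝓝 (-c)) := by
      have : ContinuousAt (fun t : ℝ => -c / (1 + c * t ^ 2)) 0 := by
        refine ContinuousAt.div (by fun_prop) (by fun_prop) (by simp)
      simpa using this.tendsto.mono_left nhdsWithin_le_nhds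
    refine le_of_tendsto_of_tendsto h1 h2 ?_
    have h3 : ∀ᶠ t : ℝ in 𝓝[≠] 0, |t| ≤ Real.pi := by
      refine nhdsWithin_le_nhds ?_
      have : Metric.ball (0 : ℝ) Real.pi ∈ 𝓝 (0 : ℝ) := Metric.ball_mem_nhds _ Real.pi_pos
      filter_upwards [this] with t ht
      simpa using (Metric.mem_ball.1 ht).le
    filter_upwards [h3, self_mem_nhdsWithin] with t ht ht0
    have ht2 : 0 < t ^ 2 := (sq_pos_iff (a := t)).2 ht0
    have h4 : 1 + t ^ 2 * (k t).re ≤ Real.exp (-c * t ^ 2) := by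
      refine le_trans (le_of_eq ?_) ((Complex.re_le_norm _).trans (hbound t ht))
      rw [hχk, ← Complex.ofReal_pow, Complex.add_re, Complex.one_re, Complex.re_ofReal_mul]
    have h5 : Real.exp (-c * t ^ 2) ≤ 1 / (1 + c * t ^ 2) := by
      rw [neg_mul, Real.exp_neg, ← one_div]
      exact one_div_le_one_div_of_le (by positivity) (by
        have := Real.add_one_le_exp (c * t ^ 2); linarith)
    have h6 := h4.trans h5
    rw [le_div_iff₀ (by positivity)] at h6 ⊢
    nlinarith
  have hb : 0 < (-k 0).re := by rw [Complex.neg_re]; linarith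
  have h := integral_gaussian_complex hb
  rw [neg_neg] at h
  rw [h]
  refine (Complex.cpow_ne_zero_iff_of_exponent_ne_zero (by norm_num)).2 (div_ne_zero ?_ ?_)
  · exact_mod_cast Real.pi_ne_zero
  · intro h0; rw [h0] at hb; simp at hb

/-! ### Lagrange inversion -/

lemma hasDerivAt_mul_serU_mul (s z : ℂ) :
    HasDerivAt (fun z => z * serU (z * s)) (serA (z * s)) z := by
  by_cases hs : s = 0
  · subst hs
    simp only [mul_zero, serU_zero, mul_one, serA_zero]
    exact hasDerivAt_id z
  · have h := ((hasDerivAt_mul_serU (z * s)).comp z ((hasDerivAt_id z).mul_const s)).div_const s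
    refine (h.congr_deriv (by field_simp)).congr_of_eventuallyEq (Eventually.of_forall fun w => ?_)
    simp only [Function.comp, id]
    field_simp

lemma differentiable_serA : Differentiable ℂ (serA : ℂ → ℂ) :=
  fun z => (hasDerivAt_serA z).differentiableAt

/-- Lagrange inversion: if `z U(z s)` is the power series with coefficients `q_m` in powers of
`w = z U(z)`, then `(m + 1) q_m` is the residue of `A(z s) / w^(m+1)`. -/
lemma circleIntegral_serA_div {q : ℕ → ℝ} {s : ℝ}
    (hid : ∀ z ∈ Set.Icc 0 z₀, HasSum (fun m => q m * (z * serU z) ^ (m + 1)) (z * serU (z * s)))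
    (hq : ∀ m, 0 ≤ q m) (N : ℕ) :
    (∮ z in C(0, z₀), serA (z * (s : ℂ)) / (z * serU z) ^ (N + 1))
      = 2 * Real.pi * Complex.I * ((N + 1) * q N) := by
  set X : ℝ := z₀ * serU z₀ with hX
  have hX0 : 0 < X := mul_pos z₀_pos (serU_pos z₀_pos.le le_rfl)
  set w : ℂ → ℂ := fun z => z * serU z with hw
  have hwd : ∀ z, HasDerivAt w (serA z) z := hasDerivAt_mul_serU
  have hwc : Continuous w := continuous_id.mul continuous_serU
  have hqX : Summable fun m => q m * X ^ m := by
    have := (hid z₀ ⟨z₀_pos.le, le_rfl⟩).summable.mul_right X⁻¹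
    refine this.congr fun m => ?_
    rw [← hX, pow_succ]; field_simp
  -- the remainders of the series
  have hqn : ∀ n, Summable fun m => q (m + n) * X ^ m := fun n => by
    refine (((summable_nat_add_iff n).2 hqX).mul_right (X ^ n)⁻¹).congr fun m => ?_
    rw [pow_add]; field_simp
  set R : ℕ → ℂ → ℂ := fun n v => ∑' m, (q (m + n) : ℂ) * v ^ m with hR
  have hle : ∀ n m, ∀ v ∈ Metric.ball (0 : ℂ) X, ‖(q (m + n) : ℂ) * v ^ m‖ ≤ q (m + n) * X ^ m := by
    intro n m v hv
    rw [norm_mul, norm_pow, Complex.norm_real, Real.norm_of_nonneg (hq _)]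
    have : ‖v‖ ≤ X := by simpa using (Metric.mem_ball.1 hv).le
    gcongr
    exact hq _
  have hRd : ∀ n, DifferentiableOn ℂ (R n) (Metric.ball 0 X) := fun n =>
    Complex.differentiableOn_tsum_of_summable_norm (hqn n) (fun m => by fun_prop)
      Metric.isOpen_ball (hle n)
  have hRs : ∀ n, ∀ v ∈ Metric.ball (0 : ℂ) X, Summable fun m => (q (m + n) : ℂ) * v ^ m :=
    fun n v hv => Summable.of_norm_bounded (hqn n) fun m => hle n m v hv
  have hRsplit : ∀ n, ∀ v ∈ Metric.ball (0 : ℂ) X,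
      v * R 0 v = ∑ m ∈ Finset.range n, (q m : ℂ) * v ^ (m + 1) + v ^ (n + 1) * R n v := by
    intro n v hv
    have h0 : R 0 v = ∑' m, (q m : ℂ) * v ^ m := rfl
    have h1 : Summable fun m => (q m : ℂ) * v ^ m := hRs 0 v hv
    rw [h0, ← h1.sum_add_tsum_nat_add n, mul_add, Finset.mul_sum]
    simp only [hR]
    rw [← tsum_mul_left, ← tsum_mul_left]
    congr 1
    · exact Finset.sum_congr rfl fun m _ => by ring
    · exact tsum_congr fun m => by rw [pow_add]; ring
  -- a small disc on which the identity extends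
  obtain ⟨δ, hδ0, hδ⟩ : ∃ δ > 0, ∀ z ∈ Metric.ball (0 : ℂ) δ, w z ∈ Metric.ball (0 : ℂ) X := by
    have : w ⁻¹' Metric.ball 0 X ∈ 𝓝 (0 : ℂ) :=
      hwc.continuousAt.preimage_mem_nhds (by simpa [hw] using Metric.ball_mem_nhds (0 : ℂ) hX0)
    obtain ⟨δ, h0, h⟩ := Metric.mem_nhds_iff.1 this
    exact ⟨δ, h0, h⟩
  have hcomp : ∀ n, DifferentiableOn ℂ (fun z => R n (w z)) (Metric.ball 0 δ) := fun n =>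
    (hRd n).comp (fun z _ => (hwd z).differentiableAt.differentiableWithinAt) hδ
  have heq : Set.EqOn (fun z => z * serU (z * (s : ℂ))) (fun z => w z * R 0 (w z))
      (Metric.ball 0 δ) := by
    refine AnalyticOnNhd.eqOn_of_preconnected_of_frequently_eq (z₀ := 0)
      (DifferentiableOn.analyticOnNhd (fun z _ =>
        (hasDerivAt_mul_serU_mul s z).differentiableAt.differentiableWithinAt) Metric.isOpen_ball)
      (DifferentiableOn.analyticOnNhd (DifferentiableOn.mul (fun z _ =>
        (hwd z).differentiableAt.differentiableWithinAt) (hcomp 0)) Metric.isOpen_ball)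
      (convex_ball _ _).isPreconnected (Metric.mem_ball_self hδ0) ?_
    have hreal : ∀ x ∈ Set.Icc 0 z₀, (x : ℂ) * serU ((x : ℂ) * (s : ℂ)) = w x * R 0 (w x) := by
      intro x hx
      have h1 := (hid x hx).tsum_eq
      have h2 : w x = ((x * serU x : ℝ) : ℂ) := by simp [hw, serU_ofReal]
      rw [h2, ← Complex.ofReal_mul, serU_ofReal, ← Complex.ofReal_mul, ← h1]
      simp only [hR, add_zero]
      rw [← tsum_mul_left, Complex.ofReal_tsum]
      refine tsum_congr fun m => ?_
      push_cast; ring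
    have hseq : Tendsto (fun n : ℕ => (((z₀ / (n + 1) : ℝ)) : ℂ)) atTop (𝓝[≠] 0) := by
      refine tendsto_nhdsWithin_iff.2 ⟨?_, Eventually.of_forall fun n => ?_⟩
      · have h := tendsto_one_div_add_atTop_nhds_zero_nat (𝕜 := ℝ)
        have h' := (h.const_mul z₀)
        rw [mul_zero] at h'
        have h2 := (Complex.continuous_ofReal.tendsto 0).comp h'
        simp only [Complex.ofReal_zero] at h2
        refine h2.congr fun n => ?_
        simp only [Function.comp, mul_one_div]
      · have : z₀ / ((n : ℝ) + 1) ≠ 0 := (div_pos z₀_pos (by positivity)).ne'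
        simpa only [Set.mem_compl_iff, Set.mem_singleton_iff, Complex.ofReal_eq_zero] using this
    refine hseq.frequently (Eventually.frequently (Eventually.of_forall fun n => ?_))
    refine hreal _ ⟨(div_pos z₀_pos (by positivity)).le, ?_⟩
    exact div_le_self z₀_pos.le (by linarith [n.cast_nonneg (α := ℝ)])
  -- the circle can be shrunk into that disc
  set ε : ℝ := min (δ / 2) z₀ with hε
  have hε0 : 0 < ε := lt_min (by positivity) z₀_pos
  have hεδ : ε < δ := (min_le_left _ _).trans_lt (by linarith)
  have hεz : ε ≤ z₀ := min_le_right _ _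
  have hw0 : ∀ z : ℂ, z ≠ 0 → ‖z‖ ≤ z₀ → w z ≠ 0 := fun z hz hz2 =>
    mul_ne_zero hz (serU_ne_zero (hz2.trans_lt z₀_lt_two))
  have hshrink : (∮ z in C(0, z₀), serA (z * (s : ℂ)) / w z ^ (N + 1))
      = ∮ z in C(0, ε), serA (z * (s : ℂ)) / w z ^ (N + 1) := by
    have hdiff : ∀ z : ℂ, z ≠ 0 → ‖z‖ ≤ z₀ →
        DifferentiableAt ℂ (fun z => serA (z * (s : ℂ)) / w z ^ (N + 1)) z := fun z hz hz2 =>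
      ((differentiable_serA _).comp z (differentiableAt_id.mul_const _)).div
        ((hwd z).differentiableAt.pow _) (pow_ne_zero _ (hw0 z hz hz2))
    refine Complex.circleIntegral_eq_of_differentiable_on_annulus_off_countable hε0 hεz
      Set.countable_empty (fun z hz => ?_) fun z hz => ?_
    · refine (hdiff z ?_ (by simpa using hz.1)).continuousAt.continuousWithinAt
      rintro rfl
      exact hz.2 (Metric.mem_ball_self hε0)
    · refine hdiff z ?_ (by simpa using (Metric.mem_ball.1 hz.1.1).le)
      rintro rfl
      exact hz.1.2 (Metric.mem_closedBall_self hε0.le)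
  have hsph : ∀ z ∈ Metric.sphere (0 : ℂ) ε, z ≠ 0 ∧ w z ≠ 0 ∧ z ∈ Metric.ball (0 : ℂ) δ := by
    intro z hz
    have hz1 : ‖z‖ = ε := by simpa using hz
    have hz0 : z ≠ 0 := by rintro rfl; simp at hz1; linarith
    exact ⟨hz0, hw0 z hz0 (hz1.le.trans hεz), by simp [hz1, hεδ]⟩
  -- the three parts of the integrand: a derivative, the pole, and a holomorphic function
  set ρ : ℂ → ℂ := fun z => R (N + 1) (w z) with hρ
  have hρd := hcomp (N + 1)
  have hρ' : DifferentiableOn ℂ (deriv ρ) (Metric.ball 0 δ) := hρd.deriv Metric.isOpen_ball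
  set D : ℂ → ℂ := fun z => ∑ m ∈ Finset.range N,
    ((m + 1 : ℂ) * q m) * (serA z / w z ^ (N - m + 1)) with hD
  set E : ℂ → ℂ := fun z => ((N + 1 : ℂ) * q N) * (deriv serU z / serU z)
    + ((N + 2 : ℂ) * (serA z * ρ z) + w z * deriv ρ z) with hE
  have hdecomp : ∀ z ∈ Metric.sphere (0 : ℂ) ε, serA (z * (s : ℂ)) / w z ^ (N + 1)
      = D z + ((N + 1 : ℂ) * q N) * (z - 0)⁻¹ + E z := by
    intro z hz
    obtain ⟨hz0, hwz, hzδ⟩ := hsph z hz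
    have hUz : serU z ≠ 0 := (mul_ne_zero_iff.1 hwz).2
    have hder : serA (z * (s : ℂ)) = ∑ m ∈ Finset.range (N + 1),
        (q m : ℂ) * ((m + 1 : ℂ) * w z ^ m * serA z)
        + ((N + 2 : ℂ) * w z ^ (N + 1) * serA z * ρ z + w z ^ (N + 2) * deriv ρ z) := by
      have hnhds : Metric.ball (0 : ℂ) δ ∈ 𝓝 z := Metric.isOpen_ball.mem_nhds hzδ
      have h1 : (fun z => z * serU (z * (s : ℂ))) =ᶠ[𝓝 z] fun z =>
          ∑ m ∈ Finset.range (N + 1), (q m : ℂ) * w z ^ (m + 1) + w z ^ (N + 1 + 1) * ρ z := by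
        filter_upwards [hnhds] with y hy
        have := heq hy
        simp only at this
        rw [this, hRsplit (N + 1) _ (hδ y hy)]
      have h2 : HasDerivAt (fun z => ∑ m ∈ Finset.range (N + 1), (q m : ℂ) * w z ^ (m + 1)
          + w z ^ (N + 1 + 1) * ρ z) _ z :=
        HasDerivAt.add (HasDerivAt.fun_sum fun m _ => ((hwd z).fun_pow (m + 1)).const_mul (q m : ℂ))
          (((hwd z).fun_pow (N + 1 + 1)).mul (hρd.differentiableAt hnhds).hasDerivAt)
      rw [(hasDerivAt_mul_serU_mul s z).unique (h2.congr_of_eventuallyEq h1)]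
      push_cast
      simp only [add_assoc, one_add_one_eq_two]
      rfl
    have hUder : serA z = serU z + z * deriv serU z := by
      have h := (hasDerivAt_id z).mul (differentiable_serU z).hasDerivAt
      rw [(hwd z).unique h]; simp
    have hDw : D z * w z ^ (N + 1)
        = ∑ m ∈ Finset.range N, (q m : ℂ) * ((m + 1 : ℂ) * w z ^ m * serA z) := by
      simp only [hD]
      rw [Finset.sum_mul]
      refine Finset.sum_congr rfl fun m hm => ?_
      have hm' := Finset.mem_range.1 hm
      have : w z ^ (N + 1) = w z ^ (N - m + 1) * w z ^ m := by
        rw [← pow_add]; congr 1; omega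
      rw [this]; field_simp
    have hpole : ((z - 0)⁻¹ + deriv serU z / serU z) * w z = serA z := by
      rw [hUder, sub_zero]; simp only [hw]; field_simp
    rw [div_eq_iff (pow_ne_zero _ hwz), hder, Finset.sum_range_succ, ← hDw]
    simp only [hE]
    linear_combination (-((N : ℂ) + 1) * q N * w z ^ N) * hpole
  have hDint : (∮ z in C(0, ε), D z) = 0 := by
    refine circleIntegral.integral_eq_zero_of_hasDerivWithinAt (f := fun z =>
      ∑ m ∈ Finset.range N, ((m + 1 : ℂ) * q m) * (-(1 / (N - m : ℕ)) * (w z ^ (N - m))⁻¹))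
      hε0.le fun z hz => HasDerivAt.hasDerivWithinAt ?_
    obtain ⟨hz0, hwz, -⟩ := hsph z hz
    refine HasDerivAt.fun_sum fun m hm => HasDerivAt.const_mul _ ?_
    have hm' : (N - m : ℕ) ≠ 0 := by have := Finset.mem_range.1 hm; omega
    have hm2 : ((N - m : ℕ) : ℂ) ≠ 0 := by exact_mod_cast hm'
    refine ((((hwd z).fun_pow (N - m)).fun_inv (pow_ne_zero _ hwz)).const_mul _).congr_deriv ?_
    obtain ⟨j, hj⟩ := Nat.exists_eq_succ_of_ne_zero hm'
    rw [hj] at hm2 ⊢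
    simp only [Nat.succ_eq_add_one, Nat.add_sub_cancel]
    field_simp
    ring
  have hEd : ∀ z ∈ Metric.closedBall (0 : ℂ) ε, DifferentiableAt ℂ E z := fun z hz => by
    have hz1 : ‖z‖ ≤ ε := by simpa using hz
    have hnhds : Metric.ball (0 : ℂ) δ ∈ 𝓝 z :=
      Metric.isOpen_ball.mem_nhds (by simpa using hz1.trans_lt hεδ)
    have hU := serU_ne_zero (hz1.trans_lt (hεz.trans_lt z₀_lt_two))
    have h1 : DifferentiableAt ℂ (deriv (serU : ℂ → ℂ)) z :=
      (differentiable_serU.differentiableOn.deriv isOpen_univ).differentiableAt univ_mem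
    exact ((h1.div (differentiable_serU z) hU).const_mul _).add
      ((((differentiable_serA z).mul (hρd.differentiableAt hnhds)).const_mul _).add
        ((hwd z).differentiableAt.mul (hρ'.differentiableAt hnhds)))
  have hEint : (∮ z in C(0, ε), E z) = 0 := by
    exact Complex.circleIntegral_eq_zero_of_differentiable_on_off_countable hε0.le
      Set.countable_empty (fun z hz => (hEd z hz).continuousAt.continuousWithinAt)
      fun z hz => hEd z (Metric.ball_subset_closedBall hz.1)
  have hDc : ContinuousOn D (Metric.sphere 0 ε) := by
    refine continuousOn_finsetSum _ fun m _ => continuousOn_const.mul ?_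
    exact differentiable_serA.continuous.continuousOn.div (hwc.pow _).continuousOn
      fun z hz => pow_ne_zero _ (hsph z hz).2.1
  have hPc : ContinuousOn (fun z : ℂ => ((N + 1 : ℂ) * q N) * (z - 0)⁻¹) (Metric.sphere 0 ε) := by
    refine continuousOn_const.mul (ContinuousOn.inv₀ (by fun_prop) fun z hz => ?_)
    rw [sub_zero]; exact (hsph z hz).1
  have hEc : ContinuousOn E (Metric.sphere 0 ε) := fun z hz =>
    (hEd z (Metric.sphere_subset_closedBall hz)).continuousAt.continuousWithinAt
  change (∮ z in C(0, z₀), serA (z * (s : ℂ)) / w z ^ (N + 1)) = _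
  rw [hshrink, circleIntegral.integral_congr hε0.le hdecomp]
  rw [circleIntegral.integral_add ((hDc.fun_add hPc).circleIntegrable hε0.le)
    (hEc.circleIntegrable hε0.le), circleIntegral.integral_add (hDc.circleIntegrable hε0.le)
    (hPc.circleIntegrable hε0.le), hDint, hEint, circleIntegral.integral_const_mul,
    circleIntegral.integral_sub_center_inv 0 hε0.ne']
  ring

/-! ### Asymptotics of the coefficients -/

/-- The coefficients in Lagrange inversion are of order `m^(-3/2) (z₀ U(z₀))^(-m)`, with a constant
that depends on `s` only through the factor `A(z₀ s)`. The saddle point is `z₀`, since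
`(z U(z))' = A(z)` vanishes there. -/
lemma exists_tendsto_coeff : ∃ C : ℂ, C ≠ 0 ∧ ∀ (q : ℕ → ℝ) (s : ℝ), (∀ m, 0 ≤ q m) →
    (∀ z ∈ Set.Icc 0 z₀, HasSum (fun m => q m * (z * serU z) ^ (m + 1)) (z * serU (z * s))) →
    Tendsto (fun N : ℕ => (Real.sqrt (N + 1) : ℂ) * ((N + 1) * q N * (z₀ * serU z₀ : ℝ) ^ (N + 1)))
      atTop (𝓝 (C * (serA (z₀ * s) : ℝ))) := by
  set X : ℝ := z₀ * serU z₀ with hX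
  have hX0 : 0 < X := mul_pos z₀_pos (serU_pos z₀_pos.le le_rfl)
  have hXc : (X : ℂ) ≠ 0 := by exact_mod_cast hX0.ne'
  have hz₀c : (z₀ : ℂ) ≠ 0 := by exact_mod_cast z₀_pos.ne'
  -- the parametrization of the circle through the saddle point, extended to complex `t`
  set e : ℂ → ℂ := fun t => z₀ * Complex.exp (t * Complex.I) with he
  have hed : ∀ t, HasDerivAt e (z₀ * (Complex.exp (t * Complex.I) * Complex.I)) t := fun t => by
    simpa using (((hasDerivAt_id t).mul_const Complex.I).cexp).const_mul (z₀ : ℂ)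
  have hec : Continuous e := by fun_prop
  set w : ℂ → ℂ := fun z => z * serU z with hw
  have hwd : ∀ z, HasDerivAt w (serA z) z := hasDerivAt_mul_serU
  set S : Set ℂ := {t | ‖e t‖ < 2} with hS
  have hSo : IsOpen S := isOpen_lt hec.norm continuous_const
  have hen : ∀ t : ℝ, ‖e t‖ = z₀ := fun t => by
    rw [he]
    simp only
    rw [norm_mul, Complex.norm_exp_ofReal_mul_I, Complex.norm_real,
      Real.norm_of_nonneg z₀_pos.le, mul_one]
  have hSr : ∀ t : ℝ, (t : ℂ) ∈ S := fun t => by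
    have := hen t; simp only [hS, Set.mem_ofPred_eq, this]; exact z₀_lt_two
  have he0 : ∀ t, e t ≠ 0 := fun t => mul_ne_zero hz₀c (Complex.exp_ne_zero _)
  have hwS : ∀ t ∈ S, w (e t) ≠ 0 := fun t ht => mul_ne_zero (he0 t) (serU_ne_zero ht)
  -- `χc` is `1` at `0`, with derivative `0` because `A z₀ = 0`; two divided differences then give
  -- the expansion `χc t = 1 + t² k t`
  set χc : ℂ → ℂ := fun t => X * (w (e t))⁻¹ with hχc
  have hχder : ∀ t ∈ S, HasDerivAt χc _ t := fun t ht =>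
    ((((hwd (e t)).comp t (hed t)).fun_inv (hwS t ht)).const_mul (X : ℂ))
  have hχd : DifferentiableOn ℂ χc S := fun t ht =>
    (hχder t ht).differentiableAt.differentiableWithinAt
  have h0S : (0 : ℂ) ∈ S := by simpa using hSr 0
  have hSn : S ∈ 𝓝 (0 : ℂ) := hSo.mem_nhds h0S
  have he00 : e 0 = z₀ := by simp [he]
  have hχ0 : χc 0 = 1 := by
    simp only [hχc, he00, hw, serU_ofReal]
    rw [← Complex.ofReal_mul, ← hX, mul_inv_cancel₀ hXc]
  have hχ'0 : deriv χc 0 = 0 := by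
    rw [(hχder 0 h0S).deriv, he00, serA_ofReal, serA_z₀]; simp
  set g : ℂ → ℂ := dslope χc 0 with hg
  have hg0 : g 0 = 0 := by rw [hg, dslope_same, hχ'0]
  have hgd : DifferentiableAt ℂ g 0 :=
    (((Complex.differentiableOn_dslope hSn).2 hχd).differentiableAt hSn)
  set k : ℝ → ℂ := fun t => dslope g 0 t with hk
  set χ : ℝ → ℂ := fun t => χc t with hχ
  have hkc : ContinuousAt k 0 := by
    refine ContinuousAt.comp (g := dslope g 0) ?_ Complex.continuous_ofReal.continuousAt
    simpa using continuousAt_dslope_same.2 hgd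
  have hχk : ∀ t, χ t = 1 + t ^ 2 * k t := fun t => by
    have h1 := sub_smul_dslope χc 0 (t : ℂ)
    have h2 := sub_smul_dslope g 0 (t : ℂ)
    rw [sub_zero, smul_eq_mul, hχ0] at h1
    rw [sub_zero, smul_eq_mul, hg0, sub_zero] at h2
    simp only [hχ, hk]
    rw [sq, mul_assoc, h2, h1]; ring
  have hχcont : Continuous χ := continuous_iff_continuousAt.2 fun t =>
    ContinuousAt.comp (g := χc) (hχder t (hSr t)).continuousAt Complex.continuous_ofReal.continuousAt
  obtain ⟨c, hc0, hc⟩ := norm_inv_serU_le z₀_pos z₀_lt_two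
  have hbound : ∀ t, |t| ≤ Real.pi → ‖χ t‖ ≤ Real.exp (-(c * (2 / Real.pi ^ 2)) * t ^ 2) := by
    intro t ht
    have h1 : ‖χ t‖ ≤ 1 - c * (1 - Real.cos t) := by
      refine le_trans (le_of_eq ?_) (hc t)
      have h2 : w (e t) = e t * serU (e t) := rfl
      have h3 : (X : ℂ) = z₀ * serU (z₀ : ℂ) := by rw [serU_ofReal, hX]; push_cast; rfl
      simp only [hχ, hχc]
      rw [h2, h3, norm_mul, norm_mul, norm_inv, norm_mul, hen, norm_mul, norm_inv,
        Complex.norm_real, Real.norm_of_nonneg z₀_pos.le]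
      have := z₀_pos.ne'
      rw [mul_inv]
      field_simp
      rfl
    have h2 := Real.cos_le_one_sub_mul_cos_sq ht
    have h3 := Real.add_one_le_exp (-(c * (2 / Real.pi ^ 2)) * t ^ 2)
    nlinarith
  have hc' : 0 < c * (2 / Real.pi ^ 2) := by positivity
  have hπ : (Real.pi : ℂ) ≠ 0 := by exact_mod_cast Real.pi_ne_zero
  refine ⟨z₀ / (2 * Real.pi) * ∫ x : ℝ, Complex.exp (k 0 * x ^ 2), mul_ne_zero
    (div_ne_zero hz₀c (mul_ne_zero two_ne_zero hπ))
    (integral_exp_ne_zero hc' hkc hχk hbound), fun q s hq hid => ?_⟩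
  set h : ℝ → ℂ := fun t => e t * serA (e t * (s : ℂ)) with hh
  have hhc : Continuous h := by
    have h1 : Continuous fun t : ℝ => e (t : ℂ) := hec.comp Complex.continuous_ofReal
    exact h1.mul (continuous_serA.comp (h1.mul continuous_const))
  have hlim := (tendsto_sqrt_mul_integral_pow hc' hχcont hhc hkc hχk hbound).comp
    (tendsto_add_atTop_nat 1)
  have hlim2 := hlim.const_mul ((1 : ℂ) / (2 * Real.pi))
  have hh0 : h 0 = z₀ * (serA (z₀ * s) : ℝ) := by
    simp only [hh, Complex.ofReal_zero, he00]
    rw [← Complex.ofReal_mul, serA_ofReal]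
  have hval : (1 : ℂ) / (2 * Real.pi) * (h 0 * ∫ x : ℝ, Complex.exp (k 0 * x ^ 2))
      = z₀ / (2 * Real.pi) * (∫ x : ℝ, Complex.exp (k 0 * x ^ 2)) * (serA (z₀ * s) : ℝ) := by
    rw [hh0]; ring
  rw [hval] at hlim2
  refine hlim2.congr fun N => ?_
  have hL := circleIntegral_serA_div hid hq N
  -- circle integrals are over `[0, 2π]`, Laplace's method is on `[-π, π]`
  have hper : Function.Periodic (fun t : ℝ => h t * χ t ^ (N + 1)) (2 * Real.pi) := fun t => by
    have : e ((t + 2 * Real.pi : ℝ) : ℂ) = e t := by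
      simp only [he]
      push_cast
      rw [add_mul, Complex.exp_add, Complex.exp_two_pi_mul_I, mul_one]
    simp only [hh, hχ, hχc, this]
  have hint : (∮ z in C(0, z₀), serA (z * (s : ℂ)) / (z * serU z) ^ (N + 1)) * X ^ (N + 1)
      = Complex.I * ∫ t in (-Real.pi)..Real.pi, h t * χ t ^ (N + 1) := by
    have h1 := hper.intervalIntegral_add_eq (-Real.pi) 0
    rw [show -Real.pi + 2 * Real.pi = Real.pi by ring, zero_add] at h1
    rw [h1, circleIntegral, ← intervalIntegral.integral_mul_const,
      ← intervalIntegral.integral_const_mul]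
    refine intervalIntegral.integral_congr fun t _ => ?_
    have h2 : circleMap 0 z₀ t = e t := by simp [circleMap, he]
    simp only [deriv_circleMap, h2, hh, hχ, hχc, hw, smul_eq_mul]
    rw [mul_pow (X : ℂ), inv_pow]
    ring
  rw [hL] at hint
  have hI := Complex.I_ne_zero
  have hint2 : ∫ t in (-Real.pi)..Real.pi, h t * χ t ^ (N + 1)
      = 2 * Real.pi * ((N + 1) * q N * X ^ (N + 1)) := by
    refine mul_left_cancel₀ hI ?_
    rw [← hint]; ring
  simp only [Function.comp]
  rw [hint2]
  push_cast
  field_simp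

/-! ### Measurability of the basic operations on labeled trees -/

lemma measurable_some_label : Measurable (some : ℝ × ℝ → Option (ℝ × ℝ)) := fun _ hs => hs

lemma measurable_of_comp_some {β : Type*} [MeasurableSpace β] {f : Option (ℝ × ℝ) → β}
    (h : Measurable fun p => f (some p)) : Measurable f := fun _ hs => h hs

lemma measurable_apply (u : List Bool) : Measurable fun t : LTree => t u := measurable_pi_apply u

lemma measurable_eq_none (u : List Bool) : Measurable fun t : LTree => t u = none := by
  have : Measurable fun x : Option (ℝ × ℝ) => x = none :=
    measurable_of_comp_some (by simp)
  exact this.comp (measurable_apply u)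

/-- The pair of angles recorded at `u`, or `(0, 0)` if `u` is not a cubic vertex. -/
def angles (t : LTree) (u : List Bool) : ℝ × ℝ := (t u).getD (0, 0)

lemma measurable_angles (u : List Bool) : Measurable fun t : LTree => angles t u := by
  have : Measurable fun x : Option (ℝ × ℝ) => x.getD (0, 0) :=
    measurable_of_comp_some measurable_id
  exact this.comp (measurable_apply u)

lemma angles_eq {t : LTree} {u : List Bool} {p : ℝ × ℝ} (h : t u = some p) : angles t u = p := by
  simp [angles, h]

lemma exists_some_of_ne {t : LTree} {u : List Bool} (h : ¬ t u = none) :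
    t u = some (angles t u) := by
  obtain ⟨p, hp⟩ := Option.ne_none_iff_exists'.1 h
  rw [hp, angles_eq hp]

/-- The conditions in `IsAllowed` that do not concern the root edge. -/
def PreAllowed (t : LTree) : Prop :=
  (∀ u : List Bool, ∀ d : Bool, t u = none → t (u ++ [d]) = none) ∧
  (∀ u : List Bool, ¬ t u = none → 0 < (angles t u).1 ∧ (angles t u).1 < Real.pi ∧
    0 < (angles t u).2 ∧ (angles t u).2 < Real.pi ∧
    Real.pi < (angles t u).1 + (angles t u).2) ∧
  (∀ u : List Bool, ¬ t u = none → ¬ t (u ++ [false]) = none →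
    (angles t (u ++ [false])).1 + (angles t (u ++ [false])).2 < (angles t u).2 + Real.pi) ∧
  (∀ u : List Bool, ¬ t u = none → ¬ t (u ++ [true]) = none →
    (angles t (u ++ [true])).1 + (angles t (u ++ [true])).2 < (angles t u).1 + Real.pi)

lemma isAllowed_iff (θ : ℝ) (t : LTree) : IsAllowed θ t ↔ PreAllowed t ∧
    (¬ t [] = none → (angles t []).1 + (angles t []).2 + θ < 2 * Real.pi) := by
  constructor
  · rintro ⟨h1, h2, h3, h4, h5⟩
    refine ⟨⟨fun u d h => ?_, fun u h => ?_, fun u h h' => ?_, fun u h h' => ?_⟩, fun h => ?_⟩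
    · by_contra hc
      exact h1 u d hc h
    · exact h2 u _ _ (exists_some_of_ne h)
    · exact h3 u _ _ _ _ (exists_some_of_ne h) (exists_some_of_ne h')
    · exact h4 u _ _ _ _ (exists_some_of_ne h) (exists_some_of_ne h')
    · exact h5 _ _ (exists_some_of_ne h)
  · rintro ⟨⟨h1, h2, h3, h4⟩, h5⟩
    refine ⟨fun u d h hn => h (h1 u d hn), fun u a b h => ?_, fun u a b a' b' h h' => ?_,
      fun u a b a' b' h h' => ?_, fun a b h => ?_⟩
    · have := h2 u (by simp [h]); rwa [angles_eq h] at this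
    · have := h3 u (by simp [h]) (by simp [h']); rwa [angles_eq h, angles_eq h'] at this
    · have := h4 u (by simp [h]) (by simp [h']); rwa [angles_eq h, angles_eq h'] at this
    · have := h5 (by simp [h]); rwa [angles_eq h] at this

lemma measurable_preAllowed : Measurable PreAllowed := by
  have ha := measurable_angles
  have hn := measurable_eq_none
  have lt : ∀ {f g : LTree → ℝ}, Measurable f → Measurable g → Measurable fun t => f t < g t :=
    fun hf hg => measurableSet_setOfPred.1 (measurableSet_lt hf hg)
  refine Measurable.and ?_ (Measurable.and ?_ (Measurable.and ?_ ?_))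
  · exact Measurable.forall fun u => Measurable.forall fun d => (hn _).imp (hn _)
  · refine Measurable.forall fun u => (hn u).not.imp ?_
    exact (lt measurable_const (ha u).fst).and ((lt (ha u).fst measurable_const).and
      ((lt measurable_const (ha u).snd).and ((lt (ha u).snd measurable_const).and
        (lt measurable_const ((ha u).fst.add (ha u).snd)))))
  · exact Measurable.forall fun u => (hn u).not.imp ((hn _).not.imp
      (lt ((ha _).fst.add (ha _).snd) ((ha u).snd.add measurable_const)))
  · exact Measurable.forall fun u => (hn u).not.imp ((hn _).not.imp
      (lt ((ha _).fst.add (ha _).snd) ((ha u).fst.add measurable_const)))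

lemma measurableSet_isAllowed : MeasurableSet {p : ℝ × LTree | IsAllowed p.1 p.2} := by
  simp only [isAllowed_iff]
  refine measurableSet_setOfPred.2 (Measurable.and (measurable_preAllowed.comp measurable_snd) ?_)
  refine ((measurable_eq_none []).not.comp measurable_snd).imp ?_
  refine measurableSet_setOfPred.1 (measurableSet_lt ?_ measurable_const)
  have : Measurable fun p : ℝ × LTree => angles p.2 [] :=
    (measurable_angles []).comp measurable_snd
  exact (this.fst.add this.snd).add measurable_fst

lemma measurable_graft : Measurable fun x : (ℝ × ℝ) × LTree × LTree => graft x.1 x.2.1 x.2.2 := by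
  refine measurable_pi_lambda _ fun u => ?_
  rcases u with _ | ⟨d, u⟩
  · exact measurable_some_label.comp measurable_fst
  · cases d
    · exact (measurable_apply u).comp (measurable_fst.comp measurable_snd)
    · exact (measurable_apply u).comp (measurable_snd.comp measurable_snd)

lemma measurable_leftTree : Measurable leftTree :=
  measurable_pi_lambda _ fun u => measurable_apply (false :: u)

lemma measurable_rightTree : Measurable rightTree :=
  measurable_pi_lambda _ fun u => measurable_apply (true :: u)

lemma measurable_trunc (r : ℕ) : Measurable (trunc r) := by
  refine measurable_pi_lambda _ fun u => ?_
  by_cases h : u.length + 2 ≤ r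
  · simpa only [trunc, h, if_true] using measurable_apply u
  · simp only [trunc, h, if_false]; exact measurable_const

lemma measurableSet_isFinite : MeasurableSet {t | IsFinite t} := by
  have : {t | IsFinite t} = ⋃ S : Finset (List Bool), {t | ∀ u, ¬ u ∈ S → t u = none} := by
    ext t
    simp only [Set.mem_iUnion, Set.mem_ofPred_eq, IsFinite]
    constructor
    · intro h
      refine ⟨h.toFinset, fun u hu => ?_⟩
      by_contra hc
      exact hu (h.mem_toFinset.2 hc)
    · rintro ⟨S, hS⟩
      refine S.finite_toSet.subset fun u hu => ?_
      by_contra hc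
      exact hu (hS u hc)
  rw [this]
  exact MeasurableSet.iUnion fun S => measurableSet_setOfPred.2 <|
    Measurable.forall fun u => Measurable.imp measurable_const (measurable_eq_none u)

lemma measurableSet_finInf : MeasurableSet FinInf :=
  (measurableSet_setOfPred.2 (measurable_eq_none []).not).inter
    ((measurable_leftTree measurableSet_isFinite).inter
      (measurable_rightTree measurableSet_isFinite).compl)

lemma measurableSet_infFin : MeasurableSet InfFin :=
  (measurableSet_setOfPred.2 (measurable_eq_none []).not).inter
    ((measurable_leftTree measurableSet_isFinite).compl.inter
      (measurable_rightTree measurableSet_isFinite))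

/-! ### Grafting -/

@[simp] lemma graft_nil (p : ℝ × ℝ) (l r : LTree) : graft p l r [] = some p := rfl
@[simp] lemma graft_false (p : ℝ × ℝ) (l r : LTree) (u : List Bool) :
    graft p l r (false :: u) = l u := rfl
@[simp] lemma graft_true (p : ℝ × ℝ) (l r : LTree) (u : List Bool) :
    graft p l r (true :: u) = r u := rfl
@[simp] lemma leftTree_graft (p : ℝ × ℝ) (l r : LTree) : leftTree (graft p l r) = l := rfl
@[simp] lemma rightTree_graft (p : ℝ × ℝ) (l r : LTree) : rightTree (graft p l r) = r := rfl

/-- The pairs of angles that are allowed at the first cubic vertex. -/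
def rootRegion (θ : ℝ) : Set (ℝ × ℝ) :=
  {p | 0 < p.1 ∧ p.1 < Real.pi ∧ 0 < p.2 ∧ p.2 < Real.pi ∧ Real.pi < p.1 + p.2 ∧
    p.1 + p.2 + θ < 2 * Real.pi}

/-- The condition on the edge from the root to a child is the root condition of the subtree at that
child, of type `π` minus the angle facing the edge. -/
lemma isAllowed_graft (θ : ℝ) (p : ℝ × ℝ) (l r : LTree) : IsAllowed θ (graft p l r) ↔
    p ∈ rootRegion θ ∧ IsAllowed (Real.pi - p.2) l ∧ IsAllowed (Real.pi - p.1) r := by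
  constructor
  · rintro ⟨h1, h2, h3, h4, h5⟩
    have h := h2 [] p.1 p.2 rfl
    refine ⟨⟨h.1, h.2.1, h.2.2.1, h.2.2.2.1, h.2.2.2.2, h5 p.1 p.2 rfl⟩,
      ⟨fun u d hu => h1 (false :: u) d hu, fun u a b hu => h2 (false :: u) a b hu,
        fun u a b a' b' hu hu' => h3 (false :: u) a b a' b' hu hu',
        fun u a b a' b' hu hu' => h4 (false :: u) a b a' b' hu hu', fun a b hu => ?_⟩,
      ⟨fun u d hu => h1 (true :: u) d hu, fun u a b hu => h2 (true :: u) a b hu,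
        fun u a b a' b' hu hu' => h3 (true :: u) a b a' b' hu hu',
        fun u a b a' b' hu hu' => h4 (true :: u) a b a' b' hu hu', fun a b hu => ?_⟩⟩
    · have := h3 [] p.1 p.2 a b rfl hu
      linarith
    · have := h4 [] p.1 p.2 a b rfl hu
      linarith
  · rintro ⟨⟨p1, p2, p3, p4, p5, p6⟩, ⟨l1, l2, l3, l4, l5⟩, ⟨r1, r2, r3, r4, r5⟩⟩
    refine ⟨?_, ?_, ?_, ?_, ?_⟩
    · rintro (_ | ⟨_ | _, u⟩) d hu
      · simp [cubic]
      · exact l1 u d hu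
      · exact r1 u d hu
    · rintro (_ | ⟨_ | _, u⟩) a b hu
      · obtain rfl : p = (a, b) := by simpa using hu
        exact ⟨p1, p2, p3, p4, p5⟩
      · exact l2 u a b hu
      · exact r2 u a b hu
    · rintro (_ | ⟨_ | _, u⟩) a b a' b' hu hu'
      · obtain rfl : p = (a, b) := by simpa using hu
        have := l5 a' b' hu'
        simp only at this ⊢
        linarith
      · exact l3 u a b a' b' hu hu'
      · exact r3 u a b a' b' hu hu'
    · rintro (_ | ⟨_ | _, u⟩) a b a' b' hu hu'
      · obtain rfl : p = (a, b) := by simpa using hu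
        have := r5 a' b' hu'
        simp only at this ⊢
        linarith
      · exact l4 u a b a' b' hu hu'
      · exact r4 u a b a' b' hu hu'
    · intro a b hu
      obtain rfl : p = (a, b) := by simpa using hu
      exact p6

/-! ### Grafting of finite sets of addresses -/

/-- Finite plane binary trees, given by their sets of cubic vertices. -/
abbrev PCSet : Type := {S : Finset (List Bool) // ParentClosed (S : Set (List Bool))}

/-- The set of cubic vertices of the tree with left and right subtrees `L` and `R`. -/
def graftSet (L R : Finset (List Bool)) : Finset (List Bool) :=
  insert [] (L.map ⟨List.cons false, List.cons_injective⟩ ∪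
    R.map ⟨List.cons true, List.cons_injective⟩)

@[simp] lemma nil_mem_graftSet (L R : Finset (List Bool)) : [] ∈ graftSet L R := by
  simp [graftSet]

@[simp] lemma false_cons_mem_graftSet {L R : Finset (List Bool)} {u : List Bool} :
    false :: u ∈ graftSet L R ↔ u ∈ L := by
  simp [graftSet]

@[simp] lemma true_cons_mem_graftSet {L R : Finset (List Bool)} {u : List Bool} :
    true :: u ∈ graftSet L R ↔ u ∈ R := by
  simp [graftSet]

lemma card_graftSet (L R : Finset (List Bool)) : (graftSet L R).card = L.card + R.card + 1 := by
  rw [graftSet, Finset.card_insert_of_notMem (by simp),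
    Finset.card_union_of_disjoint, Finset.card_map, Finset.card_map]
  rw [Finset.disjoint_left]
  intro u hu hu'
  simp only [Finset.mem_map, Function.Embedding.coeFn_mk] at hu hu'
  obtain ⟨v, -, rfl⟩ := hu
  obtain ⟨v', -, h⟩ := hu'
  simp at h

lemma parentClosed_graftSet {L R : Finset (List Bool)} (hL : ParentClosed (L : Set (List Bool)))
    (hR : ParentClosed (R : Set (List Bool))) :
    ParentClosed (graftSet L R : Set (List Bool)) := by
  rintro (_ | ⟨_ | _, u⟩) d hu
  · simp
  · simp only [Finset.mem_coe, List.cons_append, false_cons_mem_graftSet] at hu ⊢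
    exact hL u d hu
  · simp only [Finset.mem_coe, List.cons_append, true_cons_mem_graftSet] at hu ⊢
    exact hR u d hu

/-- Grafting of finite binary trees. -/
def graftPC (p : PCSet × PCSet) : PCSet :=
  ⟨graftSet p.1.1 p.2.1, parentClosed_graftSet p.1.2 p.2.2⟩

lemma graftPC_injective : Function.Injective graftPC := by
  rintro ⟨⟨L, hL⟩, ⟨R, hR⟩⟩ ⟨⟨L', hL'⟩, ⟨R', hR'⟩⟩ h
  have h : graftSet L R = graftSet L' R' := congrArg Subtype.val h
  have h1 : L = L' := by
    ext u; rw [← false_cons_mem_graftSet (R := R), h, false_cons_mem_graftSet]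
  have h2 : R = R' := by
    ext u; rw [← true_cons_mem_graftSet (L := L), h, true_cons_mem_graftSet]
  subst h1 h2; rfl

lemma ParentClosed.nil_mem {S : Set (List Bool)} (hS : ParentClosed S) {u : List Bool}
    (hu : u ∈ S) : [] ∈ S := by
  induction u using List.reverseRecOn with
  | nil => exact hu
  | append_singleton u d ih => exact ih (hS u d hu)

lemma exists_graftPC_eq (S : PCSet) (hS : S.1.Nonempty) : ∃ p, graftPC p = S := by
  obtain ⟨S, h⟩ := S
  obtain ⟨u, hu⟩ := hS
  have h0 : [] ∈ S := h.nil_mem hu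
  have key : ∀ d : Bool, ParentClosed
      ((S.preimage (List.cons d) List.cons_injective.injOn : Finset (List Bool)) :
        Set (List Bool)) := fun d v e hv => by
    simp only [Finset.coe_preimage, Set.mem_preimage, Finset.mem_coe] at hv ⊢
    exact h (d :: v) e hv
  refine ⟨(⟨_, key false⟩, ⟨_, key true⟩), Subtype.ext ?_⟩
  ext v
  rcases v with _ | ⟨_ | _, v⟩
  · simp [graftPC, h0]
  · simp [graftPC]
  · simp [graftPC]

lemma label_empty : label ∅ = fun _ _ => none := by
  ext x u : 2; simp [label]

/-- The cubic vertices of a grafted tree: the root, those on its left and those on its right. -/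
def graftIndexEquiv (L R : Finset (List Bool)) : Unit ⊕ (L ⊕ R) ≃ graftSet L R where
  toFun
    | Sum.inl _ => ⟨[], by simp⟩
    | Sum.inr (Sum.inl u) => ⟨false :: u.1, by simp⟩
    | Sum.inr (Sum.inr u) => ⟨true :: u.1, by simp⟩
  invFun
    | ⟨[], _⟩ => Sum.inl ()
    | ⟨false :: u, h⟩ => Sum.inr (Sum.inl ⟨u, by simpa using h⟩)
    | ⟨true :: u, h⟩ => Sum.inr (Sum.inr ⟨u, by simpa using h⟩)
  left_inv := by rintro (_ | _ | _) <;> rfl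
  right_inv := by rintro ⟨_ | ⟨_ | _, u⟩, h⟩ <;> rfl

/-- Lebesgue measure on all labelings of a given tree. -/
def rawLeb (S : Finset (List Bool)) : Measure LTree := (volume : Measure (S → ℝ × ℝ)).map (label S)

instance (S : Finset (List Bool)) : SFinite (rawLeb S) := by unfold rawLeb; infer_instance

/-- Labelings of a grafted tree are triples of a label at the root and of labelings of the two
subtrees. -/
lemma rawLeb_graftSet (L R : Finset (List Bool)) : rawLeb (graftSet L R)
    = ((volume : Measure (ℝ × ℝ)).prod ((rawLeb L).prod (rawLeb R))).map
      fun x => graft x.1 x.2.1 x.2.2 := by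
  set E := ℝ × ℝ
  have h1 := volume_measurePreserving_piCongrLeft (fun _ : graftSet L R => E) (graftIndexEquiv L R)
  have h2 := volume_measurePreserving_sumPiEquivProdPi_symm (fun _ : Unit ⊕ (L ⊕ R) => E)
  have h3 := volume_measurePreserving_sumPiEquivProdPi_symm (fun _ : L ⊕ R => E)
  have h4 := (volume_preserving_funUnique Unit E).symm
  have h := h1.comp (h2.comp (h4.prod h3))
  rw [rawLeb, ← h.map_eq, Measure.map_map (measurable_label _) h.measurable, rawLeb, rawLeb,
    Measure.map_prod_map _ _ (measurable_label L) (measurable_label R)]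
  nth_rewrite 2 [← Measure.map_id (μ := (volume : Measure E))]
  rw [Measure.map_prod_map _ _ measurable_id
    ((measurable_label L).prodMap (measurable_label R)), Measure.map_map measurable_graft
    (measurable_id.prodMap ((measurable_label L).prodMap (measurable_label R)))]
  congr 1
  ext x u : 2
  obtain ⟨p, xl, xr⟩ := x
  have key : ∀ i : Unit ⊕ (L ⊕ R), ∀ y : Unit ⊕ (L ⊕ R) → E,
      (MeasurableEquiv.piCongrLeft (fun _ : graftSet L R => E) (graftIndexEquiv L R)) y
        (graftIndexEquiv L R i) = y i :=
    fun i y => Equiv.piCongrLeft_apply_apply (fun _ : graftSet L R => E) (graftIndexEquiv L R) y i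
  rcases u with _ | ⟨_ | _, u⟩
  · simp only [Function.comp, label, nil_mem_graftSet, dite_true]
    exact congrArg some (key (Sum.inl ()) _)
  · by_cases hu : u ∈ L
    · simp only [Function.comp, label, false_cons_mem_graftSet, hu, dite_true, Prod.map, graft]
      exact congrArg some (key (Sum.inr (Sum.inl ⟨u, hu⟩)) _)
    · simp [Function.comp, label, hu, graft]
  · by_cases hu : u ∈ R
    · simp only [Function.comp, label, true_cons_mem_graftSet, hu, dite_true, Prod.map, graft]
      exact congrArg some (key (Sum.inr (Sum.inr ⟨u, hu⟩)) _)
    · simp [Function.comp, label, hu, graft]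

/-! ### The number of leaves -/

lemma cubic_label (S : Finset (List Bool)) (x : S → ℝ × ℝ) : cubic (label S x) = S := by
  ext u
  by_cases h : u ∈ S <;> simp [cubic, label, h]

lemma nonrootLeaves_label (S : Finset (List Bool)) (x : S → ℝ × ℝ) : nonrootLeaves (label S x)
    = {u | ¬ u ∈ S ∧ ∀ v d, u = v ++ [d] → v ∈ S} := by
  ext u
  have : ∀ v, label S x v = none ↔ ¬ v ∈ S := fun v => by
    by_cases h : v ∈ S <;> simp [label, h]
  simp only [nonrootLeaves, Set.mem_ofPred_eq, ne_eq, this, not_not]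

/-- Every vertex other than the root leaf is the first vertex or a child of a cubic vertex. -/
lemma encard_nonrootLeaves_label (S : PCSet) (x : S.1 → ℝ × ℝ) :
    (nonrootLeaves (label S.1 x)).encard = S.1.card + 1 := by
  classical
  rw [nonrootLeaves_label]
  -- all vertices but the root leaf
  set C : Finset (List Bool) := insert []
    ((S.1 ×ˢ (Finset.univ : Finset Bool)).image fun p => p.1 ++ [p.2]) with hC
  have hcard : C.card = 2 * S.1.card + 1 := by
    rw [hC, Finset.card_insert_of_notMem (by simp), Finset.card_image_of_injective]
    · simp [Finset.card_product, mul_comm]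
    · rintro ⟨u, d⟩ ⟨v, e⟩ h
      have := List.append_inj' h rfl
      simpa using this
  have hSC : S.1 ⊆ C := fun u hu => by
    rcases List.eq_nil_or_concat u with rfl | ⟨v, d, rfl⟩
    · simp [hC]
    · have : v ∈ S.1 := S.2 v d (by simpa using hu)
      simp [hC, this]
  have hset : {u | ¬ u ∈ S.1 ∧ ∀ v d, u = v ++ [d] → v ∈ S.1} = ((C \ S.1 : Finset _) : Set _) := by
    ext u
    simp only [Set.mem_ofPred_eq, Finset.coe_sdiff, Set.mem_sdiff, Finset.mem_coe]
    rw [and_comm]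
    refine and_congr_left fun _ => ?_
    rcases List.eq_nil_or_concat u with rfl | ⟨v, d, rfl⟩
    · simp [hC]
    · constructor
      · intro h
        have := h v d (by simp)
        simp [hC, this]
      · intro h w e hw
        simp [hC] at h
        simp at hw
        rw [← hw.1]
        exact h
  rw [hset, Set.encard_coe_eq_coe_finsetCard, Finset.card_sdiff_of_subset hSC, hcard]
  have : 2 * S.1.card + 1 - S.1.card = S.1.card + 1 := by omega
  rw [this]; push_cast; rfl

lemma numLeaves_label (S : PCSet) (x : S.1 → ℝ × ℝ) :
    numLeaves (label S.1 x) = (S.1.card + 2 : ℕ) := by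
  rw [numLeaves, encard_nonrootLeaves_label]
  push_cast
  rw [add_assoc, one_add_one_eq_two]

lemma measurableSet_numLeaves (n : ℕ) : MeasurableSet {t | numLeaves t = n} := by
  have hmem : ∀ u, MeasurableSet {t : LTree | u ∈ nonrootLeaves t} := fun u => by
    refine measurableSet_setOfPred.2 ((measurable_eq_none u).and ?_)
    exact Measurable.forall fun v => Measurable.forall fun d =>
      measurable_const.imp (measurable_eq_none v).not
  have : {t | numLeaves t = n} = ⋃ L : {L : Finset (List Bool) // L.card + 1 = n},
      {t | ∀ u, u ∈ nonrootLeaves t ↔ u ∈ L.1} := by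
    ext t
    simp only [Set.mem_iUnion, Set.mem_ofPred_eq, numLeaves]
    constructor
    · intro h
      have hfin : (nonrootLeaves t).Finite := by
        rw [← Set.encard_lt_top_iff]
        refine lt_of_le_of_lt le_self_add (h ▸ ENat.natCast_lt_top n)
      refine ⟨⟨hfin.toFinset, ?_⟩, fun u => by simp⟩
      rw [hfin.encard_eq_coe_toFinset_card] at h
      exact_mod_cast h
    · rintro ⟨⟨L, hL⟩, h⟩
      have : nonrootLeaves t = L := by ext u; simpa using h u
      rw [this, Set.encard_coe_eq_coe_finsetCard, ← hL]; push_cast; rfl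
  rw [this]
  refine MeasurableSet.iUnion fun L => measurableSet_setOfPred.2 (Measurable.forall fun u => ?_)
  exact (measurableSet_setOfPred.1 (hmem u)).iff measurable_const

/-! ### The change of variables at the root -/

lemma measurableSet_splitRegion (θ : AngleType) : MeasurableSet (splitRegion θ) := by
  have h1 : Measurable fun p : AngleType × AngleType => (p.1 : ℝ) + (p.2 : ℝ) :=
    (measurable_subtype_coe.comp measurable_fst).add (measurable_subtype_coe.comp measurable_snd)
  exact (measurableSet_lt measurable_const h1).inter (measurableSet_lt h1 measurable_const)

lemma measurableSet_splitRegion_joint :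
    MeasurableSet {x : AngleType × (AngleType × AngleType) | x.2 ∈ splitRegion x.1} := by
  have h1 : Measurable fun x : AngleType × (AngleType × AngleType) => (x.2.1 : ℝ) + (x.2.2 : ℝ) :=
    (measurable_subtype_coe.comp (measurable_fst.comp measurable_snd)).add
      (measurable_subtype_coe.comp (measurable_snd.comp measurable_snd))
  exact (measurableSet_lt (measurable_subtype_coe.comp measurable_fst) h1).inter
    (measurableSet_lt h1 measurable_const)

instance : SFinite (Measure.comap (fun α : AngleType => (α : ℝ)) volume) := by
  have : IsFiniteMeasure (Measure.comap (fun α : AngleType => (α : ℝ)) volume) := by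
    refine ⟨?_⟩
    rw [(MeasurableEmbedding.subtype_coe measurableSet_Ico).comap_apply, Set.image_univ,
      Subtype.range_coe, Real.volume_Ico]
    exact ENNReal.ofReal_lt_top
  infer_instance

instance : SFinite lebPairs := by unfold lebPairs; infer_instance

lemma map_lebPairs : lebPairs.map (fun q => ((q.1 : ℝ), (q.2 : ℝ)))
    = (volume : Measure (ℝ × ℝ)).restrict (Set.Ico 0 Real.pi ×ˢ Set.Ico 0 Real.pi) := by
  have h := Measure.map_prod_map (Measure.comap (fun α : AngleType => (α : ℝ)) volume)
    (Measure.comap (fun α : AngleType => (α : ℝ)) volume) measurable_subtype_coe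
    measurable_subtype_coe
  have h2 : Measure.map Subtype.val (Measure.comap (fun α : AngleType => (α : ℝ)) volume)
      = volume.restrict (Set.Ico 0 Real.pi) := map_comap_subtype_coe measurableSet_Ico volume
  rw [h2, Measure.prod_restrict] at h
  exact h.symm

/-- The pairs `(α, β)` with `α, β ≥ 0` and `θ < α + β < π`. -/
def realSplit (θ : ℝ) : Set (ℝ × ℝ) :=
  {q | 0 ≤ q.1 ∧ 0 ≤ q.2 ∧ θ < q.1 + q.2 ∧ q.1 + q.2 < Real.pi}

lemma measurableSet_realSplit (θ : ℝ) : MeasurableSet (realSplit θ) := by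
  refine MeasurableSet.inter (measurableSet_le measurable_const measurable_fst)
    (MeasurableSet.inter (measurableSet_le measurable_const measurable_snd)
    (MeasurableSet.inter (measurableSet_lt measurable_const (measurable_fst.add measurable_snd))
    (measurableSet_lt (measurable_fst.add measurable_snd) measurable_const)))

lemma setLIntegral_splitRegion (θ : AngleType) {f : ℝ × ℝ → ENNReal} (hf : Measurable f) :
    ∫⁻ q in splitRegion θ, f (q.1, q.2) ∂lebPairs = ∫⁻ q in realSplit θ, f q := by
  have hm : Measurable fun q : AngleType × AngleType => ((q.1 : ℝ), (q.2 : ℝ)) :=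
    (measurable_subtype_coe.comp measurable_fst).prodMk (measurable_subtype_coe.comp measurable_snd)
  have hpre : splitRegion θ = (fun q : AngleType × AngleType => ((q.1 : ℝ), (q.2 : ℝ))) ⁻¹'
      realSplit θ := by
    ext q
    simp only [splitRegion, realSplit, Set.mem_preimage, Set.mem_ofPred_eq]
    exact ⟨fun h => ⟨q.1.2.1, q.2.2.1, h.1, h.2⟩, fun h => ⟨h.2.2.1, h.2.2.2⟩⟩
  rw [hpre, ← setLIntegral_map (measurableSet_realSplit θ) hf hm, map_lebPairs,
    Measure.restrict_restrict (measurableSet_realSplit θ), Set.inter_eq_left.2]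
  rintro ⟨a, b⟩ ⟨h1, h2, h3, h4⟩
  simp only at h1 h2 h3 h4
  exact ⟨⟨h1, by simp only; linarith⟩, ⟨h2, by simp only; linarith⟩⟩

lemma measurableSet_rootRegion (θ : ℝ) : MeasurableSet (rootRegion θ) := by
  refine MeasurableSet.inter (measurableSet_lt measurable_const measurable_fst)
    (MeasurableSet.inter (measurableSet_lt measurable_fst measurable_const)
    (MeasurableSet.inter (measurableSet_lt measurable_const measurable_snd)
    (MeasurableSet.inter (measurableSet_lt measurable_snd measurable_const)
    (MeasurableSet.inter (measurableSet_lt measurable_const (measurable_fst.add measurable_snd))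
    (measurableSet_lt ((measurable_fst.add measurable_snd).add measurable_const)
      measurable_const)))))

lemma measurePreserving_swap_sub : MeasurePreserving
    (fun p : ℝ × ℝ => (Real.pi - p.2, Real.pi - p.1)) volume volume := by
  have h := Measure.measurePreserving_sub_left (volume : Measure ℝ) Real.pi
  have h2 := (h.prod h).comp (Measure.measurePreserving_swap (μ := (volume : Measure ℝ))
    (ν := (volume : Measure ℝ)))
  exact h2

/-- The substitution `(α, β) = (π - b, π - a)` from the angles at the first cubic vertex to the
types of the two subtrees. -/
lemma setLIntegral_rootRegion (θ : AngleType) {f : ℝ × ℝ → ENNReal} (hf : Measurable f) :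
    ∫⁻ p in rootRegion θ, f (Real.pi - p.2, Real.pi - p.1)
      = ∫⁻ q in splitRegion θ, f (q.1, q.2) ∂lebPairs := by
  rw [setLIntegral_splitRegion θ hf]
  have hpre : rootRegion θ = (fun p : ℝ × ℝ => (Real.pi - p.2, Real.pi - p.1)) ⁻¹'
      {q | 0 < q.1 ∧ 0 < q.2 ∧ (θ : ℝ) < q.1 + q.2 ∧ q.1 + q.2 < Real.pi} := by
    ext ⟨a, b⟩
    simp only [rootRegion, Set.mem_preimage, Set.mem_ofPred_eq]
    constructor
    · rintro ⟨h1, h2, h3, h4, h5, h6⟩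
      refine ⟨?_, ?_, ?_, ?_⟩ <;> linarith
    · rintro ⟨h1, h2, h3, h4⟩
      refine ⟨?_, ?_, ?_, ?_, ?_, ?_⟩ <;> linarith
  have hms : MeasurableSet {q : ℝ × ℝ | 0 < q.1 ∧ 0 < q.2 ∧ (θ : ℝ) < q.1 + q.2 ∧
      q.1 + q.2 < Real.pi} := by
    refine MeasurableSet.inter (measurableSet_lt measurable_const measurable_fst)
      (MeasurableSet.inter (measurableSet_lt measurable_const measurable_snd)
      (MeasurableSet.inter (measurableSet_lt measurable_const (measurable_fst.add measurable_snd))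
      (measurableSet_lt (measurable_fst.add measurable_snd) measurable_const)))
  rw [hpre, measurePreserving_swap_sub.setLIntegral_comp_preimage hms hf]
  -- the two regions differ by pieces of the coordinate axes
  refine setLIntegral_congr ?_
  have hz1 : ∀ᵐ q : ℝ × ℝ, q.1 ≠ 0 := by
    have := (Measure.quasiMeasurePreserving_fst (μ := (volume : Measure ℝ))
      (ν := (volume : Measure ℝ))).ae (p := fun x => x ≠ 0) (by simp [ae_iff])
    exact this
  have hz2 : ∀ᵐ q : ℝ × ℝ, q.2 ≠ 0 := by
    have := (Measure.quasiMeasurePreserving_snd (μ := (volume : Measure ℝ))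
      (ν := (volume : Measure ℝ))).ae (p := fun x => x ≠ 0) (by simp [ae_iff])
    exact this
  filter_upwards [hz1, hz2] with q h1 h2
  refine propext ⟨fun h => ⟨h.1.le, h.2.1.le, h.2.2⟩, fun h =>
    ⟨lt_of_le_of_ne h.1 h1.symm, lt_of_le_of_ne h.2.1 h2.symm, h.2.2⟩⟩

/-! ### Pairs of independent subtrees -/

/-- The integral of `φ` over the trees whose left and right subtrees have the types `q.1`, `q.2`
and are distributed according to `κ` and `η`. -/
def graftInt (κ η : Kernel AngleType LTree) (φ : LTree → ENNReal) (q : AngleType × AngleType) :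
    ENNReal :=
  ∫⁻ l, ∫⁻ r, φ (graft (Real.pi - q.2, Real.pi - q.1) l r) ∂(η q.2) ∂(κ q.1)

lemma measurable_graft_of_pair : Measurable fun x : (AngleType × AngleType) × LTree × LTree =>
    graft (Real.pi - (x.1.2 : ℝ), Real.pi - (x.1.1 : ℝ)) x.2.1 x.2.2 := by
  refine measurable_graft.comp (Measurable.prodMk (Measurable.prodMk ?_ ?_) measurable_snd)
  · exact measurable_const.sub (measurable_subtype_coe.comp (measurable_snd.comp measurable_fst))
  · exact measurable_const.sub (measurable_subtype_coe.comp (measurable_fst.comp measurable_fst))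

lemma measurable_graftInt (κ η : Kernel AngleType LTree) [IsSFiniteKernel κ] [IsSFiniteKernel η]
    {φ : LTree → ENNReal} (hφ : Measurable φ) : Measurable (graftInt κ η φ) := by
  have h : graftInt κ η φ = fun q => ∫⁻ x : LTree × LTree,
      φ (graft (Real.pi - (q.2 : ℝ), Real.pi - (q.1 : ℝ)) x.1 x.2)
        ∂(((κ.comap Prod.fst measurable_fst) ×ₖ (η.comap Prod.snd measurable_snd)) q) := by
    ext q
    have hm : Measurable fun x : LTree × LTree =>
        φ (graft (Real.pi - (q.2 : ℝ), Real.pi - (q.1 : ℝ)) x.1 x.2) :=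
      hφ.comp (measurable_graft_of_pair.comp measurable_prodMk_left)
    rw [Kernel.lintegral_prod _ _ _ hm]
    rfl
  rw [h]
  exact Measurable.lintegral_kernel_prod_right (f := fun (q : AngleType × AngleType)
    (x : LTree × LTree) => φ (graft (Real.pi - (q.2 : ℝ), Real.pi - (q.1 : ℝ)) x.1 x.2))
    (hφ.comp measurable_graft_of_pair)

lemma measurable_graft_section {φ : LTree → ENNReal} (hφ : Measurable φ) (p : ℝ × ℝ) :
    Measurable fun x : LTree × LTree => φ (graft p x.1 x.2) :=
  hφ.comp (measurable_graft.comp measurable_prodMk_left)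

lemma lintegral_lintegral_sum {ι ι' : Type*} (μ : ι → Measure LTree)
    (ν : ι' → Measure LTree) [Countable ι'] [∀ j, SFinite (ν j)] {G : LTree × LTree → ENNReal}
    (hG : Measurable G) :
    ∫⁻ l, ∫⁻ r, G (l, r) ∂(Measure.sum ν) ∂(Measure.sum μ)
      = ∑' i, ∑' j, ∫⁻ l, ∫⁻ r, G (l, r) ∂(ν j) ∂(μ i) := by
  rw [lintegral_sum_measure]
  refine tsum_congr fun i => ?_
  simp only [lintegral_sum_measure]
  exact lintegral_tsum fun j => hG.lintegral_prod_right'.aemeasurable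

/-! ### The measures on trees with a given number of leaves -/

/-- Lebesgue measure on the labelings of a tree that are allowed at type `θ`. -/
def lebS (θ : ℝ) (S : Finset (List Bool)) : Measure LTree :=
  (rawLeb S).restrict {t | IsAllowed θ t}

instance (θ : ℝ) (S : Finset (List Bool)) : SFinite (lebS θ S) := by unfold lebS; infer_instance

lemma measurableSet_isAllowed_section (θ : ℝ) : MeasurableSet {t | IsAllowed θ t} :=
  measurable_prodMk_left measurableSet_isAllowed

lemma leb_eq_lebS {n : ℕ} (θ : ℝ) (τ : Bin n) : leb θ τ = lebS θ τ.1 := by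
  rw [leb, lebS, rawLeb, Measure.restrict_map (measurable_label _)
    (measurableSet_isAllowed_section θ)]
  rfl

lemma volume_allowedAngles {n : ℕ} (θ : ℝ) (τ : Bin n) :
    volume (allowedAngles θ τ) = lebS θ τ.1 Set.univ := by
  rw [← leb_eq_lebS, leb, Measure.map_apply (measurable_label _) MeasurableSet.univ]
  simp

/-- The recursion at the root for the Lebesgue measures. -/
lemma lintegral_lebS_graftSet (θ : AngleType) (L R : Finset (List Bool)) {φ : LTree → ENNReal}
    (hφ : Measurable φ) : ∫⁻ t, φ t ∂(lebS θ (graftSet L R))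
      = ∫⁻ q in splitRegion θ, ∫⁻ l, ∫⁻ r, φ (graft (Real.pi - q.2, Real.pi - q.1) l r)
        ∂(lebS q.2 R) ∂(lebS q.1 L) ∂lebPairs := by
  set A : ℝ → Set LTree := fun θ => {t | IsAllowed θ t} with hA
  have hAm := measurableSet_isAllowed_section
  -- the integrand in terms of the types and of the two subtrees, with the restrictions of the
  -- measures written as indicator functions
  set K : ((ℝ × ℝ) × LTree) × LTree → ENNReal := fun x =>
    (A x.1.1.1).indicator 1 x.1.2 * ((A x.1.1.2).indicator 1 x.2 *
      φ (graft (Real.pi - x.1.1.2, Real.pi - x.1.1.1) x.1.2 x.2)) with hK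
  have hind : Measurable fun p : ℝ × LTree => (A p.1).indicator (1 : LTree → ENNReal) p.2 := by
    have : (fun p : ℝ × LTree => (A p.1).indicator (1 : LTree → ENNReal) p.2)
        = {p : ℝ × LTree | IsAllowed p.1 p.2}.indicator 1 := by
      ext p; by_cases h : IsAllowed p.1 p.2 <;> simp [hA, h]
    rw [this]
    exact measurable_one.indicator measurableSet_isAllowed
  have hKm : Measurable K := by
    refine Measurable.mul ?_ (Measurable.mul ?_ (hφ.comp ?_))
    · exact hind.comp ((measurable_fst.comp (measurable_fst.comp measurable_fst)).prodMk
        (measurable_snd.comp measurable_fst))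
    · exact hind.comp ((measurable_snd.comp (measurable_fst.comp measurable_fst)).prodMk
        measurable_snd)
    · refine measurable_graft.comp (Measurable.prodMk (Measurable.prodMk ?_ ?_) (Measurable.prodMk
        (measurable_snd.comp measurable_fst) measurable_snd))
      · exact measurable_const.sub (measurable_snd.comp (measurable_fst.comp measurable_fst))
      · exact measurable_const.sub (measurable_fst.comp (measurable_fst.comp measurable_fst))
  set H : ℝ × ℝ → ENNReal := fun q => ∫⁻ l, ∫⁻ r, K ((q, l), r) ∂(rawLeb R) ∂(rawLeb L) with hH
  have hHm : Measurable H := by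
    have h1 : Measurable fun x : (ℝ × ℝ) × LTree => ∫⁻ r, K (x, r) ∂(rawLeb R) :=
      hKm.lintegral_prod_right'
    exact h1.lintegral_prod_right'
  have hHeq : ∀ q : AngleType × AngleType, H (q.1, q.2)
      = ∫⁻ l, ∫⁻ r, φ (graft (Real.pi - q.2, Real.pi - q.1) l r) ∂(lebS q.2 R) ∂(lebS q.1 L) := by
    intro q
    have hone : ∀ (B : Set LTree) (f : LTree → ENNReal) (x : LTree),
        B.indicator f x = B.indicator 1 x * f x := fun B f x => by
      by_cases h : x ∈ B <;> simp [h]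
    have hs := measurable_graft_section hφ (Real.pi - q.2, Real.pi - q.1)
    rw [lebS, ← lintegral_indicator (hAm _)]
    simp only [hH, hK, lebS]
    refine lintegral_congr fun l => ?_
    have hr : Measurable fun r => (A q.2).indicator 1 r *
        φ (graft (Real.pi - (q.2 : ℝ), Real.pi - (q.1 : ℝ)) l r) :=
      ((measurable_one.indicator (hAm _))).mul (hs.comp measurable_prodMk_left)
    rw [lintegral_const_mul _ hr]
    refine Eq.trans ?_ (hone _ _ l).symm
    congr 1
    rw [← lintegral_indicator (hAm _)]
    exact lintegral_congr fun r => (hone _ (fun r => φ (graft (Real.pi - (q.2 : ℝ),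
      Real.pi - (q.1 : ℝ)) l r)) r).symm
  simp only [← hHeq]
  rw [← setLIntegral_rootRegion θ hHm, lebS, ← lintegral_indicator (hAm _), rawLeb_graftSet,
    lintegral_map (hφ.indicator (hAm _)) measurable_graft,
    lintegral_prod (fun x : (ℝ × ℝ) × LTree × LTree =>
      {t | IsAllowed θ t}.indicator φ (graft x.1 x.2.1 x.2.2))
      ((hφ.indicator (hAm _)).comp measurable_graft).aemeasurable,
    ← lintegral_indicator (measurableSet_rootRegion θ)]
  refine lintegral_congr fun p => ?_
  have hp : Measurable fun x : LTree × LTree => (A θ).indicator φ (graft p x.1 x.2) :=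
    measurable_graft_section (hφ.indicator (hAm _)) p
  rw [lintegral_prod _ hp.aemeasurable]
  have hpt : ∀ l r, (A θ).indicator φ (graft p l r) = (rootRegion θ).indicator
      (fun p => K (((Real.pi - p.2, Real.pi - p.1), l), r)) p := by
    intro l r
    have h := isAllowed_graft θ p l r
    simp only [hK, sub_sub_cancel]
    by_cases h1 : p ∈ rootRegion θ <;> by_cases h2 : IsAllowed (Real.pi - p.2) l <;>
      by_cases h3 : IsAllowed (Real.pi - p.1) r <;> simp [hA, Set.indicator, h, h1, h2, h3]
  by_cases h1 : p ∈ rootRegion θ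
  · rw [Set.indicator_of_mem h1]
    exact lintegral_congr fun l => lintegral_congr fun r => by
      rw [hpt, Set.indicator_of_mem h1]
  · rw [Set.indicator_of_notMem h1]
    simp only [hpt, Set.indicator_of_notMem h1, lintegral_zero]

/-- The weight of a finite tree: `x` to the number of leaves (the root leaf excepted), if the tree
has `m` cubic vertices. -/
def wt (x : ℝ) (m : ℕ) (S : PCSet) : ENNReal :=
  if S.1.card = m then ENNReal.ofReal x ^ (m + 1) else 0

lemma wt_graftPC (x : ℝ) (m : ℕ) (p : PCSet × PCSet) : wt x (m + 1) (graftPC p)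
    = ∑ ij ∈ Finset.HasAntidiagonal.antidiagonal m, wt x ij.1 p.1 * wt x ij.2 p.2 := by
  obtain ⟨L, R⟩ := p
  simp only [wt, graftPC, card_graftSet, add_left_inj]
  by_cases h : L.1.card + R.1.card = m
  · rw [if_pos h, Finset.sum_eq_single (L.1.card, R.1.card)]
    · simp only [if_true, ← pow_add]
      congr 1; omega
    · rintro ⟨i, j⟩ - hne
      by_cases hi : L.1.card = i
      · by_cases hj : R.1.card = j
        · exact absurd (by rw [hi, hj]) hne
        · simp [hj]
      · simp [hi]
    · intro hn
      exact absurd (Finset.HasAntidiagonal.mem_antidiagonal.2 h) hn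
  · rw [if_neg h, Finset.sum_eq_zero]
    rintro ⟨i, j⟩ hij
    have hij := Finset.HasAntidiagonal.mem_antidiagonal.1 hij
    by_cases hi : L.1.card = i
    · by_cases hj : R.1.card = j
      · exact absurd (by rw [hi, hj]; exact hij) h
      · simp [hj]
    · simp [hi]

/-- Lebesgue measure on the allowed labelings of a tree, as a kernel. -/
def lebK (S : Finset (List Bool)) : Kernel AngleType LTree :=
  (Kernel.const AngleType (rawLeb S)).withDensity fun θ t => {t | IsAllowed θ t}.indicator 1 t

instance (S : Finset (List Bool)) : IsSFiniteKernel (lebK S) :=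
  Kernel.IsSFiniteKernel.withDensity _ fun θ t => by
    by_cases h : IsAllowed θ t <;> simp [h]

lemma lebK_apply (S : Finset (List Bool)) (θ : AngleType) : lebK S θ = lebS θ S := by
  have hm : Measurable (Function.uncurry fun (θ : AngleType) (t : LTree) =>
      {t | IsAllowed θ t}.indicator (1 : LTree → ENNReal) t) := by
    have : (fun p : AngleType × LTree => {t | IsAllowed p.1 t}.indicator (1 : LTree → ENNReal) p.2)
        = {p : AngleType × LTree | IsAllowed p.1 p.2}.indicator 1 := by
      ext p; by_cases h : IsAllowed p.1 p.2 <;> simp [h]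
    change Measurable fun p : AngleType × LTree =>
      {t | IsAllowed p.1 t}.indicator (1 : LTree → ENNReal) p.2
    rw [this]
    exact measurable_one.indicator (measurableSet_isAllowed.preimage
      ((measurable_subtype_coe.comp measurable_fst).prodMk measurable_snd))
  rw [lebK, Kernel.withDensity_apply _ hm, Kernel.const_apply, lebS]
  exact withDensity_indicator_one (measurableSet_isAllowed_section θ)

lemma graftInt_lebK (L R : Finset (List Bool)) (φ : LTree → ENNReal) (q : AngleType × AngleType) :
    graftInt (lebK L) (lebK R) φ q = ∫⁻ l, ∫⁻ r, φ (graft (Real.pi - q.2, Real.pi - q.1) l r)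
      ∂(lebS q.2 R) ∂(lebS q.1 L) := by
  rw [graftInt, lebK_apply, lebK_apply]

lemma wt_ne_top (x : ℝ) (m : ℕ) (S : PCSet) : wt x m S ≠ ⊤ := by
  rw [wt]; split_ifs
  · exact ENNReal.pow_ne_top ENNReal.ofReal_ne_top
  · exact ENNReal.zero_ne_top

/-- The measure `x^(m+1) ∑_τ Leb_{A_{θ,τ}}` on labeled trees with `m` cubic vertices, that is with
`m + 2` leaves, as a kernel. -/
def nuK (x : ℝ) (m : ℕ) : Kernel AngleType LTree :=
  Kernel.sum fun S : PCSet => (lebK S.1).withDensity fun _ _ => wt x m S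

instance (x : ℝ) (m : ℕ) : IsSFiniteKernel (nuK x m) := by
  have : ∀ S : PCSet, IsSFiniteKernel ((lebK S.1).withDensity fun _ _ => wt x m S) := fun S =>
    Kernel.IsSFiniteKernel.withDensity _ fun _ _ => wt_ne_top x m S
  exact Kernel.isSFiniteKernel_sum

lemma nuK_apply (x : ℝ) (m : ℕ) (θ : AngleType) :
    nuK x m θ = Measure.sum fun S : PCSet => wt x m S • lebS θ S.1 := by
  rw [nuK, Kernel.sum_apply]
  congr 1
  ext S : 1
  rw [Kernel.withDensity_apply _ (by exact measurable_const), withDensity_const, lebK_apply]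

lemma tsum_bin (m : ℕ) (f : Finset (List Bool) → ENNReal) :
    ∑' τ : Bin (m + 2), f τ.1 = ∑' S : PCSet, if S.1.card = m then f S.1 else 0 := by
  set g : Bin (m + 2) → PCSet := fun τ => ⟨τ.1, τ.2.1⟩ with hg
  have hinj : Function.Injective g := fun τ τ' h =>
    Subtype.ext (congrArg (fun S : PCSet => S.1) h)
  rw [← hinj.tsum_eq (f := fun S : PCSet => if S.1.card = m then f S.1 else 0)]
  · refine tsum_congr fun τ => ?_
    have : τ.1.card = m := by have := τ.2.2; omega
    simp [hg, this]
  · intro S hS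
    have : S.1.card = m := by
      by_contra hc
      simp [hc] at hS
    exact ⟨⟨S.1, S.2, by omega⟩, rfl⟩

lemma lintegral_nuK (x : ℝ) (m : ℕ) (θ : AngleType) (φ : LTree → ENNReal) :
    ∫⁻ t, φ t ∂(nuK x m θ) = ∑' S : PCSet, wt x m S * ∫⁻ t, φ t ∂(lebS θ S.1) := by
  rw [nuK_apply, lintegral_sum_measure]
  simp only [lintegral_smul_measure, smul_eq_mul]

lemma nuK_eq (x : ℝ) (m : ℕ) (θ : AngleType) :
    nuK x m θ = ENNReal.ofReal x ^ (m + 1) • Measure.sum fun τ : Bin (m + 2) => leb θ τ := by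
  refine Measure.ext_of_lintegral _ fun φ hφ => ?_
  rw [lintegral_nuK, lintegral_smul_measure, lintegral_sum_measure]
  simp only [leb_eq_lebS, smul_eq_mul]
  rw [tsum_bin m fun S => ∫⁻ t, φ t ∂(lebS θ S), ← ENNReal.tsum_mul_left]
  refine tsum_congr fun S => ?_
  simp only [wt]
  split_ifs <;> simp

lemma graftInt_nuK (x : ℝ) (i j : ℕ) {φ : LTree → ENNReal} (hφ : Measurable φ)
    (q : AngleType × AngleType) : graftInt (nuK x i) (nuK x j) φ q
      = ∑' L : PCSet, ∑' R : PCSet, wt x i L * wt x j R * ∫⁻ l, ∫⁻ r,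
        φ (graft (Real.pi - q.2, Real.pi - q.1) l r) ∂(lebS q.2 R.1) ∂(lebS q.1 L.1) := by
  have hs := measurable_graft_section hφ (Real.pi - (q.2 : ℝ), Real.pi - (q.1 : ℝ))
  rw [graftInt, nuK_apply, nuK_apply]
  refine (lintegral_lintegral_sum (G := fun x : LTree × LTree =>
    φ (graft (Real.pi - (q.2 : ℝ), Real.pi - (q.1 : ℝ)) x.1 x.2)) _ _ hs).trans ?_
  refine tsum_congr fun L => tsum_congr fun R => ?_
  simp only [lintegral_smul_measure, smul_eq_mul]
  rw [lintegral_const_mul _ hs.lintegral_prod_right', mul_assoc]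

/-- The recursion at the root for the measures on trees with a given number of leaves. -/
lemma lintegral_nuK_succ (x : ℝ) (m : ℕ) (θ : AngleType) {φ : LTree → ENNReal}
    (hφ : Measurable φ) : ∫⁻ t, φ t ∂(nuK x (m + 1) θ)
      = ∑ ij ∈ Finset.HasAntidiagonal.antidiagonal m,
        ∫⁻ q in splitRegion θ, graftInt (nuK x ij.1) (nuK x ij.2) φ q ∂lebPairs := by
  rw [lintegral_nuK, ← graftPC_injective.tsum_eq]
  · simp only [wt_graftPC, graftInt_nuK x _ _ hφ]
    have hterm : ∀ p : PCSet × PCSet, ∫⁻ t, φ t ∂(lebS θ (graftPC p).1)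
        = ∫⁻ q in splitRegion θ, ∫⁻ l, ∫⁻ r, φ (graft (Real.pi - q.2, Real.pi - q.1) l r)
        ∂(lebS q.2 p.2.1) ∂(lebS q.1 p.1.1) ∂lebPairs := fun p =>
      lintegral_lebS_graftSet θ p.1.1 p.2.1 hφ
    simp only [hterm, Finset.sum_mul]
    rw [Summable.tsum_finsetSum fun _ _ => ENNReal.summable]
    refine Finset.sum_congr rfl fun ij _ => ?_
    have hmeas : ∀ L R : PCSet, Measurable fun q : AngleType × AngleType => ∫⁻ l, ∫⁻ r,
        φ (graft (Real.pi - q.2, Real.pi - q.1) l r) ∂(lebS q.2 R.1) ∂(lebS q.1 L.1) := fun L R => by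
      have h := measurable_graftInt (lebK L.1) (lebK R.1) hφ
      rwa [funext fun q => graftInt_lebK L.1 R.1 φ q] at h
    rw [ENNReal.tsum_prod (f := fun L R : PCSet => wt x ij.1 L * wt x ij.2 R *
      ∫⁻ q in splitRegion θ, ∫⁻ l, ∫⁻ r, φ (graft (Real.pi - q.2, Real.pi - q.1) l r)
        ∂(lebS q.2 R.1) ∂(lebS q.1 L.1) ∂lebPairs), lintegral_tsum fun L => (Measurable.tsum fun R =>
      (hmeas L R).const_mul _).aemeasurable]
    refine tsum_congr fun L => ?_
    rw [lintegral_tsum fun R => ((hmeas L R).const_mul _).aemeasurable]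
    refine tsum_congr fun R => ?_
    rw [lintegral_const_mul _ (hmeas L R)]
  · intro S hS
    refine exists_graftPC_eq S ?_
    by_contra hc
    rw [Finset.not_nonempty_iff_eq_empty] at hc
    simp [wt, hc] at hS

/-! ### The integral operator at the root -/

/-- The integral of `f(α) g(β)` over `θ < α + β < π`. -/
def splitInt (f g : AngleType → ENNReal) (θ : AngleType) : ENNReal :=
  ∫⁻ q in splitRegion θ, f q.1 * g q.2 ∂lebPairs

lemma measurable_fst_mul_snd {f g : AngleType → ENNReal} (hf : Measurable f) (hg : Measurable g) :
    Measurable fun q : AngleType × AngleType => f q.1 * g q.2 :=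
  (hf.comp measurable_fst).mul (hg.comp measurable_snd)

lemma setLIntegral_splitRegion_swap (θ : AngleType) {f : AngleType × AngleType → ENNReal}
    (hf : Measurable f) : ∫⁻ q in splitRegion θ, f q.swap ∂lebPairs
      = ∫⁻ q in splitRegion θ, f q ∂lebPairs := by
  have hs : MeasurePreserving Prod.swap lebPairs lebPairs := Measure.measurePreserving_swap
  have hpre : splitRegion θ = Prod.swap ⁻¹' splitRegion θ := by
    ext q; simp [splitRegion, add_comm]
  rw [← hs.setLIntegral_comp_preimage (measurableSet_splitRegion θ) hf, ← hpre]

lemma splitInt_comm {f g : AngleType → ENNReal} (hf : Measurable f) (hg : Measurable g)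
    (θ : AngleType) : splitInt f g θ = splitInt g f θ := by
  rw [splitInt, ← setLIntegral_splitRegion_swap θ (measurable_fst_mul_snd hf hg), splitInt]
  simp only [Prod.fst_swap, Prod.snd_swap, mul_comm]

/-- The integral over `θ < α + β < π` is an integral of the convolution of `f` and `g` over
`s = α + β`. -/
lemma lintegral_convolution {f g : ℝ → ℝ} (hf : Continuous f) (hg : Continuous g)
    (hf0 : ∀ t ∈ Set.Icc 0 Real.pi, 0 ≤ f t) (hg0 : ∀ t ∈ Set.Icc 0 Real.pi, 0 ≤ g t)
    (θ : AngleType) :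
    splitInt (fun α => ENNReal.ofReal (f α)) (fun β => ENNReal.ofReal (g β)) θ
      = ENNReal.ofReal (∫ s in (θ : ℝ)..Real.pi, ∫ t in (0 : ℝ)..s, f t * g (s - t)) := by
  have hfm : Measurable fun q : ℝ × ℝ => ENNReal.ofReal (f q.1) * ENNReal.ofReal (g q.2) :=
    ((hf.comp continuous_fst).measurable.ennreal_ofReal).mul
      ((hg.comp continuous_snd).measurable.ennreal_ofReal)
  have hθ := θ.2
  rw [splitInt]
  rw [setLIntegral_splitRegion θ hfm, ← lintegral_indicator (measurableSet_realSplit θ)]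
  set Φ : ℝ × ℝ → ENNReal := (realSplit θ).indicator
    fun q => ENNReal.ofReal (f q.1) * ENNReal.ofReal (g q.2) with hΦ
  have hΦm : Measurable Φ := hfm.indicator (measurableSet_realSplit θ)
  have hΨm : Measurable fun x : ℝ × ℝ => Φ (x.1, x.2 - x.1) :=
    hΦm.comp (measurable_fst.prodMk (measurable_snd.sub measurable_fst))
  have e1 : ∫⁻ q, Φ q = ∫⁻ s, ∫⁻ a, Φ (a, s - a) := by
    rw [Measure.volume_eq_prod, lintegral_prod _ hΦm.aemeasurable]
    rw [lintegral_lintegral_swap (f := fun s a => Φ (a, s - a)) (by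
      exact (hΨm.comp measurable_swap).aemeasurable)]
    exact lintegral_congr fun a =>
      (lintegral_sub_right_eq_self (μ := volume) (fun b => Φ (a, b)) a).symm
  have hconv : Continuous fun s : ℝ => ∫ t in (0 : ℝ)..s, f t * g (s - t) := by
    have h := intervalIntegral.continuous_parametric_intervalIntegral_of_continuous
      (μ := volume) (f := fun s t => f t * g (s - t)) (a₀ := 0) (s := fun s : ℝ => s)
      (by
        have : Continuous fun p : ℝ × ℝ => f p.2 * g (p.1 - p.2) :=
          (hf.comp continuous_snd).mul (hg.comp (continuous_fst.sub continuous_snd))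
        exact this) continuous_id
    exact h
  have hinner : ∀ s, ∫⁻ a, Φ (a, s - a) = (Set.Ioo (θ : ℝ) Real.pi).indicator
      (fun s => ENNReal.ofReal (∫ t in (0 : ℝ)..s, f t * g (s - t))) s := by
    intro s
    by_cases hs : s ∈ Set.Ioo (θ : ℝ) Real.pi
    · have hs0 : 0 ≤ s := hθ.1.trans hs.1.le
      rw [Set.indicator_of_mem hs, intervalIntegral.integral_of_le hs0,
        ← integral_Icc_eq_integral_Ioc]
      rw [ofReal_integral_eq_lintegral_ofReal]
      · rw [← lintegral_indicator measurableSet_Icc]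
        refine lintegral_congr fun a => ?_
        by_cases ha : a ∈ Set.Icc 0 s
        · have hmem : (a, s - a) ∈ realSplit θ := by
            refine ⟨ha.1, ?_, ?_, ?_⟩ <;> simp only <;> linarith [ha.1, ha.2, hs.1, hs.2]
          rw [hΦ, Set.indicator_of_mem hmem, Set.indicator_of_mem ha, ENNReal.ofReal_mul
            (hf0 a ⟨ha.1, by linarith [ha.2, hs.2]⟩)]
        · have hmem : (a, s - a) ∉ realSplit θ := fun h => ha ⟨h.1, by
            have := h.2.1; simp only at this; linarith⟩
          rw [hΦ, Set.indicator_of_notMem hmem, Set.indicator_of_notMem ha]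
      · exact ((hf.mul (hg.comp (continuous_const.sub continuous_id))).integrableOn_Icc)
      · refine (ae_restrict_iff' measurableSet_Icc).2 (Eventually.of_forall fun a ha => ?_)
        exact mul_nonneg (hf0 a ⟨ha.1, by linarith [ha.2, hs.2]⟩)
          (hg0 _ ⟨by linarith [ha.2], by linarith [ha.1, hs.2]⟩)
    · rw [Set.indicator_of_notMem hs]
      have : ∀ a, Φ (a, s - a) = 0 := fun a => Set.indicator_of_notMem (fun h => hs ⟨by
        have := h.2.2.1; simp only at this; linarith, by
        have := h.2.2.2; simp only at this; linarith⟩) _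
      simp only [this, lintegral_zero]
  rw [e1]
  simp only [hinner]
  rw [lintegral_indicator measurableSet_Ioo, intervalIntegral.integral_of_le hθ.2.le,
    integral_Ioc_eq_integral_Ioo, ofReal_integral_eq_lintegral_ofReal]
  · exact hconv.integrableOn_Icc.mono_set Set.Ioo_subset_Icc_self
  · refine (ae_restrict_iff' measurableSet_Ioo).2 (Eventually.of_forall fun s hs => ?_)
    have hs0 : 0 ≤ s := hθ.1.trans hs.1.le
    refine intervalIntegral.integral_nonneg hs0 fun a ha => ?_
    exact mul_nonneg (hf0 a ⟨ha.1, by linarith [ha.2, hs.2]⟩)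
          (hg0 _ ⟨by linarith [ha.2], by linarith [ha.1, hs.2]⟩)

/-- The critical value of the parameter `y`. -/
def yc : ℝ := z₀ / Real.pi ^ 2

lemma yc_pos : 0 < yc := div_pos z₀_pos (by have := Real.pi_pos; positivity)

lemma yc_mul : yc * Real.pi ^ 2 = z₀ := by
  unfold yc; field_simp

lemma mul_sq_mem {y t : ℝ} (hy : y ∈ Set.Icc 0 yc) (ht : t ∈ Set.Icc 0 Real.pi) :
    y * t ^ 2 ∈ Set.Icc 0 z₀ := by
  refine ⟨mul_nonneg hy.1 (sq_nonneg t), ?_⟩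
  rw [← yc_mul]
  exact mul_le_mul hy.2 (pow_le_pow_left₀ ht.1 ht.2 2) (sq_nonneg t) yc_pos.le

lemma genU_nonneg {y t : ℝ} (hy : y ∈ Set.Icc 0 yc) (ht : t ∈ Set.Icc 0 Real.pi) :
    0 ≤ genU y t :=
  mul_nonneg hy.1 (serU_pos (mul_sq_mem hy ht).1 (mul_sq_mem hy ht).2).le

lemma serA_sq_nonneg {y t : ℝ} (hy : y ∈ Set.Icc 0 yc) (ht : t ∈ Set.Icc 0 Real.pi) :
    0 ≤ serA (y * t ^ 2) :=
  serA_nonneg (mul_sq_mem hy ht).1 (mul_sq_mem hy ht).2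

lemma mem_Icc_pi (θ : AngleType) : (θ : ℝ) ∈ Set.Icc 0 Real.pi := ⟨θ.2.1, θ.2.2.le⟩

/-- `F(x; θ)` as a function of the parameter `y`, with values in `[0, ∞]`. -/
def eU (y : ℝ) (θ : AngleType) : ENNReal := ENNReal.ofReal (genU y θ)

/-- The derivative of `F` in the parameter `y`, with values in `[0, ∞]`. -/
def eA (y : ℝ) (θ : AngleType) : ENNReal := ENNReal.ofReal (serA (y * (θ : ℝ) ^ 2))

lemma continuous_serA_sq (y : ℝ) : Continuous fun t : ℝ => serA (y * t ^ 2) :=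
  continuous_serA.comp (by fun_prop)

lemma measurable_eU (y : ℝ) : Measurable (eU y) :=
  ((continuous_genU y).measurable.comp measurable_subtype_coe).ennreal_ofReal

lemma measurable_eA (y : ℝ) : Measurable (eA y) :=
  ((continuous_serA_sq y).measurable.comp measurable_subtype_coe).ennreal_ofReal

lemma integral_conv_genU {y : ℝ} (θ : AngleType) :
    ∫ s in (θ : ℝ)..Real.pi, ∫ t in (0 : ℝ)..s, genU y t * genU y (s - t)
      = genU y θ - genU y Real.pi := by
  have hc : Continuous fun s : ℝ => ∫ t in (0 : ℝ)..s, genU y t * genU y (s - t) :=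
    intervalIntegral.continuous_parametric_intervalIntegral_of_continuous
      (μ := volume) (f := fun s t => genU y t * genU y (s - t)) (a₀ := 0) (s := fun s : ℝ => s)
      (((continuous_genU y).comp continuous_snd).mul
        ((continuous_genU y).comp (continuous_fst.sub continuous_snd))) continuous_id
  have h := intervalIntegral.integral_eq_sub_of_hasDerivAt (a := (θ : ℝ)) (b := Real.pi)
    (f := genU y) (fun s hs => hasDerivAt_genU y (by
      rw [Set.uIcc_of_le θ.2.2.le] at hs; exact θ.2.1.trans hs.1)) (hc.neg.intervalIntegrable _ _)
  rw [intervalIntegral.integral_neg] at h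
  linarith

lemma integral_conv_serA {y : ℝ} (θ : AngleType) :
    2 * ∫ s in (θ : ℝ)..Real.pi, ∫ t in (0 : ℝ)..s, genU y t * serA (y * (s - t) ^ 2)
      = serA (y * (θ : ℝ) ^ 2) - serA (y * Real.pi ^ 2) := by
  have hc : Continuous fun s : ℝ => ∫ t in (0 : ℝ)..s, genU y t * serA (y * (s - t) ^ 2) :=
    intervalIntegral.continuous_parametric_intervalIntegral_of_continuous
      (μ := volume) (f := fun s t => genU y t * serA (y * (s - t) ^ 2)) (a₀ := 0)
      (s := fun s : ℝ => s) (((continuous_genU y).comp continuous_snd).mul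
        ((continuous_serA_sq y).comp (continuous_fst.sub continuous_snd))) continuous_id
  have h := intervalIntegral.integral_eq_sub_of_hasDerivAt (a := (θ : ℝ)) (b := Real.pi)
    (f := fun s => serA (y * s ^ 2)) (fun s hs => hasDerivAt_serA_sq y (by
      rw [Set.uIcc_of_le θ.2.2.le] at hs; exact θ.2.1.trans hs.1))
    ((hc.const_mul 2).neg.intervalIntegrable _ _)
  rw [intervalIntegral.integral_neg, intervalIntegral.integral_const_mul] at h
  linarith

lemma splitInt_eU {y : ℝ} (hy : y ∈ Set.Icc 0 yc) (θ : AngleType) :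
    splitInt (eU y) (eU y) θ = ENNReal.ofReal (genU y θ - genU y Real.pi) := by
  have h := lintegral_convolution (continuous_genU y) (continuous_genU y)
    (fun t => genU_nonneg hy) (fun t => genU_nonneg hy) θ
  rw [integral_conv_genU] at h
  exact h

lemma splitInt_eU_eA {y : ℝ} (hy : y ∈ Set.Icc 0 yc) (θ : AngleType) :
    splitInt (eU y) (eA y) θ
      = ENNReal.ofReal ((serA (y * (θ : ℝ) ^ 2) - serA (y * Real.pi ^ 2)) / 2) := by
  have h := lintegral_convolution (continuous_genU y) (continuous_serA_sq y)
    (fun t => genU_nonneg hy) (fun t => serA_sq_nonneg hy) θ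
  rw [← integral_conv_serA, mul_div_cancel_left₀ _ two_ne_zero]
  exact h

lemma genU_pi_le {y : ℝ} (hy : y ∈ Set.Icc 0 yc) (θ : AngleType) : genU y Real.pi ≤ genU y θ := by
  rw [← sub_nonneg, ← integral_conv_genU]
  refine intervalIntegral.integral_nonneg θ.2.2.le fun s hs => ?_
  have hs0 : 0 ≤ s := θ.2.1.trans hs.1
  refine intervalIntegral.integral_nonneg hs0 fun a ha => mul_nonneg
    (genU_nonneg hy ⟨ha.1, by linarith [ha.2, hs.2]⟩)
    (genU_nonneg hy ⟨by linarith [ha.2], by linarith [ha.1, hs.2]⟩)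

lemma eU_eq {y : ℝ} (hy : y ∈ Set.Icc 0 yc) (θ : AngleType) :
    eU y θ = ENNReal.ofReal (genU y Real.pi) + splitInt (eU y) (eU y) θ := by
  rw [splitInt_eU hy, ← ENNReal.ofReal_add (genU_nonneg hy ⟨Real.pi_pos.le, le_rfl⟩)
    (sub_nonneg.2 (genU_pi_le hy θ)), eU, add_sub_cancel]

/-! ### The generating function -/

/-- The total mass of `nuK x m θ`. -/
def mass (x : ℝ) (m : ℕ) (θ : AngleType) : ENNReal := nuK x m θ Set.univ

lemma measurable_mass (x : ℝ) (m : ℕ) : Measurable (mass x m) :=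
  (nuK x m).measurable_coe MeasurableSet.univ

lemma mass_eq (x : ℝ) (m : ℕ) (θ : AngleType) : mass x m θ
    = ENNReal.ofReal x ^ (m + 1) * ∑' τ : Bin (m + 2), volume (allowedAngles θ τ) := by
  rw [mass, nuK_eq, Measure.smul_apply, Measure.sum_apply _ MeasurableSet.univ, smul_eq_mul]
  simp only [volume_allowedAngles, leb_eq_lebS]

lemma genF_eq_tsum_mass (x : ℝ) (θ : AngleType) : genF x θ = ∑' m, mass x m θ := by
  simp only [genF, mass_eq]

lemma mass_zero (x : ℝ) (θ : AngleType) : mass x 0 θ = ENNReal.ofReal x := by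
  have h0 : ParentClosed ((∅ : Finset (List Bool)) : Set (List Bool)) := fun u d h => by simp at h
  have h := lintegral_nuK x 0 θ (fun _ => 1)
  rw [lintegral_one] at h
  rw [mass, h, tsum_eq_single ⟨∅, h0⟩]
  · have hall : ∀ x, IsAllowed θ (label ∅ x) := fun x => by
      rw [label_empty]
      exact ⟨fun u d h => by simp [cubic] at h, fun u a b h => by simp at h,
        fun u a b a' b' h => by simp at h, fun u a b a' b' h => by simp at h,
        fun a b h => by simp at h⟩
    have hl : lebS θ ∅ Set.univ = 1 := by
      rw [lebS, Measure.restrict_apply MeasurableSet.univ, Set.univ_inter, rawLeb,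
        Measure.map_apply (measurable_label ∅) (measurableSet_isAllowed_section θ)]
      have : label ∅ ⁻¹' {t | IsAllowed θ t} = Set.univ := Set.eq_univ_of_forall hall
      rw [this, volume_pi, Measure.pi_univ]
      simp
    simp [wt, hl]
  · intro S hS
    have : S.1.card ≠ 0 := fun hc => hS (Subtype.ext (Finset.card_eq_zero.1 hc))
    simp [wt, this]

lemma mass_succ (x : ℝ) (m : ℕ) (θ : AngleType) : mass x (m + 1) θ
    = ∑ ij ∈ Finset.HasAntidiagonal.antidiagonal m, splitInt (mass x ij.1) (mass x ij.2) θ := by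
  have h := lintegral_nuK_succ x m θ (φ := fun _ => 1) measurable_const
  rw [lintegral_one] at h
  rw [mass, h]
  refine Finset.sum_congr rfl fun ij _ => ?_
  refine setLIntegral_congr_fun (measurableSet_splitRegion θ) fun q _ => ?_
  simp only [graftInt, lintegral_const, one_mul, mass]
  rw [mul_comm]

lemma measurable_genF (x : ℝ) : Measurable fun θ : AngleType => genF x θ := by
  simp only [genF_eq_tsum_mass]
  exact Measurable.tsum fun m => measurable_mass x m

lemma tsum_antidiagonal_mul (a b : ℕ → ENNReal) :
    ∑' m, ∑ ij ∈ Finset.HasAntidiagonal.antidiagonal m, a ij.1 * b ij.2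
      = (∑' i, a i) * ∑' j, b j := by
  have h : (∑' i, a i) * ∑' j, b j = ∑' p : ℕ × ℕ, a p.1 * b p.2 := by
    rw [ENNReal.tsum_prod (f := fun i j => a i * b j), ← ENNReal.tsum_mul_right]
    exact tsum_congr fun i => ENNReal.tsum_mul_left.symm
  rw [h, ← Finset.HasAntidiagonal.sigmaAntidiagonalEquivProd.tsum_eq, ENNReal.tsum_sigma']
  refine tsum_congr fun m => ?_
  rw [tsum_fintype]
  exact (Finset.sum_coe_sort (Finset.HasAntidiagonal.antidiagonal m)
    fun p : ℕ × ℕ => a p.1 * b p.2).symm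

lemma genF_eq_add (x : ℝ) (θ : AngleType) : genF x θ = ENNReal.ofReal x
    + splitInt (fun α => genF x α) (fun β => genF x β) θ := by
  have hm := fun ij : ℕ × ℕ => measurable_fst_mul_snd (measurable_mass x ij.1)
    (measurable_mass x ij.2)
  rw [genF_eq_tsum_mass, tsum_eq_zero_add' ENNReal.summable, mass_zero]
  congr 1
  simp only [mass_succ, splitInt, genF_eq_tsum_mass, ← tsum_antidiagonal_mul]
  rw [lintegral_tsum fun m => (Finset.measurable_sum _ fun ij _ => hm ij).aemeasurable]
  exact tsum_congr fun m => (lintegral_finsetSum _ fun ij _ => hm ij).symm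

lemma sum_range_antidiagonal_le (a b : ℕ → ENNReal) (N : ℕ) :
    ∑ m ∈ Finset.range N, ∑ ij ∈ Finset.HasAntidiagonal.antidiagonal m, a ij.1 * b ij.2
      ≤ (∑ i ∈ Finset.range N, a i) * ∑ j ∈ Finset.range N, b j := by
  rw [Finset.sum_mul_sum, ← Finset.sum_product', ← Finset.sum_biUnion]
  · refine Finset.sum_le_sum_of_subset fun p hp => ?_
    simp only [Finset.mem_biUnion, Finset.mem_range, Finset.HasAntidiagonal.mem_antidiagonal,
      Finset.mem_product] at hp ⊢
    omega
  · intro m _ n _ hmn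
    refine Finset.disjoint_left.2 fun p hp hp' => hmn ?_
    rw [← Finset.HasAntidiagonal.mem_antidiagonal.1 hp,
      Finset.HasAntidiagonal.mem_antidiagonal.1 hp']

/-- The generating function is the smallest solution of its integral equation. -/
lemma genF_le_eU {y : ℝ} (hy : y ∈ Set.Icc 0 yc) (θ : AngleType) :
    genF (genU y Real.pi) θ ≤ eU y θ := by
  set x := genU y Real.pi with hx
  -- the sum of the first `N + 1` terms is at most `x` plus the quadratic operator applied to the
  -- sum of the first `N` terms
  have key : ∀ N, ∀ θ, ∑ m ∈ Finset.range N, mass x m θ ≤ eU y θ := by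
    intro N
    induction N with
    | zero => intro θ; simp
    | succ N ih =>
      intro θ
      have hm := fun ij : ℕ × ℕ => measurable_fst_mul_snd (measurable_mass x ij.1)
        (measurable_mass x ij.2)
      rw [Finset.sum_range_succ', mass_zero, eU_eq hy, add_comm]
      gcongr
      simp only [mass_succ, splitInt]
      have e : ∀ m, ∑ ij ∈ Finset.HasAntidiagonal.antidiagonal m,
          ∫⁻ q in splitRegion θ, mass x ij.1 q.1 * mass x ij.2 q.2 ∂lebPairs
          = ∫⁻ q in splitRegion θ, ∑ ij ∈ Finset.HasAntidiagonal.antidiagonal m,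
            mass x ij.1 q.1 * mass x ij.2 q.2 ∂lebPairs := fun m =>
        (lintegral_finsetSum _ fun ij _ => hm ij).symm
      simp only [e]
      rw [← lintegral_finsetSum _ fun m _ => Finset.measurable_sum _ fun ij _ => hm ij]
      refine lintegral_mono fun q => ?_
      exact (sum_range_antidiagonal_le (fun i => mass x i q.1) (fun j => mass x j q.2) N).trans
        (mul_le_mul' (ih q.1) (ih q.2))
  rw [genF_eq_tsum_mass]
  exact ENNReal.tsum_le_of_sum_range_le fun N => key N θ

/-- Below the critical point the solution of the integral equation is unique: the linearization of
the equation is a contraction for the norm weighted by `A(y θ²)`. -/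
lemma eU_le_genF_of_lt {y : ℝ} (hy0 : 0 ≤ y) (hy : y < yc) (θ : AngleType) :
    eU y θ ≤ genF (genU y Real.pi) θ := by
  have hyI : y ∈ Set.Icc 0 yc := ⟨hy0, hy.le⟩
  set x := genU y Real.pi with hx
  -- the linearized operator maps `A(y θ²)` to `A(y θ²) - δ ≤ (1 - δ) A(y θ²)`
  set δ := serA (y * Real.pi ^ 2) with hδ
  have hπ : Real.pi ∈ Set.Icc 0 Real.pi := ⟨Real.pi_pos.le, le_rfl⟩
  have hδ0 : 0 < δ := by
    refine serA_pos (by positivity) ?_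
    rw [← yc_mul]
    exact mul_lt_mul_of_pos_right hy (by have := Real.pi_pos; positivity)
  have hA1 : ∀ θ : AngleType, serA (y * (θ : ℝ) ^ 2) ≤ 1 := fun θ =>
    serA_le_one (mul_sq_mem hyI (mem_Icc_pi θ)).1 (mul_sq_mem hyI (mem_Icc_pi θ)).2
  have hδ1 : δ ≤ 1 := serA_le_one (mul_sq_mem hyI hπ).1 (mul_sq_mem hyI hπ).2
  have hδA : ∀ θ : AngleType, δ ≤ serA (y * (θ : ℝ) ^ 2) := fun θ => by
    refine antitoneOn_serA (mul_sq_mem hyI (mem_Icc_pi θ)) (mul_sq_mem hyI hπ) ?_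
    have := θ.2.1
    have := θ.2.2.le
    gcongr
  have hU := measurable_eU y
  have hA := measurable_eA y
  have hG := measurable_genF x
  have key : ∀ k : ℕ, ∀ θ, eU y θ ≤ genF x θ + ENNReal.ofReal (y / δ * (1 - δ) ^ k) * eA y θ := by
    intro k
    induction k with
    | zero =>
      intro θ
      refine le_add_left ?_
      rw [pow_zero, mul_one, eU, eA, ← ENNReal.ofReal_mul (by positivity)]
      refine ENNReal.ofReal_le_ofReal ?_
      have h1 : genU y θ ≤ y := by
        have := serU_le_one (mul_sq_mem hyI (mem_Icc_pi θ)).1 (mul_sq_mem hyI (mem_Icc_pi θ)).2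
        rw [genU]; nlinarith
      refine h1.trans ?_
      rw [div_mul_eq_mul_div, le_div_iff₀ hδ0]
      exact mul_le_mul_of_nonneg_left (hδA θ) hy0
    | succ k ih =>
      intro θ
      set c := ENNReal.ofReal (y / δ * (1 - δ) ^ k) with hc
      have hpt : ∀ q : AngleType × AngleType, eU y q.1 * eU y q.2
          ≤ genF x q.1 * genF x q.2 + (c * (eA y q.1 * eU y q.2) + c * (eU y q.1 * eA y q.2)) := by
        intro q
        calc eU y q.1 * eU y q.2 ≤ eU y q.1 * (genF x q.2 + c * eA y q.2) := by
              gcongr; exact ih q.2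
          _ = eU y q.1 * genF x q.2 + c * (eU y q.1 * eA y q.2) := by ring
          _ ≤ (genF x q.1 + c * eA y q.1) * genF x q.2 + c * (eU y q.1 * eA y q.2) := by
              gcongr; exact ih q.1
          _ = genF x q.1 * genF x q.2 + (c * (eA y q.1 * genF x q.2)
              + c * (eU y q.1 * eA y q.2)) := by ring
          _ ≤ _ := by gcongr; exact genF_le_eU hyI q.2
      have hint : splitInt (eU y) (eU y) θ ≤ splitInt (fun α => genF x α) (fun β => genF x β) θ
          + (c * splitInt (eA y) (eU y) θ + c * splitInt (eU y) (eA y) θ) := by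
        refine (lintegral_mono fun q => hpt q).trans (le_of_eq ?_)
        rw [lintegral_add_left (measurable_fst_mul_snd hG hG),
          lintegral_add_left ((measurable_fst_mul_snd hA hU).const_mul c),
          lintegral_const_mul _ (measurable_fst_mul_snd hA hU),
          lintegral_const_mul _ (measurable_fst_mul_snd hU hA)]
        rfl
      rw [splitInt_comm hA hU, splitInt_eU_eA hyI, ← mul_add, ← ENNReal.ofReal_add
        (by linarith [hδA θ]) (by linarith [hδA θ]), add_halves] at hint
      rw [eU_eq hyI, genF_eq_add, add_assoc]
      gcongr
      refine hint.trans (add_le_add_right ?_ _)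
      rw [eA]
      rw [hc, ← ENNReal.ofReal_mul (by have := sub_nonneg.2 hδ1; positivity),
        ← ENNReal.ofReal_mul (by have := sub_nonneg.2 hδ1; positivity)]
      refine ENNReal.ofReal_le_ofReal ?_
      have h1 := sub_nonneg.2 hδ1
      have h2 : serA (y * (θ : ℝ) ^ 2) - δ ≤ (1 - δ) * serA (y * (θ : ℝ) ^ 2) := by
        nlinarith [hA1 θ]
      calc y / δ * (1 - δ) ^ k * (serA (y * (θ : ℝ) ^ 2) - δ)
          ≤ y / δ * (1 - δ) ^ k * ((1 - δ) * serA (y * (θ : ℝ) ^ 2)) := by gcongr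
        _ = _ := by ring
  have hlim : Tendsto (fun k : ℕ => genF x θ + ENNReal.ofReal (y / δ * (1 - δ) ^ k) * eA y θ) atTop
      (𝓝 (genF x θ + ENNReal.ofReal (y / δ * 0) * eA y θ)) := by
    refine Tendsto.const_add _ (ENNReal.Tendsto.mul_const ?_ (Or.inr ENNReal.ofReal_ne_top))
    refine ENNReal.tendsto_ofReal (Tendsto.const_mul _ ?_)
    exact tendsto_pow_atTop_nhds_zero_of_lt_one (sub_nonneg.2 hδ1) (by linarith)
  have := ge_of_tendsto' hlim fun k => key k θ
  simpa using this

lemma xc_eq_genU : xc = genU yc Real.pi := by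
  rw [xc_eq, genU, yc_mul, yc]; ring

lemma genF_mono {x x' : ℝ} (h : x ≤ x') (θ : ℝ) : genF x θ ≤ genF x' θ := by
  unfold genF; gcongr

/-- The generating function in closed form. -/
theorem genF_genU {y : ℝ} (hy : y ∈ Set.Icc 0 yc) (θ : AngleType) :
    genF (genU y Real.pi) θ = eU y θ := by
  refine le_antisymm (genF_le_eU hy θ) ?_
  rcases hy.2.lt_or_eq with h | h
  · exact eU_le_genF_of_lt hy.1 h θ
  -- at the critical point, let `y` increase to `yc`
  subst h
  have hlim : Tendsto (fun y => eU y θ) (𝓝[<] yc) (𝓝 (eU yc θ)) := by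
    have hc : Continuous fun y => eU y θ :=
      ENNReal.continuous_ofReal.comp (continuous_id.mul (continuous_serU.comp (by fun_prop)))
    exact hc.continuousAt.tendsto.mono_left nhdsWithin_le_nhds
  refine le_of_tendsto hlim ?_
  filter_upwards [Ioo_mem_nhdsLT yc_pos] with y hy
  refine (eU_le_genF_of_lt hy.1.le hy.2 θ).trans (genF_mono ?_ θ)
  have hπ := Real.pi_pos
  have h1 := strictMonoOn_mul_serU.monotoneOn
    (mul_sq_mem ⟨hy.1.le, hy.2.le⟩ ⟨hπ.le, le_rfl⟩) (mul_sq_mem ⟨yc_pos.le, le_rfl⟩ ⟨hπ.le, le_rfl⟩)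
    (show y * Real.pi ^ 2 ≤ yc * Real.pi ^ 2 by gcongr; exact hy.2.le)
  rw [genU, genU]
  have h2 : 0 < Real.pi ^ 2 := by positivity
  refine le_of_mul_le_mul_left ?_ h2
  linarith

lemma F_eq (θ : AngleType) : F θ = eU yc θ := by
  rw [F, xc_eq_genU, genF_genU ⟨yc_pos.le, le_rfl⟩]

lemma Finf_eq_serA (θ : ℝ) : Finf θ = serA (yc * θ ^ 2) := Finf_eq θ

lemma measurable_F : Measurable fun θ : AngleType => F θ := measurable_genF xc

lemma F_ne_top (θ : AngleType) : F θ ≠ ⊤ := by rw [F_eq]; exact ENNReal.ofReal_ne_top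

lemma F_ne_zero (θ : AngleType) : F θ ≠ 0 := by
  rw [F, genF_eq_add]
  have : ENNReal.ofReal xc ≠ 0 := (ENNReal.ofReal_pos.2 xc_pos).ne'
  simp [this]

lemma Finf_pos (θ : AngleType) : 0 < Finf θ := by
  rw [Finf_eq_serA]
  refine serA_pos (mul_nonneg yc_pos.le (sq_nonneg _)) ?_
  rw [← yc_mul]
  have h1 : (θ : ℝ) ^ 2 < Real.pi ^ 2 := pow_lt_pow_left₀ θ.2.2 θ.2.1 two_ne_zero
  exact mul_lt_mul_of_pos_left h1 yc_pos

/-- The integral equation of `F_∞`. -/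
lemma two_mul_splitInt_F_Finf (θ : AngleType) :
    2 * splitInt (fun α => F α) (fun β => ENNReal.ofReal (Finf β)) θ = ENNReal.ofReal (Finf θ) := by
  have h := splitInt_eU_eA (y := yc) ⟨yc_pos.le, le_rfl⟩ θ
  have e1 : eU yc = fun α : AngleType => F α := funext fun α => (F_eq α).symm
  have e2 : eA yc = fun β : AngleType => ENNReal.ofReal (Finf β) :=
    funext fun β => by simp only [eA, Finf_eq_serA]
  rw [e1, e2, yc_mul, serA_z₀, sub_zero, ← Finf_eq_serA] at h
  rw [h, ← ENNReal.ofReal_ofNat, ← ENNReal.ofReal_mul (by norm_num)]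
  congr 1; ring

lemma measurable_ofReal_Finf : Measurable fun θ : AngleType => ENNReal.ofReal (Finf θ) := by
  simp only [Finf_eq_serA]
  exact measurable_eA yc

/-! ### Ratios of partition functions of trees of given size -/

lemma mass_ne_top (m : ℕ) (θ : AngleType) : mass xc m θ ≠ ⊤ := by
  refine ne_top_of_le_ne_top (F_ne_top θ) ?_
  rw [F, genF_eq_tsum_mass]
  exact ENNReal.le_tsum m

/-- The generating function in closed form, as a convergent real series. -/
lemma hasSum_volume (θ : AngleType) {z : ℝ} (hz : z ∈ Set.Icc 0 z₀) :
    HasSum (fun m => (∑' τ : Bin (m + 2), volume (allowedAngles (θ : ℝ) τ)).toReal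
      / (Real.pi ^ 2) ^ m * (z * serU z) ^ (m + 1)) (z * serU (z * (θ / Real.pi) ^ 2)) := by
  have hπ := Real.pi_pos
  have hπ2 : 0 < Real.pi ^ 2 := by positivity
  have hy : z / Real.pi ^ 2 ∈ Set.Icc 0 yc := ⟨by have := hz.1; positivity, by
    rw [yc]; have := hz.2; gcongr⟩
  have hx : genU (z / Real.pi ^ 2) Real.pi = z * serU z / Real.pi ^ 2 := by
    rw [genU, div_mul_cancel₀ _ hπ2.ne']; ring
  have hx0 : 0 ≤ z * serU z / Real.pi ^ 2 := by
    rw [← hx]; exact genU_nonneg hy ⟨hπ.le, le_rfl⟩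
  have h := genF_genU hy θ
  rw [hx, genF] at h
  have hne : ∑' m : ℕ, ENNReal.ofReal (z * serU z / Real.pi ^ 2) ^ (m + 1)
      * ∑' τ : Bin (m + 2), volume (allowedAngles (θ : ℝ) τ) ≠ ⊤ := by
    rw [h]; exact ENNReal.ofReal_ne_top
  have hs := ENNReal.hasSum_toReal hne
  rw [← ENNReal.tsum_toReal_eq (ENNReal.ne_top_of_tsum_ne_top hne), h, eU,
    ENNReal.toReal_ofReal (genU_nonneg hy (mem_Icc_pi θ))] at hs
  have hm := hs.mul_left (Real.pi ^ 2)
  have h1 : Real.pi ^ 2 * genU (z / Real.pi ^ 2) θ = z * serU (z * (θ / Real.pi) ^ 2) := by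
    rw [genU, show z / Real.pi ^ 2 * (θ : ℝ) ^ 2 = z * (θ / Real.pi) ^ 2 by field_simp]
    field_simp
  rw [h1] at hm
  refine (congrArg (fun f : ℕ → ℝ => HasSum f _) (funext fun m => ?_)).mpr hm
  rw [ENNReal.toReal_mul, ENNReal.toReal_pow, ENNReal.toReal_ofReal hx0, div_pow,
    pow_succ (Real.pi ^ 2)]
  field_simp

/-- The total weights of trees of size `N` decay like `N^(-3/2)`, with a constant proportional to
`F_∞(θ)`. -/
lemma exists_tendsto_mass : ∃ D : ℝ, 0 < D ∧ ∀ θ : AngleType,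
    Tendsto (fun N : ℕ => Real.sqrt (N + 1) * (N + 1) * (mass xc N θ).toReal) atTop
      (𝓝 (D * Finf θ)) := by
  obtain ⟨C, hC, h⟩ := exists_tendsto_coeff
  have hπ := Real.pi_pos
  have hπ2 : 0 < Real.pi ^ 2 := by positivity
  refine ⟨‖C‖ / Real.pi ^ 2, div_pos (norm_pos_iff.2 hC) hπ2, fun θ => ?_⟩
  have h1 := (h (fun m => (∑' τ : Bin (m + 2), volume (allowedAngles (θ : ℝ) τ)).toReal
    / (Real.pi ^ 2) ^ m) ((θ / Real.pi) ^ 2) (fun m => by positivity)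
    (fun z hz => hasSum_volume θ hz)).norm.div_const (Real.pi ^ 2)
  have hX : z₀ * serU z₀ = Real.pi ^ 2 * xc := by rw [xc_eq]; field_simp
  have hF : serA (z₀ * (θ / Real.pi) ^ 2) = Finf θ := by
    rw [Finf_eq_serA, yc]; congr 1; field_simp
  have hp := Finf_pos θ
  convert h1 using 1
  · funext N
    rw [hX, mass_eq, ENNReal.toReal_mul, ENNReal.toReal_pow, ENNReal.toReal_ofReal xc_pos.le]
    set v := (∑' τ : Bin (N + 2), volume (allowedAngles (θ : ℝ) τ)).toReal with hv
    have hv0 : 0 ≤ v := ENNReal.toReal_nonneg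
    have : ((Real.sqrt (N + 1) : ℂ) * ((N + 1) * ((v / (Real.pi ^ 2) ^ N : ℝ) : ℂ)
        * ((Real.pi ^ 2 * xc : ℝ) : ℂ) ^ (N + 1)))
        = ((Real.sqrt (N + 1) * ((N + 1) * (v / (Real.pi ^ 2) ^ N)
          * (Real.pi ^ 2 * xc) ^ (N + 1)) : ℝ) : ℂ) := by push_cast; ring
    rw [this, Complex.norm_real, Real.norm_of_nonneg (by have := xc_pos; positivity)]
    rw [mul_pow, pow_succ (Real.pi ^ 2)]
    field_simp
  · rw [hF, norm_mul, Complex.norm_real, Real.norm_of_nonneg hp.le]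
    congr 1; ring

lemma eventually_mass_ne_zero (θ : AngleType) : ∀ᶠ N in atTop, mass xc N θ ≠ 0 := by
  obtain ⟨D, hD, h⟩ := exists_tendsto_mass
  filter_upwards [(h θ).eventually_ne (mul_pos hD (Finf_pos θ)).ne'] with N hN h0
  simp [h0] at hN

/-- Local limit of the ratios of total weights of trees. -/
lemma tendsto_mass_ratio (i : ℕ) (β θ : AngleType) :
    Tendsto (fun m : ℕ => mass xc (m - i) β / mass xc (m + 1) θ) atTop
      (𝓝 (ENNReal.ofReal (Finf β / Finf θ))) := by
  obtain ⟨D, hD, h⟩ := exists_tendsto_mass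
  rw [← tendsto_add_atTop_iff_nat i]
  simp only [Nat.add_sub_cancel]
  have h2 := (h θ).comp (tendsto_add_atTop_nat (i + 1))
  have h3 := (h β).div h2 (mul_pos hD (Finf_pos θ)).ne'
  have hr : Tendsto (fun n : ℕ => ((n : ℝ) + (i + 1 : ℕ) + 1) / (n + 1)) atTop (𝓝 1) := by
    have h4 := (tendsto_one_div_add_atTop_nhds_zero_nat (𝕜 := ℝ)).const_mul ((i : ℝ) + 1)
    have h5 := h4.const_add 1
    rw [mul_zero, add_zero] at h5
    refine h5.congr fun n => ?_
    have : (n : ℝ) + 1 ≠ 0 := by positivity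
    push_cast
    field_simp
    ring
  have hr2 := ((Real.continuous_sqrt.tendsto 1).comp hr).mul hr
  have h6 := h3.mul hr2
  rw [Real.sqrt_one, mul_one, mul_one, mul_div_mul_left _ _ hD.ne'] at h6
  refine (ENNReal.tendsto_ofReal h6).congr' ?_
  filter_upwards [(tendsto_add_atTop_nat (i + 1)).eventually (eventually_mass_ne_zero θ)] with n hn
  have hp : 0 < (mass xc (n + (i + 1)) θ).toReal := ENNReal.toReal_pos hn (mass_ne_top _ _)
  rw [add_assoc n i 1, ← ENNReal.ofReal_toReal (mass_ne_top n β),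
    ← ENNReal.ofReal_toReal (mass_ne_top (n + (i + 1)) θ), ← ENNReal.ofReal_div_of_pos hp]
  congr 1
  simp only [Pi.div_apply, Function.comp_apply]
  have h1 : (0 : ℝ) < (n : ℝ) + 1 := by positivity
  have h2 : (0 : ℝ) < (n : ℝ) + ((i + 1 : ℕ) : ℝ) + 1 := by positivity
  rw [Real.sqrt_div h2.le, Nat.cast_add]
  have h3 := (Real.sqrt_pos.2 h1).ne'
  have h4 := (Real.sqrt_pos.2 h2).ne'
  field_simp

/-! ### The critical Boltzmann kernel and the step of the spine -/

/-- The critical Boltzmann laws `P_θ` as a kernel. -/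
def critK : Kernel AngleType LTree :=
  (Kernel.sum (nuK xc)).withDensity fun θ _ => (F θ)⁻¹

lemma measurable_uncurry_F_inv :
    Measurable (Function.uncurry fun (θ : AngleType) (_ : LTree) => (F θ)⁻¹) :=
  measurable_F.inv.comp measurable_fst

instance : IsSFiniteKernel critK :=
  Kernel.IsSFiniteKernel.withDensity _ fun θ _ => ENNReal.inv_ne_top.2 (F_ne_zero θ)

lemma critLaw_eq (θ : AngleType) : critLaw θ = (F θ)⁻¹ • Measure.sum fun m => nuK xc m θ := by
  rw [critLaw, boltzmann, F]
  congr 2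
  funext m
  rw [nuK_eq]

lemma critK_apply (θ : AngleType) : critK θ = critLaw θ := by
  rw [critK, Kernel.withDensity_apply _ measurable_uncurry_F_inv, withDensity_const,
    Kernel.sum_apply, critLaw_eq]

/-- The decomposition of the unnormalized critical Boltzmann measure by the number of leaves. -/
lemma F_mul_lintegral_critLaw (θ : AngleType) (φ : LTree → ENNReal) :
    F θ * ∫⁻ t, φ t ∂(critLaw θ) = ∑' m, ∫⁻ t, φ t ∂(nuK xc m θ) := by
  rw [critLaw_eq, lintegral_smul_measure, lintegral_sum_measure, smul_eq_mul, ← mul_assoc,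
    ENNReal.mul_inv_cancel (F_ne_zero θ) (F_ne_top θ), one_mul]

instance : IsMarkovKernel critK := ⟨fun θ => ⟨by
  have h := F_mul_lintegral_critLaw θ fun _ => 1
  simp only [lintegral_one] at h
  have h2 : F θ * critLaw θ Set.univ = F θ * 1 := by
    rw [h, mul_one, F, genF_eq_tsum_mass]
    rfl
  rw [critK_apply]
  exact (ENNReal.mul_right_inj (F_ne_zero θ) (F_ne_top θ)).1 h2⟩⟩

instance (θ : AngleType) : IsProbabilityMeasure (critLaw θ) := by
  rw [← critK_apply]; infer_instance

/-- A property of all labelings of all finite trees holds almost everywhere for `nuK x m θ`. -/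
lemma ae_nuK (x : ℝ) (m : ℕ) (θ : AngleType) {p : LTree → Prop} (hm : MeasurableSet {t | p t})
    (h : ∀ S : PCSet, S.1.card = m → ∀ y, IsAllowed θ (label S.1 y) → p (label S.1 y)) :
    ∀ᵐ t ∂(nuK x m θ), p t := by
  rw [ae_iff, show {t | ¬ p t} = {t | p t}ᶜ from rfl, nuK_apply,
    Measure.sum_apply _ hm.compl, ENNReal.tsum_eq_zero]
  intro S
  rw [Measure.smul_apply, smul_eq_mul, wt]
  split_ifs with hS
  · rw [lebS, Measure.restrict_apply hm.compl, rawLeb, Measure.map_apply (measurable_label _)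
      (hm.compl.inter (measurableSet_isAllowed_section θ))]
    have : label S.1 ⁻¹' ({t | p t}ᶜ ∩ {t | IsAllowed (θ : ℝ) t}) = ∅ := by
      ext y
      simp only [Set.mem_preimage, Set.mem_inter_iff, Set.mem_compl_iff, Set.mem_ofPred_eq,
        Set.mem_empty_iff_false, iff_false, not_and]
      exact fun h1 h2 => h1 (h S hS y h2)
    rw [this, measure_empty, mul_zero]
  · rw [zero_mul]

lemma ae_critLaw (θ : AngleType) {p : LTree → Prop} (hm : MeasurableSet {t | p t})
    (h : ∀ S : PCSet, ∀ y, IsAllowed θ (label S.1 y) → p (label S.1 y)) :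
    ∀ᵐ t ∂(critLaw θ), p t := by
  rw [critLaw_eq]
  refine Measure.ae_smul_measure ?_ _
  rw [Measure.ae_sum_iff' hm]
  exact fun m => ae_nuK xc m θ hm fun S _ y => h S y

lemma ae_critLaw_isFinite (θ : AngleType) : ∀ᵐ t ∂(critLaw θ), IsFinite t :=
  ae_critLaw θ measurableSet_isFinite fun S y _ => by
    rw [IsFinite, cubic_label]; exact S.1.finite_toSet

/-- The type of the infinite subtree, if the infinite subtree is on the right (`d.1 = true`) or on
the left, and if the subtrees have types `d.2`. -/
def infType (d : Bool × AngleType × AngleType) : AngleType := if d.1 = true then d.2.2 else d.2.1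

/-- The type of the finite subtree. -/
def finType (d : Bool × AngleType × AngleType) : AngleType := if d.1 = true then d.2.1 else d.2.2

lemma measurableSet_dir : MeasurableSet {d : Bool × AngleType × AngleType | d.1 = true} :=
  measurable_fst (MeasurableSet.singleton true)

lemma measurable_infType : Measurable infType :=
  Measurable.ite measurableSet_dir (measurable_snd.comp measurable_snd)
    (measurable_fst.comp measurable_snd)

lemma measurable_finType : Measurable finType :=
  Measurable.ite measurableSet_dir (measurable_fst.comp measurable_snd)
    (measurable_snd.comp measurable_snd)

/-- The density of the direction of the spine and of the types of the subtrees. -/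
def dirDensity (θ : AngleType) (d : Bool × AngleType × AngleType) : ENNReal :=
  (splitRegion θ).indicator (fun _ => F (finType d) * ENNReal.ofReal (Finf (infType d) / Finf θ))
    d.2

lemma measurable_Finf : Measurable fun θ : AngleType => Finf θ := by
  simp only [Finf_eq_serA]
  exact (continuous_serA_sq yc).measurable.comp measurable_subtype_coe

lemma measurable_dirDensity : Measurable (Function.uncurry dirDensity) := by
  have h : Function.uncurry dirDensity =
      {x : AngleType × (Bool × AngleType × AngleType) | x.2.2 ∈ splitRegion x.1}.indicator
        fun x => F (finType x.2) * ENNReal.ofReal (Finf (infType x.2) / Finf x.1) := by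
    funext x
    by_cases hx : x.2.2 ∈ splitRegion x.1 <;> simp [Function.uncurry, dirDensity, hx]
  rw [h]
  refine Measurable.indicator ?_ ?_
  · exact (measurable_F.comp (measurable_finType.comp measurable_snd)).mul
      (ENNReal.measurable_ofReal.comp ((measurable_Finf.comp
        (measurable_infType.comp measurable_snd)).div (measurable_Finf.comp measurable_fst)))
  · exact (measurable_fst.prodMk (measurable_snd.comp measurable_snd))
      measurableSet_splitRegion_joint

lemma dirDensity_ne_top (θ : AngleType) (d : Bool × AngleType × AngleType) :
    dirDensity θ d ≠ ⊤ := by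
  rw [dirDensity, Set.indicator]
  split_ifs
  · exact ENNReal.mul_ne_top (F_ne_top _) ENNReal.ofReal_ne_top
  · exact ENNReal.zero_ne_top

/-- The law of the direction of the spine and of the types of the subtrees. -/
def dirK : Kernel AngleType (Bool × AngleType × AngleType) :=
  (Kernel.const AngleType (Measure.count.prod lebPairs)).withDensity dirDensity

instance : IsSFiniteKernel dirK := Kernel.IsSFiniteKernel.withDensity _ dirDensity_ne_top

lemma lintegral_dirK (θ : AngleType) {g : Bool × AngleType × AngleType → ENNReal}
    (hg : Measurable g) : ∫⁻ d, g d ∂(dirK θ)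
      = ∫⁻ q in splitRegion θ, F q.1 * ENNReal.ofReal (Finf q.2 / Finf θ) * g (true, q) ∂lebPairs
      + ∫⁻ q in splitRegion θ, ENNReal.ofReal (Finf q.1 / Finf θ) * F q.2 * g (false, q)
        ∂lebPairs := by
  have hd : Measurable fun d => dirDensity θ d * g d :=
    (measurable_dirDensity.comp measurable_prodMk_left).mul hg
  rw [dirK, Kernel.lintegral_withDensity _ measurable_dirDensity _ hg, Kernel.const_apply,
    lintegral_prod _ hd.aemeasurable, lintegral_count, tsum_fintype, Fintype.sum_bool,
    ← lintegral_indicator (measurableSet_splitRegion θ),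
    ← lintegral_indicator (measurableSet_splitRegion θ)]
  congr 1
  · refine lintegral_congr fun q => ?_
    by_cases hq : q ∈ splitRegion θ <;> simp [dirDensity, hq, finType, infType]
  · refine lintegral_congr fun q => ?_
    by_cases hq : q ∈ splitRegion θ <;> simp [dirDensity, hq, finType, infType, mul_comm]

instance : IsMarkovKernel dirK := ⟨fun θ => ⟨by
  have h := lintegral_dirK θ (g := fun _ => 1) measurable_const
  rw [lintegral_one] at h
  have hF : ENNReal.ofReal (Finf θ) ≠ 0 := (ENNReal.ofReal_pos.2 (Finf_pos θ)).ne'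
  have h2 := two_mul_splitInt_F_Finf θ
  have h3 : ∀ α : AngleType, ENNReal.ofReal (Finf α / Finf θ)
      = ENNReal.ofReal (Finf α) * (ENNReal.ofReal (Finf θ))⁻¹ := fun α => by
    rw [ENNReal.ofReal_div_of_pos (Finf_pos θ), div_eq_mul_inv]
  have hm := measurable_fst_mul_snd measurable_F measurable_ofReal_Finf
  have hm' := measurable_fst_mul_snd measurable_ofReal_Finf measurable_F
  have e1 : ∫⁻ q in splitRegion θ, F q.1 * ENNReal.ofReal (Finf q.2 / Finf θ) * 1 ∂lebPairs
      = splitInt (fun α => F α) (fun β => ENNReal.ofReal (Finf β)) θ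
        * (ENNReal.ofReal (Finf θ))⁻¹ := by
    rw [splitInt, ← lintegral_mul_const _ hm]
    refine lintegral_congr fun q => ?_
    rw [h3]; ring
  have e2 : ∫⁻ q in splitRegion θ, ENNReal.ofReal (Finf q.1 / Finf θ) * F q.2 * 1 ∂lebPairs
      = splitInt (fun α => F α) (fun β => ENNReal.ofReal (Finf β)) θ
        * (ENNReal.ofReal (Finf θ))⁻¹ := by
    rw [splitInt_comm measurable_F measurable_ofReal_Finf, splitInt, ← lintegral_mul_const _ hm']
    refine lintegral_congr fun q => ?_
    rw [h3]; ring
  rw [h, e1, e2, ← two_mul, ← mul_assoc, h2, ENNReal.mul_inv_cancel hF ENNReal.ofReal_ne_top]⟩⟩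

/-- The law of the first step of the spine: its direction, the types of the subtrees, and the
finite subtree. -/
def stepK : Kernel AngleType ((Bool × AngleType × AngleType) × LTree) :=
  dirK ⊗ₖ critK.comap (fun x => finType x.2) (measurable_finType.comp measurable_snd)

instance : IsMarkovKernel stepK := by unfold stepK; infer_instance

lemma lintegral_stepK (θ : AngleType) {g : (Bool × AngleType × AngleType) × LTree → ENNReal}
    (hg : Measurable g) : ∫⁻ y, g y ∂(stepK θ)
      = ∫⁻ q in splitRegion θ, F q.1 * ENNReal.ofReal (Finf q.2 / Finf θ)
          * ∫⁻ l, g ((true, q), l) ∂(critLaw q.1) ∂lebPairs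
      + ∫⁻ q in splitRegion θ, ENNReal.ofReal (Finf q.1 / Finf θ) * F q.2
          * ∫⁻ r, g ((false, q), r) ∂(critLaw q.2) ∂lebPairs := by
  have hm : Measurable fun d => ∫⁻ l, g (d, l) ∂(critK (finType d)) := by
    have := Measurable.lintegral_kernel_prod_right'
      (κ := critK.comap finType measurable_finType) hg
    simpa only [Kernel.comap_apply] using this
  rw [stepK, Kernel.lintegral_compProd _ _ _ hg]
  simp only [Kernel.comap_apply]
  rw [lintegral_dirK θ hm]
  simp only [critK_apply, finType, if_true, Bool.false_eq_true, if_false]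

/-! ### Construction of the limit laws -/

/-- The tree with a given code: the code of a label is a pair `(b, p)`, which stands for `none` if
`b = false` and for `some p` if `b = true`. Codes form a standard Borel space by the instances for
products. -/
def decodeTree (c : List Bool → Bool × (ℝ × ℝ)) : LTree := fun u =>
  if (c u).1 = true then some (c u).2 else none

lemma measurable_decodeTree : Measurable decodeTree := by
  refine measurable_pi_lambda _ fun u => Measurable.ite ?_ ?_ measurable_const
  · exact (measurable_fst.comp (measurable_pi_apply u)) (MeasurableSet.singleton true)
  · exact measurable_some_label.comp (measurable_snd.comp (measurable_pi_apply u))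

open Classical in
/-- The code of a tree. -/
def encodeTree (t : LTree) : List Bool → Bool × (ℝ × ℝ) := fun u =>
  (if t u = none then false else true, angles t u)

lemma measurable_encodeTree : Measurable encodeTree := by
  refine measurable_pi_lambda _ fun u => Measurable.prodMk (Measurable.ite ?_ measurable_const
    measurable_const) (measurable_angles u)
  exact measurableSet_setOfPred.2 (measurable_eq_none u)

lemma decodeTree_encodeTree (t : LTree) : decodeTree (encodeTree t) = t := by
  funext u
  by_cases h : t u = none
  · simp [decodeTree, encodeTree, h]
  · simp [decodeTree, encodeTree, h, ← exists_some_of_ne h]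

instance : StandardBorelSpace AngleType := measurableSet_Ico.standardBorel

instance : Nonempty AngleType := ⟨⟨0, le_rfl, Real.pi_pos⟩⟩

/-- The first step of the spine as a function of the type and of a uniform random variable. -/
lemma exists_stepFun : ∃ f : AngleType → unitInterval → (Bool × AngleType × AngleType) × LTree,
    Measurable (Function.uncurry f) ∧ ∀ θ, volume.map (f θ) = stepK θ := by
  have hd : Measurable (Prod.map id decodeTree : (Bool × AngleType × AngleType) × _ → _) :=
    measurable_id.prodMap measurable_decodeTree
  have he : Measurable (Prod.map id encodeTree : (Bool × AngleType × AngleType) × LTree → _) :=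
    measurable_id.prodMap measurable_encodeTree
  have : IsMarkovKernel (stepK.map (Prod.map id encodeTree :
      (Bool × AngleType × AngleType) × LTree → _)) := Kernel.IsMarkovKernel.map _ he
  obtain ⟨f, hf, hκ⟩ := Kernel.exists_measurable_map_eq_unitInterval
    (stepK.map (Prod.map id encodeTree : (Bool × AngleType × AngleType) × LTree → _))
  refine ⟨fun θ u => Prod.map id decodeTree (f θ u), hd.comp hf, fun θ => ?_⟩
  have hfθ : Measurable (f θ) := hf.comp measurable_prodMk_left
  change volume.map (Prod.map id decodeTree ∘ f θ) = stepK θ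
  rw [← Measure.map_map hd hfθ, hκ, Kernel.map_apply _ he,
    Measure.map_map hd he]
  have : (Prod.map id decodeTree ∘ Prod.map id encodeTree :
      (Bool × AngleType × AngleType) × LTree → _) = id := by
    funext y
    exact Prod.ext rfl (decodeTree_encodeTree y.2)
  rw [this, Measure.map_id]

/-- The step of the spine, as a function of the type and of a uniform random variable. -/
def stepFun : AngleType → unitInterval → (Bool × AngleType × AngleType) × LTree :=
  exists_stepFun.choose

lemma measurable_stepFun : Measurable (Function.uncurry stepFun) := exists_stepFun.choose_spec.1

lemma map_stepFun (θ : AngleType) : volume.map (stepFun θ) = stepK θ :=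
  exists_stepFun.choose_spec.2 θ

/-- The tree with a given first step `y` of the spine and with the infinite subtree `t`. -/
def attach (y : (Bool × AngleType × AngleType) × LTree) (t : LTree) : LTree :=
  graft (Real.pi - y.1.2.2, Real.pi - y.1.2.1) (if y.1.1 = true then y.2 else t)
    (if y.1.1 = true then t else y.2)

lemma measurable_attach : Measurable fun x : ((Bool × AngleType × AngleType) × LTree) × LTree =>
    attach x.1 x.2 := by
  have hs : MeasurableSet {x : ((Bool × AngleType × AngleType) × LTree) × LTree |
      x.1.1.1 = true} :=
    (measurable_fst.comp (measurable_fst.comp measurable_fst)) (MeasurableSet.singleton true)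
  have h1 : Measurable fun x : ((Bool × AngleType × AngleType) × LTree) × LTree => x.1.2 :=
    measurable_snd.comp measurable_fst
  refine measurable_graft.comp (Measurable.prodMk (Measurable.prodMk ?_ ?_)
    ((Measurable.ite hs h1 measurable_snd).prodMk (Measurable.ite hs measurable_snd h1)))
  · exact measurable_const.sub (measurable_subtype_coe.comp (measurable_snd.comp
      (measurable_snd.comp (measurable_fst.comp measurable_fst))))
  · exact measurable_const.sub (measurable_subtype_coe.comp (measurable_fst.comp
      (measurable_snd.comp (measurable_fst.comp measurable_fst))))

/-- The tree of type `θ` whose spine has the steps encoded by the sequence `ω`. -/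
def spineTree (θ : AngleType) (ω : ℕ → unitInterval) : LTree
  | [] => some (Real.pi - (stepFun θ (ω 0)).1.2.2, Real.pi - (stepFun θ (ω 0)).1.2.1)
  | d :: u => if d = (stepFun θ (ω 0)).1.1
      then spineTree (infType (stepFun θ (ω 0)).1) (fun n => ω (n + 1)) u
      else (stepFun θ (ω 0)).2 u

lemma spineTree_eq (θ : AngleType) (ω : ℕ → unitInterval) : spineTree θ ω
    = attach (stepFun θ (ω 0)) (spineTree (infType (stepFun θ (ω 0)).1) fun n => ω (n + 1)) := by
  funext u
  rcases u with _ | ⟨_ | _, u⟩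
  · simp [spineTree, attach]
  · cases h : (stepFun θ (ω 0)).1.1 <;> simp [spineTree, attach, h]
  · cases h : (stepFun θ (ω 0)).1.1 <;> simp [spineTree, attach, h]

lemma measurable_stepFun_zero :
    Measurable fun x : AngleType × (ℕ → unitInterval) => stepFun x.1 (x.2 0) :=
  measurable_stepFun.comp (measurable_fst.prodMk ((measurable_pi_apply 0).comp measurable_snd))

lemma measurable_shift : Measurable fun ω : ℕ → unitInterval => fun n => ω (n + 1) :=
  measurable_pi_lambda _ fun n => measurable_pi_apply (n + 1)

lemma measurable_spineTree : Measurable (Function.uncurry spineTree) := by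
  refine measurable_pi_lambda _ fun u => ?_
  induction u with
  | nil =>
    have h := measurable_snd.comp (measurable_fst.comp measurable_stepFun_zero)
    exact measurable_some_label.comp
      ((measurable_const.sub (measurable_subtype_coe.comp (measurable_snd.comp h))).prodMk
        (measurable_const.sub (measurable_subtype_coe.comp (measurable_fst.comp h))))
  | cons d u ih =>
    refine Measurable.ite ?_ ?_ ?_
    · exact measurableSet_eq_fun measurable_const
        (measurable_fst.comp (measurable_fst.comp measurable_stepFun_zero))
    · exact ih.comp ((measurable_infType.comp (measurable_fst.comp measurable_stepFun_zero)).prodMk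
        (measurable_shift.comp measurable_snd))
    · exact (measurable_apply u).comp (measurable_snd.comp measurable_stepFun_zero)

/-- The spine is infinite. -/
lemma exists_mem_cubic_spineTree (k : ℕ) : ∀ (θ : AngleType) (ω : ℕ → unitInterval),
    ∃ u ∈ cubic (spineTree θ ω), u.length = k := by
  induction k with
  | zero => exact fun θ ω => ⟨[], by simp [cubic, spineTree], rfl⟩
  | succ k ih =>
    intro θ ω
    obtain ⟨u, hu, hk⟩ := ih (infType (stepFun θ (ω 0)).1) fun n => ω (n + 1)
    refine ⟨(stepFun θ (ω 0)).1.1 :: u, ?_, by simp [hk]⟩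
    simpa [cubic, spineTree] using hu

lemma not_isFinite_spineTree (θ : AngleType) (ω : ℕ → unitInterval) :
    ¬ IsFinite (spineTree θ ω) := by
  intro h
  obtain ⟨N, hN⟩ := (h.image List.length).bddAbove
  obtain ⟨u, hu, hk⟩ := exists_mem_cubic_spineTree (N + 1) θ ω
  have := hN ⟨u, hu, rfl⟩
  omega

/-- The law of a sequence of independent uniform variables. -/
def unifSeq : Measure (ℕ → unitInterval) := Measure.infinitePi fun _ => volume

instance : IsProbabilityMeasure unifSeq := by unfold unifSeq; infer_instance

/-- A uniform variable followed by an independent sequence of uniform variables is again such a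
sequence. -/
lemma map_cons_unifSeq : (((volume : Measure unitInterval)).prod unifSeq).map
    (fun x n => Nat.casesOn n x.1 x.2 : unitInterval × (ℕ → unitInterval) → ℕ → unitInterval)
      = unifSeq := by
  have hm : Measurable (fun x n => Nat.casesOn n x.1 x.2 :
      unitInterval × (ℕ → unitInterval) → ℕ → unitInterval) := by
    refine measurable_pi_lambda _ fun n => ?_
    cases n with
    | zero => exact measurable_fst
    | succ n => exact (measurable_pi_apply n).comp measurable_snd
  refine Measure.eq_infinitePi _ fun s t ht => ?_
  -- a cylinder over `s` is a cylinder over an initial segment, with trivial sides outside `s`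
  set N := s.sup id with hN
  set t' : ℕ → Set unitInterval := fun n => if n ∈ s then t n else Set.univ with ht'
  have hs : s ⊆ Finset.range (N + 1) := fun n hn =>
    Finset.mem_range.2 (Nat.lt_succ_of_le (Finset.le_sup (f := id) hn))
  have hpi : Set.pi (s : Set ℕ) t = Set.pi (Finset.range (N + 1) : Set ℕ) t' := by
    ext ω
    simp only [Set.mem_pi, Finset.mem_coe, ht']
    constructor
    · intro h n _
      split_ifs with hn
      exacts [h n hn, trivial]
    · intro h n hn
      simpa [hn] using h n (hs hn)
  have hprod : ∏ n ∈ s, volume (t n) = ∏ n ∈ Finset.range (N + 1), volume (t' n) := by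
    rw [← Finset.prod_subset hs]
    · exact Finset.prod_congr rfl fun n hn => by simp [ht', hn]
    · intro n _ hn
      simp [ht', hn]
  have ht'm : ∀ n, MeasurableSet (t' n) := fun n => by
    simp only [ht']; split_ifs
    exacts [ht n, MeasurableSet.univ]
  rw [hpi, hprod, Measure.map_apply hm (MeasurableSet.pi (Finset.countable_toSet _)
    fun n _ => ht'm n)]
  have hpre : (fun x n => Nat.casesOn n x.1 x.2 :
      unitInterval × (ℕ → unitInterval) → ℕ → unitInterval) ⁻¹'
      Set.pi (Finset.range (N + 1) : Set ℕ) t'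
      = t' 0 ×ˢ Set.pi (Finset.range N : Set ℕ) fun n => t' (n + 1) := by
    ext x
    simp only [Set.mem_preimage, Set.mem_pi, Finset.mem_coe, Finset.mem_range, Set.mem_prod]
    constructor
    · exact fun h => ⟨h 0 (by omega), fun n hn => h (n + 1) (by omega)⟩
    · rintro ⟨h0, h⟩ (_ | n) hn
      exacts [h0, h n (by omega)]
  rw [hpre, Measure.prod_prod, unifSeq, Measure.infinitePi_pi _ fun n _ => ht'm (n + 1),
    Finset.prod_range_succ', mul_comm]

/-- The limit laws `P_θ^∞`. -/
def limitK : Kernel AngleType LTree :=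
  (Kernel.deterministic id measurable_id ×ₖ Kernel.const AngleType unifSeq).map
    (Function.uncurry spineTree)

instance : IsMarkovKernel limitK := Kernel.IsMarkovKernel.map _ measurable_spineTree

lemma limitK_apply (θ : AngleType) : limitK θ = unifSeq.map (spineTree θ) := by
  rw [limitK, Kernel.map_apply _ measurable_spineTree, Kernel.prod_apply,
    Kernel.deterministic_apply, Kernel.const_apply, Measure.dirac_prod, id,
    Measure.map_map measurable_spineTree measurable_prodMk_left]
  rfl

/-- The limit tree is a first step of the spine to which an independent limit tree is attached. -/
lemma lintegral_limitK (θ : AngleType) {φ : LTree → ENNReal} (hφ : Measurable φ) :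
    ∫⁻ t, φ t ∂(limitK θ) = ∫⁻ y, ∫⁻ t, φ (attach y t) ∂(limitK (infType y.1)) ∂(stepK θ) := by
  have hs : ∀ θ, Measurable (spineTree θ) := fun θ =>
    measurable_spineTree.comp measurable_prodMk_left
  have hsf : Measurable (stepFun θ) := measurable_stepFun.comp measurable_prodMk_left
  have hin : ∀ y, ∫⁻ t, φ (attach y t) ∂(limitK (infType y.1))
      = ∫⁻ ω, φ (attach y (spineTree (infType y.1) ω)) ∂unifSeq := fun y => by
    have ha : Measurable fun t => φ (attach y t) :=
      hφ.comp (measurable_attach.comp measurable_prodMk_left)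
    rw [limitK_apply, lintegral_map ha (hs _)]
  have hm : Measurable fun x : ((Bool × AngleType × AngleType) × LTree) × (ℕ → unitInterval) =>
      φ (attach x.1 (spineTree (infType x.1.1) x.2)) := by
    refine hφ.comp (measurable_attach.comp (measurable_fst.prodMk ?_))
    exact measurable_spineTree.comp
      ((measurable_infType.comp (measurable_fst.comp measurable_fst)).prodMk measurable_snd)
  have hc : Measurable (fun x n => Nat.casesOn n x.1 x.2 :
      unitInterval × (ℕ → unitInterval) → ℕ → unitInterval) := by
    refine measurable_pi_lambda _ fun n => ?_
    cases n with
    | zero => exact measurable_fst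
    | succ n => exact (measurable_pi_apply n).comp measurable_snd
  simp only [hin]
  have hφs : Measurable fun ω => φ (spineTree θ ω) := hφ.comp (hs θ)
  have hφc : Measurable fun x : unitInterval × (ℕ → unitInterval) =>
      φ (spineTree θ fun n => Nat.casesOn n x.1 x.2) := hφs.comp hc
  have hleft : ∫⁻ t, φ t ∂(limitK θ) = ∫⁻ u, ∫⁻ ω, φ (spineTree θ fun n => Nat.casesOn n u ω)
      ∂unifSeq ∂(volume : Measure unitInterval) := by
    rw [limitK_apply, lintegral_map hφ (hs θ)]
    nth_rewrite 1 [← map_cons_unifSeq]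
    rw [lintegral_map hφs hc, lintegral_prod _ hφc.aemeasurable]
  rw [hleft, ← map_stepFun, lintegral_map hm.lintegral_prod_right' hsf]
  refine lintegral_congr fun u => lintegral_congr fun ω => ?_
  rw [spineTree_eq]
  rfl

lemma ae_limitK_not_isFinite (θ : AngleType) : ∀ᵐ t ∂(limitK θ), ¬ IsFinite t := by
  have hs : Measurable (spineTree θ) := measurable_spineTree.comp measurable_prodMk_left
  rw [limitK_apply]
  refine (ae_map_iff hs.aemeasurable measurableSet_isFinite.compl).2 ?_
  exact Filter.Eventually.of_forall fun ω => not_isFinite_spineTree θ ω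

/-- The decomposition of the limit law by the side of the infinite subtree. -/
lemma lintegral_limitK' (θ : AngleType) {φ : LTree → ENNReal} (hφ : Measurable φ) :
    ∫⁻ t, φ t ∂(limitK θ)
      = ∫⁻ q in splitRegion θ, F q.1 * ENNReal.ofReal (Finf q.2 / Finf θ) * ∫⁻ l, ∫⁻ r,
          φ (graft (Real.pi - q.2, Real.pi - q.1) l r) ∂(limitK q.2) ∂(critLaw q.1) ∂lebPairs
      + ∫⁻ q in splitRegion θ, ENNReal.ofReal (Finf q.1 / Finf θ) * F q.2 * ∫⁻ l, ∫⁻ r,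
          φ (graft (Real.pi - q.2, Real.pi - q.1) l r) ∂(critLaw q.2) ∂(limitK q.1) ∂lebPairs := by
  have hm : Measurable fun y : (Bool × AngleType × AngleType) × LTree =>
      ∫⁻ t, φ (attach y t) ∂(limitK (infType y.1)) := by
    have := Measurable.lintegral_kernel_prod_right'
      (κ := limitK.comap (fun y : (Bool × AngleType × AngleType) × LTree => infType y.1)
        (measurable_infType.comp measurable_fst)) (hφ.comp measurable_attach)
    simpa only [Kernel.comap_apply, Function.comp_def] using this
  rw [lintegral_limitK θ hφ, lintegral_stepK θ hm]
  congr 1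
  refine lintegral_congr fun q => ?_
  congr 1
  simp only [attach, infType, Bool.false_eq_true, if_false]
  exact lintegral_lintegral_swap
    ((measurable_graft_section hφ (Real.pi - (q.2 : ℝ), Real.pi - (q.1 : ℝ))).comp
      measurable_swap).aemeasurable

/-- A tree constructed along a spine has the Markov property at the root. -/
lemma rootMarkov_limitK : RootMarkov limitK := by
  have hsplit : ∀ θ, ∀ φ : LTree → ENNReal, Measurable φ →
      (∫⁻ t in FinInf, φ t ∂(limitK θ) =
        ∫⁻ q in splitRegion θ, F q.1 * ENNReal.ofReal (Finf q.2 / Finf θ) * ∫⁻ l, ∫⁻ r,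
          φ (graft (Real.pi - q.2, Real.pi - q.1) l r) ∂(limitK q.2) ∂(critLaw q.1) ∂lebPairs) ∧
      (∫⁻ t in InfFin, φ t ∂(limitK θ) =
        ∫⁻ q in splitRegion θ, ENNReal.ofReal (Finf q.1 / Finf θ) * F q.2 * ∫⁻ l, ∫⁻ r,
          φ (graft (Real.pi - q.2, Real.pi - q.1) l r) ∂(critLaw q.2) ∂(limitK q.1)
            ∂lebPairs) := by
    intro θ φ hφ
    rw [← lintegral_indicator measurableSet_finInf, ← lintegral_indicator measurableSet_infFin,
      lintegral_limitK' θ (hφ.indicator measurableSet_finInf),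
      lintegral_limitK' θ (hφ.indicator measurableSet_infFin)]
    have hz : ∀ f : AngleType × AngleType → ENNReal, (∀ q, f q = 0) →
        ∫⁻ q in splitRegion θ, f q ∂lebPairs = 0 := fun f hf => by simp [hf]
    have h1 : ∀ q : AngleType × AngleType, ∀ A : Set LTree, ∀ g : LTree → ENNReal,
        (∀ l r, IsFinite l → ¬ IsFinite r →
          A.indicator φ (graft (Real.pi - q.2, Real.pi - q.1) l r)
            = g (graft (Real.pi - q.2, Real.pi - q.1) l r)) →
        ∫⁻ l, ∫⁻ r, A.indicator φ (graft (Real.pi - q.2, Real.pi - q.1) l r)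
          ∂(limitK q.2) ∂(critLaw q.1)
        = ∫⁻ l, ∫⁻ r, g (graft (Real.pi - q.2, Real.pi - q.1) l r)
          ∂(limitK q.2) ∂(critLaw q.1) := by
      intro q A g h
      refine lintegral_congr_ae ?_
      filter_upwards [ae_critLaw_isFinite q.1] with l hl
      refine lintegral_congr_ae ?_
      filter_upwards [ae_limitK_not_isFinite q.2] with r hr
      exact h l r hl hr
    have h2 : ∀ q : AngleType × AngleType, ∀ A : Set LTree, ∀ g : LTree → ENNReal,
        (∀ l r, ¬ IsFinite l → IsFinite r →
          A.indicator φ (graft (Real.pi - q.2, Real.pi - q.1) l r)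
            = g (graft (Real.pi - q.2, Real.pi - q.1) l r)) →
        ∫⁻ l, ∫⁻ r, A.indicator φ (graft (Real.pi - q.2, Real.pi - q.1) l r)
          ∂(critLaw q.2) ∂(limitK q.1)
        = ∫⁻ l, ∫⁻ r, g (graft (Real.pi - q.2, Real.pi - q.1) l r)
          ∂(critLaw q.2) ∂(limitK q.1) := by
      intro q A g h
      refine lintegral_congr_ae ?_
      filter_upwards [ae_limitK_not_isFinite q.1] with l hl
      refine lintegral_congr_ae ?_
      filter_upwards [ae_critLaw_isFinite q.2] with r hr
      exact h l r hl hr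
    constructor
    · have h0 := hz (fun q => ENNReal.ofReal (Finf q.1 / Finf θ) * F q.2 * ∫⁻ l, ∫⁻ r,
          FinInf.indicator φ (graft (Real.pi - q.2, Real.pi - q.1) l r)
          ∂(critLaw q.2) ∂(limitK q.1)) fun q => by
        rw [h2 q FinInf (fun _ => 0) fun l r hl hr => by simp [FinInf, hl]]; simp
      rw [h0, add_zero]
      refine lintegral_congr fun q => ?_
      rw [h1 q FinInf φ fun l r hl hr => by simp [FinInf, hl, hr]]
    · have h0 := hz (fun q => F q.1 * ENNReal.ofReal (Finf q.2 / Finf θ) * ∫⁻ l, ∫⁻ r,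
          InfFin.indicator φ (graft (Real.pi - q.2, Real.pi - q.1) l r)
          ∂(limitK q.2) ∂(critLaw q.1)) fun q => by
        rw [h1 q InfFin (fun _ => 0) fun l r hl hr => by simp [InfFin, hl]]; simp
      rw [h0, zero_add]
      refine lintegral_congr fun q => ?_
      rw [h2 q InfFin φ fun l r hl hr => by simp [InfFin, hl, hr]]
  refine ⟨fun θ => ?_, fun θ φ hφ => (hsplit θ φ hφ).1, fun θ φ hφ => (hsplit θ φ hφ).2⟩
  have hdis : Disjoint FinInf InfFin := by
    rw [Set.disjoint_left]
    exact fun t h1 h2 => h2.2.1 h1.2.1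
  have h1 : limitK θ (FinInf ∪ InfFin) = 1 := by
    have h := lintegral_limitK' θ (φ := fun _ => 1) measurable_const
    rw [← (hsplit θ _ measurable_const).1, ← (hsplit θ _ measurable_const).2] at h
    simp only [lintegral_one, measure_univ, Measure.restrict_apply_univ] at h
    rw [measure_union hdis measurableSet_infFin, ← h]
  exact (prob_compl_eq_zero_iff (measurableSet_finInf.union measurableSet_infFin)).2 h1

/-! ### Consequences of the Markov property at the root -/

lemma disjoint_finInf_infFin : Disjoint FinInf InfFin := by
  rw [Set.disjoint_left]
  exact fun t h1 h2 => h2.2.1 h1.2.1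

lemma RootMarkov.lintegral_eq {Q : Kernel AngleType LTree} (hQ : RootMarkov Q) (θ : AngleType)
    {φ : LTree → ENNReal} (hφ : Measurable φ) : ∫⁻ t, φ t ∂(Q θ)
      = ∫⁻ q in splitRegion θ, F q.1 * ENNReal.ofReal (Finf q.2 / Finf θ) * ∫⁻ l, ∫⁻ r,
          φ (graft (Real.pi - q.2, Real.pi - q.1) l r) ∂(Q q.2) ∂(critLaw q.1) ∂lebPairs
      + ∫⁻ q in splitRegion θ, ENNReal.ofReal (Finf q.1 / Finf θ) * F q.2 * ∫⁻ l, ∫⁻ r,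
          φ (graft (Real.pi - q.2, Real.pi - q.1) l r) ∂(critLaw q.2) ∂(Q q.1) ∂lebPairs := by
  rw [← hQ.finInf θ φ hφ, ← hQ.infFin θ φ hφ, ← lintegral_union measurableSet_infFin
    disjoint_finInf_infFin]
  rw [Measure.restrict_eq_self_of_ae_mem (hQ.split θ)]

lemma ae_lebPairs_pos : ∀ᵐ q ∂lebPairs, (0 : ℝ) < q.1 ∧ (0 : ℝ) < q.2 := by
  have h : ∀ᵐ α : AngleType ∂(Measure.comap (fun α : AngleType => (α : ℝ)) volume),
      (0 : ℝ) < (α : ℝ) := by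
    rw [ae_iff]
    refine ((MeasurableEmbedding.subtype_coe measurableSet_Ico).comap_apply _ _).trans ?_
    refine measure_mono_null ?_ (Real.volume_singleton (a := 0))
    rintro x ⟨α, hα, rfl⟩
    exact le_antisymm (not_lt.1 hα) α.2.1
  exact (Measure.quasiMeasurePreserving_fst.ae h).and (Measure.quasiMeasurePreserving_snd.ae h)

/-- A property of the trees with finite left and infinite right subtree may be checked on grafts.
The types `0` may be left out; they form a null set. -/
lemma RootMarkov.ae_finInf {Q : Kernel AngleType LTree} [IsMarkovKernel Q] (hQ : RootMarkov Q)
    (θ : AngleType) {A : Set LTree} (hA : MeasurableSet A)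
    (h : ∀ q : AngleType × AngleType, q ∈ splitRegion θ → (0 : ℝ) < q.1 → (0 : ℝ) < q.2 →
      ∀ᵐ l ∂(critLaw q.1), ∀ᵐ r ∂(Q q.2), graft (Real.pi - q.2, Real.pi - q.1) l r ∈ A) :
    ∀ᵐ t ∂(Q θ), t ∈ FinInf → t ∈ A := by
  rw [← ae_restrict_iff' measurableSet_finInf]
  have h0 : ∫⁻ t in FinInf, Aᶜ.indicator 1 t ∂(Q θ) = 0 := by
    rw [hQ.finInf θ _ (measurable_one.indicator hA.compl), ← nonpos_iff_eq_zero,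
      ← lintegral_zero (μ := lebPairs.restrict (splitRegion θ))]
    refine lintegral_mono_ae ?_
    filter_upwards [ae_restrict_of_ae ae_lebPairs_pos,
      ae_restrict_mem (measurableSet_splitRegion θ)] with q hp hq
    rw [nonpos_iff_eq_zero]
    refine mul_eq_zero_of_right _ ((lintegral_congr_ae ?_).trans lintegral_zero)
    filter_upwards [h q hq hp.1 hp.2] with l hl
    refine (lintegral_congr_ae ?_).trans lintegral_zero
    filter_upwards [hl] with r hr
    simp [hr]
  rw [lintegral_indicator_one hA.compl] at h0
  exact h0

/-- The analogue of `RootMarkov.ae_finInf` for an infinite left and a finite right subtree. -/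
lemma RootMarkov.ae_infFin {Q : Kernel AngleType LTree} [IsMarkovKernel Q] (hQ : RootMarkov Q)
    (θ : AngleType) {A : Set LTree} (hA : MeasurableSet A)
    (h : ∀ q : AngleType × AngleType, q ∈ splitRegion θ → (0 : ℝ) < q.1 → (0 : ℝ) < q.2 →
      ∀ᵐ l ∂(Q q.1), ∀ᵐ r ∂(critLaw q.2), graft (Real.pi - q.2, Real.pi - q.1) l r ∈ A) :
    ∀ᵐ t ∂(Q θ), t ∈ InfFin → t ∈ A := by
  rw [← ae_restrict_iff' measurableSet_infFin]
  have h0 : ∫⁻ t in InfFin, Aᶜ.indicator 1 t ∂(Q θ) = 0 := by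
    rw [hQ.infFin θ _ (measurable_one.indicator hA.compl), ← nonpos_iff_eq_zero,
      ← lintegral_zero (μ := lebPairs.restrict (splitRegion θ))]
    refine lintegral_mono_ae ?_
    filter_upwards [ae_restrict_of_ae ae_lebPairs_pos,
      ae_restrict_mem (measurableSet_splitRegion θ)] with q hp hq
    rw [nonpos_iff_eq_zero]
    refine mul_eq_zero_of_right _ ((lintegral_congr_ae ?_).trans lintegral_zero)
    filter_upwards [h q hq hp.1 hp.2] with l hl
    refine (lintegral_congr_ae ?_).trans lintegral_zero
    filter_upwards [hl] with r hr
    simp [hr]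
  rw [lintegral_indicator_one hA.compl] at h0
  exact h0

/-! ### Uniqueness -/

lemma trunc_graft (k : ℕ) (p : ℝ × ℝ) (l r : LTree) :
    trunc (k + 2) (graft p l r) = graft p (trunc (k + 1) l) (trunc (k + 1) r) := by
  funext u
  rcases u with _ | ⟨_ | _, u⟩ <;> simp [trunc]

lemma trunc_one (t : LTree) : trunc 1 t = fun _ => none := by
  funext u; simp [trunc]

lemma trunc_trunc (k : ℕ) (t : LTree) : trunc k (trunc k t) = trunc k t := by
  funext u; simp only [trunc]; split_ifs <;> rfl

lemma lintegral_of_trunc_one {μ : Measure LTree} [IsProbabilityMeasure μ] {φ : LTree → ENNReal}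
    (h : ∀ t, φ (trunc 1 t) = φ t) : ∫⁻ t, φ t ∂μ = φ fun _ => none := by
  have : φ = fun _ => φ fun _ => none := by
    funext t; rw [← h t, trunc_one]
  rw [this, lintegral_const, measure_univ, mul_one]

lemma graft_trunc_right {k : ℕ} {φ : LTree → ENNReal} (h : ∀ t, φ (trunc (k + 2) t) = φ t)
    (p : ℝ × ℝ) (l r : LTree) : φ (graft p l (trunc (k + 1) r)) = φ (graft p l r) := by
  rw [← h, trunc_graft, trunc_trunc, ← trunc_graft, h]

lemma graft_trunc_left {k : ℕ} {φ : LTree → ENNReal} (h : ∀ t, φ (trunc (k + 2) t) = φ t)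
    (p : ℝ × ℝ) (l r : LTree) : φ (graft p (trunc (k + 1) l) r) = φ (graft p l r) := by
  rw [← h, trunc_graft, trunc_trunc, ← trunc_graft, h]

lemma lintegral_lintegral_swap_graft {μ ν : Measure LTree} [SFinite μ] [SFinite ν]
    {φ : LTree → ENNReal} (hφ : Measurable φ) (p : ℝ × ℝ) :
    ∫⁻ l, ∫⁻ r, φ (graft p l r) ∂ν ∂μ = ∫⁻ r, ∫⁻ l, φ (graft p l r) ∂μ ∂ν :=
  lintegral_lintegral_swap (measurable_graft_section hφ p).aemeasurable

/-- The Markov property determines the law of the first generations: it expresses the law of `k + 2`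
of them by the law of `k + 1` generations of the infinite subtree. -/
lemma RootMarkov.lintegral_trunc {Q Q' : Kernel AngleType LTree} [IsMarkovKernel Q]
    [IsMarkovKernel Q'] (hQ : RootMarkov Q) (hQ' : RootMarkov Q') (k : ℕ) :
    ∀ (θ : AngleType) (φ : LTree → ENNReal), Measurable φ → (∀ t, φ (trunc (k + 1) t) = φ t) →
      ∫⁻ t, φ t ∂(Q θ) = ∫⁻ t, φ t ∂(Q' θ) := by
  induction k with
  | zero => exact fun θ φ _ h => by rw [lintegral_of_trunc_one h, lintegral_of_trunc_one h]
  | succ k ih =>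
    intro θ φ hφ h
    rw [hQ.lintegral_eq θ hφ, hQ'.lintegral_eq θ hφ]
    congr 1
    · refine lintegral_congr fun q => ?_
      congr 1
      refine lintegral_congr fun l => ?_
      exact ih q.2 (fun r => φ (graft (Real.pi - q.2, Real.pi - q.1) l r))
        ((measurable_graft_section hφ _).comp measurable_prodMk_left)
        fun r => graft_trunc_right h _ l r
    · refine lintegral_congr fun q => ?_
      congr 1
      rw [lintegral_lintegral_swap_graft hφ, lintegral_lintegral_swap_graft hφ]
      refine lintegral_congr fun r => ?_
      exact ih q.1 (fun l => φ (graft (Real.pi - q.2, Real.pi - q.1) l r))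
        ((measurable_graft_section hφ _).comp measurable_prodMk_right)
        fun l => graft_trunc_left h _ l r

/-- The finite-dimensional marginals depend on finitely many generations only. -/
theorem RootMarkov.unique {Q Q' : Kernel AngleType LTree} [IsMarkovKernel Q] [IsMarkovKernel Q']
    (hQ : RootMarkov Q) (hQ' : RootMarkov Q') : Q = Q' := by
  ext1 θ
  have : ∀ I : Finset (List Bool), IsFiniteMeasure ((Q' θ).map I.restrict) := fun I => inferInstance
  refine IsProjectiveLimit.unique (P := fun I => (Q' θ).map I.restrict) (fun I => ?_) fun I => rfl
  ext A hA
  have hr : Measurable (I.restrict : LTree → _) := Finset.measurable_restrict I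
  rw [Measure.map_apply hr hA, Measure.map_apply hr hA, ← lintegral_indicator_one (hr hA),
    ← lintegral_indicator_one (hr hA)]
  refine hQ.lintegral_trunc hQ' (I.sup List.length + 1) θ _ (measurable_one.indicator (hr hA))
    fun t => ?_
  have : I.restrict (trunc (I.sup List.length + 1 + 1) t) = I.restrict t := by
    funext u
    have : u.1.length ≤ I.sup List.length := Finset.le_sup u.2
    simp [trunc, this]
  have hiff : trunc (I.sup List.length + 1 + 1) t ∈ I.restrict ⁻¹' A ↔ t ∈ I.restrict ⁻¹' A := by
    rw [Set.mem_preimage, Set.mem_preimage, this]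
  by_cases ht : t ∈ I.restrict ⁻¹' A
  · rw [Set.indicator_of_mem ht, Set.indicator_of_mem (hiff.2 ht), Pi.one_apply, Pi.one_apply]
  · rw [Set.indicator_of_notMem ht, Set.indicator_of_notMem (mt hiff.1 ht)]

/-! ### The support of the limit laws -/

lemma IsAllowed.trunc {θ : ℝ} {t : LTree} (h : IsAllowed θ t) (k : ℕ) :
    IsAllowed θ (trunc k t) := by
  have hs : ∀ {u p}, AngleTree.trunc k t u = some p → t u = some p := fun {u p} hu => by
    unfold AngleTree.trunc at hu
    split_ifs at hu
    exact hu
  refine ⟨fun u d hu => ?_, fun u a b hu => h.angles u a b (hs hu),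
    fun u a b a' b' hu hv => h.left_edge u a b a' b' (hs hu) (hs hv),
    fun u a b a' b' hu hv => h.right_edge u a b a' b' (hs hu) (hs hv),
    fun a b hu => h.root_edge a b (hs hu)⟩
  simp only [cubic, AngleTree.trunc, Set.mem_ofPred_eq, List.length_append, List.length_singleton,
    ne_eq, ite_eq_right_iff, Classical.not_imp] at hu ⊢
  exact ⟨by omega, h.parentClosed u d hu.2⟩

lemma isAllowed_of_trunc {θ : ℝ} {t : LTree} (h : ∀ k, IsAllowed θ (trunc (k + 1) t)) :
    IsAllowed θ t := by
  have hs : ∀ {u : List Bool} {k : ℕ}, u.length < k → trunc (k + 1) t u = t u := fun {u k} hu => by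
    simp [trunc, hu]
  have hd : ∀ (u : List Bool) (d : Bool), (u ++ [d]).length < u.length + 2 := by simp
  have hu : ∀ u : List Bool, u.length < u.length + 2 := by simp
  refine ⟨fun u d hc => ?_, fun u a b h1 => (h _).angles u a b ((hs (hu u)).trans h1),
    fun u a b a' b' h1 h2 => (h _).left_edge u a b a' b' ((hs (hu u)).trans h1)
      ((hs (hd u _)).trans h2),
    fun u a b a' b' h1 h2 => (h _).right_edge u a b a' b' ((hs (hu u)).trans h1)
      ((hs (hd u _)).trans h2),
    fun a b h1 => (h 1).root_edge a b ((hs (by simp)).trans h1)⟩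
  have := (h (u.length + 2)).parentClosed u d
  simp only [cubic, Set.mem_ofPred_eq, hs (hu u), hs (hd u d)] at this hc ⊢
  exact this hc

lemma ae_critLaw_isAllowed (θ : AngleType) : ∀ᵐ t ∂(critLaw θ), IsAllowed θ t :=
  ae_critLaw θ (measurableSet_isAllowed_section θ) fun _ _ h => h

lemma mem_rootRegion {θ : AngleType} {q : AngleType × AngleType} (hq : q ∈ splitRegion θ)
    (h1 : (0 : ℝ) < q.1) (h2 : (0 : ℝ) < q.2) :
    ((Real.pi - q.2, Real.pi - q.1) : ℝ × ℝ) ∈ rootRegion θ := by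
  have h3 := q.1.2.2
  have h4 := q.2.2.2
  obtain ⟨h5, h6⟩ := hq
  refine ⟨?_, ?_, ?_, ?_, ?_, ?_⟩ <;> simp only <;> linarith

/-- The finite generations are allowed by induction, and the conditions of `IsAllowed` are local. -/
lemma RootMarkov.ae_isAllowed {Q : Kernel AngleType LTree} [IsMarkovKernel Q] (hQ : RootMarkov Q)
    (θ : AngleType) : ∀ᵐ t ∂(Q θ), IsAllowed θ t := by
  have key : ∀ k : ℕ, ∀ θ : AngleType, ∀ᵐ t ∂(Q θ), IsAllowed θ (trunc (k + 1) t) := by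
    intro k
    induction k with
    | zero =>
      refine fun θ => Filter.Eventually.of_forall fun t => ?_
      rw [trunc_one]
      exact ⟨fun u d h => by simp [cubic] at h, fun u a b h => by simp at h,
        fun u a b a' b' h => by simp at h, fun u a b a' b' h => by simp at h,
        fun a b h => by simp at h⟩
    | succ k ih =>
      intro θ
      have hA : MeasurableSet {t | IsAllowed (θ : ℝ) (trunc (k + 2) t)} :=
        measurable_trunc _ (measurableSet_isAllowed_section θ)
      have hg : ∀ q : AngleType × AngleType, q ∈ splitRegion θ → (0 : ℝ) < q.1 → (0 : ℝ) < q.2 →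
          ∀ l r, IsAllowed q.1 (trunc (k + 1) l) → IsAllowed q.2 (trunc (k + 1) r) →
          graft (Real.pi - q.2, Real.pi - q.1) l r ∈ {t | IsAllowed (θ : ℝ) (trunc (k + 2) t)} := by
        intro q hq h1 h2 l r hl hr
        rw [Set.mem_ofPred_eq, trunc_graft, isAllowed_graft]
        refine ⟨mem_rootRegion hq h1 h2, ?_, ?_⟩ <;> simpa only [sub_sub_cancel]
      filter_upwards [hQ.split θ, hQ.ae_finInf θ hA fun q hq h1 h2 => by
          filter_upwards [ae_critLaw_isAllowed q.1] with l hl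
          filter_upwards [ih q.2] with r hr
          exact hg q hq h1 h2 l r (hl.trunc _) hr,
        hQ.ae_infFin θ hA fun q hq h1 h2 => by
          filter_upwards [ih q.1] with l hl
          filter_upwards [ae_critLaw_isAllowed q.2] with r hr
          exact hg q hq h1 h2 l r hl (hr.trunc _)] with t ht h1 h2
      exact ht.elim h1 h2
  filter_upwards [ae_all_iff.2 fun k => key k θ] with t ht
  exact isAllowed_of_trunc ht

/-- The trees in which, `k` times in a row starting from the root, exactly one of the two subtrees
is infinite; one moves to the infinite subtree each time. -/
def spineUpTo : ℕ → Set LTree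
  | 0 => Set.univ
  | k + 1 => (FinInf ∩ rightTree ⁻¹' spineUpTo k) ∪ (InfFin ∩ leftTree ⁻¹' spineUpTo k)

lemma measurableSet_spineUpTo (k : ℕ) : MeasurableSet (spineUpTo k) := by
  induction k with
  | zero => exact MeasurableSet.univ
  | succ k ih =>
    exact (measurableSet_finInf.inter (measurable_rightTree ih)).union
      (measurableSet_infFin.inter (measurable_leftTree ih))

lemma RootMarkov.ae_spineUpTo {Q : Kernel AngleType LTree} [IsMarkovKernel Q] (hQ : RootMarkov Q)
    (k : ℕ) : ∀ θ, ∀ᵐ t ∂(Q θ), t ∈ spineUpTo k := by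
  induction k with
  | zero => exact fun θ => Filter.Eventually.of_forall fun t => trivial
  | succ k ih =>
    intro θ
    have hm := measurableSet_spineUpTo k
    filter_upwards [hQ.split θ, hQ.ae_finInf θ (measurable_rightTree hm) fun q _ _ _ =>
        Filter.Eventually.of_forall fun l => ih q.2,
      hQ.ae_infFin θ (measurable_leftTree hm) fun q _ _ _ => by
        filter_upwards [ih q.1] with l hl
        exact Filter.Eventually.of_forall fun r => hl] with t ht h1 h2
    exact ht.imp (fun h => ⟨h, h1 h⟩) fun h => ⟨h, h2 h⟩

open Classical in
/-- The direction of the infinite subtree. -/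
def spineDir (t : LTree) : Bool := if t ∈ FinInf then true else false

/-- The subtree in a given direction. -/
def subtree (d : Bool) (t : LTree) : LTree := fun u => t (d :: u)

/-- `s` is the sequence of directions of an infinite branch from the root. -/
def IsPath (s : ℕ → Bool) (t : LTree) : Prop := ∀ k : ℕ, (List.range k).map s ∈ cubic t

lemma map_range_succ (s : ℕ → Bool) (k : ℕ) :
    (List.range (k + 1)).map s = s 0 :: (List.range k).map fun n => s (n + 1) := by
  rw [List.range_succ_eq_map, List.map_cons, List.map_map]
  rfl

lemma IsPath.shift {s : ℕ → Bool} {t : LTree} (h : IsPath s t) :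
    IsPath (fun n => s (n + 1)) (subtree (s 0) t) := fun k => by
  have := h (k + 1)
  rwa [map_range_succ] at this

lemma IsPath.not_isFinite {s : ℕ → Bool} {t : LTree} (h : IsPath s t) : ¬ IsFinite t :=
  Set.infinite_of_injective_forall_mem (f := fun k => (List.range k).map s)
    (fun k k' hk => by simpa using congrArg List.length hk) h

/-- The spine follows the infinite subtree at each step; a branch that leaves it enters a finite
subtree. -/
lemma oneSpine_of_spineUpTo {t : LTree} (h : ∀ k, t ∈ spineUpTo k) : OneSpine t := by
  have hdir : ∀ {t : LTree}, (∀ k, t ∈ spineUpTo k) → t [] ≠ none ∧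
      IsFinite (subtree (!spineDir t) t) ∧ ∀ k, subtree (spineDir t) t ∈ spineUpTo k := by
    intro t h
    by_cases ht : t ∈ FinInf
    · have hd : spineDir t = true := by simp [spineDir, ht]
      rw [hd]
      exact ⟨ht.1, ht.2.1, fun k => (h (k + 1)).elim (fun h => h.2)
        fun h => absurd h.1 (disjoint_finInf_infFin.notMem_of_mem_left ht)⟩
    · have ht' : t ∈ InfFin := (h 1).elim (fun h => absurd h.1 ht) fun h => h.1
      have hd : spineDir t = false := by simp [spineDir, ht]
      rw [hd]
      exact ⟨ht'.1, ht'.2.2, fun k => (h (k + 1)).elim (fun h => absurd h.1 ht) fun h => h.2⟩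
  set next : LTree → LTree := fun t => subtree (spineDir t) t with hnext
  refine ⟨fun n => spineDir (next^[n] t), ?_, ?_⟩
  · intro k
    induction k generalizing t with
    | zero => exact (hdir h).1
    | succ k ih =>
      rw [map_range_succ]
      simp only [Function.iterate_succ_apply, Function.iterate_zero, id]
      exact ih (hdir h).2.2
  · intro s hs
    funext n
    have hs : IsPath s t := hs
    have h0 : ∀ {s : ℕ → Bool} {t : LTree}, (∀ k, t ∈ spineUpTo k) → IsPath s t →
        s 0 = spineDir t := by
      intro s t h hs
      by_contra hne
      have : s 0 = !spineDir t := by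
        cases h1 : s 0 <;> cases h2 : spineDir t <;> simp_all
      exact hs.shift.not_isFinite (this ▸ (hdir h).2.1)
    induction n generalizing t s with
    | zero => exact h0 h hs
    | succ n ih =>
      have hs' := hs.shift
      rw [h0 h hs] at hs'
      exact ih (hdir h).2.2 _ hs' hs'

lemma RootMarkov.ae_oneSpine {Q : Kernel AngleType LTree} [IsMarkovKernel Q] (hQ : RootMarkov Q)
    (θ : AngleType) : ∀ᵐ t ∂(Q θ), OneSpine t := by
  filter_upwards [ae_all_iff.2 fun k => hQ.ae_spineUpTo k θ] with t ht
  exact oneSpine_of_spineUpTo ht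

/-! ### Local limit -/

/-- The limit of the ratio of the total weights of large trees of types `β` and `θ`. -/
def limRatio (β θ : AngleType) : ENNReal := ENNReal.ofReal (Finf β / Finf θ)

/-- The ratio of the total weights of trees of type `β` with `m - i` cubic vertices and of trees of
type `θ` with `m + 1` cubic vertices; only the `i` with `2 i < m` matter, so that the subtree with
`i` cubic vertices is the smaller of the two subtrees. -/
def massRatio (m i : ℕ) (β θ : AngleType) : ENNReal :=
  if 2 * i < m then mass xc (m - i) β / mass xc (m + 1) θ else 0

lemma limRatio_ne_top (β θ : AngleType) : limRatio β θ ≠ ⊤ := ENNReal.ofReal_ne_top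

lemma tendsto_massRatio (i : ℕ) (β θ : AngleType) :
    Tendsto (fun m => massRatio m i β θ) atTop (𝓝 (limRatio β θ)) := by
  refine (tendsto_mass_ratio i β θ).congr' ?_
  filter_upwards [eventually_gt_atTop (2 * i)] with m hm
  rw [massRatio, if_pos hm]

lemma measurable_limRatio : Measurable fun x : AngleType × AngleType => limRatio x.1 x.2 :=
  ENNReal.measurable_ofReal.comp
    ((measurable_Finf.comp measurable_fst).div (measurable_Finf.comp measurable_snd))

lemma measurable_massRatio (m i : ℕ) :
    Measurable fun x : AngleType × AngleType => massRatio m i x.1 x.2 := by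
  unfold massRatio
  split_ifs
  · exact ((measurable_mass xc _).comp measurable_fst).div
      ((measurable_mass xc _).comp measurable_snd)
  · exact measurable_const

/-- The error made at the root when the infinite subtree is replaced by a large finite one, if `e`
bounds the error made in that subtree. -/
def rootError (e : ℕ → AngleType → ENNReal) (m : ℕ) (θ : AngleType) (q : AngleType × AngleType) :
    ENNReal :=
  ∑' i, mass xc i q.1 * ((limRatio q.2 θ - massRatio m i q.2 θ) + limRatio q.2 θ * e (m - i) q.2)

lemma measurable_rootError {e : ℕ → AngleType → ENNReal} (he : ∀ m, Measurable (e m)) (m : ℕ) :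
    Measurable (Function.uncurry (rootError e m)) := by
  have hu : Function.uncurry (rootError e m) = fun x : AngleType × AngleType × AngleType =>
      ∑' i, mass xc i x.2.1 * ((limRatio x.2.2 x.1 - massRatio m i x.2.2 x.1)
        + limRatio x.2.2 x.1 * e (m - i) x.2.2) := rfl
  rw [hu]
  refine Measurable.tsum fun i => ?_
  have h1 : Measurable fun x : AngleType × AngleType × AngleType => (x.2.2, x.1) :=
    (measurable_snd.comp measurable_snd).prodMk measurable_fst
  exact ((measurable_mass xc i).comp (measurable_fst.comp measurable_snd)).mul
    (((measurable_limRatio.comp h1).sub ((measurable_massRatio m i).comp h1)).add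
      ((measurable_limRatio.comp h1).mul ((he _).comp (measurable_snd.comp measurable_snd))))

lemma rootError_term_le {e : ℕ → AngleType → ENNReal} (he1 : ∀ m θ, e m θ ≤ 1) (m i : ℕ)
    (θ : AngleType) (q : AngleType × AngleType) :
    mass xc i q.1 * ((limRatio q.2 θ - massRatio m i q.2 θ) + limRatio q.2 θ * e (m - i) q.2)
      ≤ mass xc i q.1 * (2 * limRatio q.2 θ) := by
  gcongr
  rw [two_mul]
  gcongr
  · exact tsub_le_self
  · exact mul_le_of_le_one_right' (he1 _ _)

lemma tsum_mass (θ : AngleType) : ∑' i, mass xc i θ = F θ := (genF_eq_tsum_mass xc θ).symm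

/-- The sum over `i` tends to `0` by dominated convergence. -/
lemma tendsto_rootError {e : ℕ → AngleType → ENNReal} (he1 : ∀ m θ, e m θ ≤ 1)
    (he : ∀ θ, Tendsto (fun m => e m θ) atTop (𝓝 0)) (θ : AngleType) (q : AngleType × AngleType) :
    Tendsto (fun m => rootError e m θ q) atTop (𝓝 0) := by
  have hc := limRatio_ne_top q.2 θ
  simp only [rootError, ← lintegral_count]
  rw [← lintegral_zero (μ := (Measure.count : Measure ℕ))]
  refine tendsto_lintegral_of_dominated_convergence
    (fun i => mass xc i q.1 * (2 * limRatio q.2 θ)) (fun m => Measurable.of_discrete)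
    (fun m => Eventually.of_forall fun i => rootError_term_le he1 m i θ q) ?_
    (Eventually.of_forall fun i => ?_)
  · rw [lintegral_count, ENNReal.tsum_mul_right, tsum_mass]
    exact ENNReal.mul_ne_top (F_ne_top _) (ENNReal.mul_ne_top ENNReal.ofNat_ne_top hc)
  · have h1 : Tendsto (fun m => limRatio q.2 θ - massRatio m i q.2 θ) atTop (𝓝 0) := by
      have := ENNReal.Tendsto.sub (tendsto_const_nhds (x := limRatio q.2 θ))
        (tendsto_massRatio i q.2 θ) (Or.inl hc)
      rwa [tsub_self] at this
    have h2 : Tendsto (fun m => limRatio q.2 θ * e (m - i) q.2) atTop (𝓝 0) := by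
      have := ENNReal.Tendsto.const_mul (a := limRatio q.2 θ)
        ((he q.2).comp (tendsto_sub_atTop_nat i)) (Or.inr hc)
      rwa [mul_zero] at this
    have := ENNReal.Tendsto.const_mul (a := mass xc i q.1) (h1.add h2)
      (Or.inr (mass_ne_top i q.1))
    rwa [add_zero, mul_zero] at this

lemma tendsto_lintegral_rootError {e : ℕ → AngleType → ENNReal} (hem : ∀ m, Measurable (e m))
    (he1 : ∀ m θ, e m θ ≤ 1) (he : ∀ θ, Tendsto (fun m => e m θ) atTop (𝓝 0)) (θ : AngleType) :
    Tendsto (fun m => ∫⁻ q in splitRegion θ, rootError e m θ q ∂lebPairs) atTop (𝓝 0) := by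
  have hmeas : ∀ m, Measurable (rootError e m θ) := fun m =>
    (measurable_rootError hem m).of_uncurry_left
  rw [← lintegral_zero (μ := lebPairs.restrict (splitRegion θ))]
  refine tendsto_lintegral_of_dominated_convergence (fun q => F q.1 * (2 * limRatio q.2 θ))
    hmeas
    (fun m => Eventually.of_forall fun q => ?_) ?_
    (Eventually.of_forall fun q => tendsto_rootError he1 he θ q)
  · simp only
    rw [← tsum_mass, ← ENNReal.tsum_mul_right]
    exact ENNReal.tsum_le_tsum fun i => rootError_term_le he1 m i θ q
  · have h1 : ∫⁻ q in splitRegion θ, F q.1 * (2 * limRatio q.2 θ) ∂lebPairs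
        = 2 * splitInt (fun α => F α) (fun β => ENNReal.ofReal (Finf β)) θ
          * (ENNReal.ofReal (Finf θ))⁻¹ := by
      have hm := measurable_fst_mul_snd measurable_F measurable_ofReal_Finf
      rw [splitInt, ← lintegral_const_mul _ hm, ← lintegral_mul_const _ (hm.const_mul 2)]
      refine lintegral_congr fun q => ?_
      rw [limRatio, ENNReal.ofReal_div_of_pos (Finf_pos θ), div_eq_mul_inv]
      ring
    rw [h1, two_mul_splitInt_F_Finf, ENNReal.mul_inv_cancel
      (ENNReal.ofReal_pos.2 (Finf_pos θ)).ne' ENNReal.ofReal_ne_top]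
    exact ENNReal.one_ne_top

lemma lintegral_lintegral_le {μ ν : Measure LTree} {ψ : LTree → LTree → ENNReal}
    [IsProbabilityMeasure ν] (h : ∀ l r, ψ l r ≤ 1) :
    ∫⁻ l, ∫⁻ r, ψ l r ∂ν ∂μ ≤ μ Set.univ := by
  calc ∫⁻ l, ∫⁻ r, ψ l r ∂ν ∂μ ≤ ∫⁻ _, ∫⁻ _, 1 ∂ν ∂μ :=
        lintegral_mono fun l => lintegral_mono fun r => h l r
    _ = μ Set.univ := by simp

/-- Comparison of the laws of the pair of subtrees: the law `P` of the infinite one is replaced by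
the measure `ν` on large finite trees. -/
lemma mul_lintegral_lintegral_le {μ ν P : Measure LTree} [IsProbabilityMeasure P]
    {ψ : LTree → LTree → ENNReal} (hψ : Measurable (Function.uncurry ψ)) [SFinite ν]
    (h1 : ∀ l r, ψ l r ≤ 1) {c M e : ENNReal} (hν : ν Set.univ ≠ ⊤)
    (h : ∀ l, ν Set.univ * ∫⁻ r, ψ l r ∂P ≤ ∫⁻ r, ψ l r ∂ν + ν Set.univ * e) :
    c * ∫⁻ l, ∫⁻ r, ψ l r ∂P ∂μ ≤ μ Set.univ * ((c - ν Set.univ / M) + c * e)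
      + (∫⁻ l, ∫⁻ r, ψ l r ∂ν ∂μ) / M := by
  set b := ν Set.univ with hb
  set w := min c (b / M) with hw
  have hJ := lintegral_lintegral_le (μ := μ) (ν := P) h1
  set J := ∫⁻ l, ∫⁻ r, ψ l r ∂P ∂μ with hJdef
  have hc : c ≤ (c - b / M) + w := by
    rcases le_total c (b / M) with h | h
    · rw [hw, min_eq_left h]; exact le_add_self
    · rw [hw, min_eq_right h, tsub_add_cancel_of_le h]
  have hwJ : w * J ≤ μ Set.univ * (c * e) + (∫⁻ l, ∫⁻ r, ψ l r ∂ν ∂μ) / M := by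
    by_cases hb0 : b = 0
    · rw [hw, hb0, ENNReal.zero_div, min_eq_right zero_le, zero_mul]; exact zero_le
    have hl : ∀ l, ∫⁻ r, ψ l r ∂P ≤ b⁻¹ * ∫⁻ r, ψ l r ∂ν + e := fun l => by
      have := mul_le_mul_right (h l) b⁻¹
      rwa [mul_add, ← mul_assoc, ← mul_assoc, ENNReal.inv_mul_cancel hb0 hν, one_mul,
        one_mul] at this
    have hJ2 : J ≤ b⁻¹ * ∫⁻ l, ∫⁻ r, ψ l r ∂ν ∂μ + e * μ Set.univ := by
      refine (lintegral_mono hl).trans (le_of_eq ?_)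
      have hm : Measurable fun l => ∫⁻ r, ψ l r ∂ν := hψ.lintegral_prod_right'
      rw [lintegral_add_left (hm.const_mul _), lintegral_const_mul _ hm, lintegral_const]
    calc w * J ≤ w * (b⁻¹ * ∫⁻ l, ∫⁻ r, ψ l r ∂ν ∂μ + e * μ Set.univ) := by gcongr
      _ = w * (e * μ Set.univ) + w * (b⁻¹ * ∫⁻ l, ∫⁻ r, ψ l r ∂ν ∂μ) := by ring
      _ ≤ c * (e * μ Set.univ) + b / M * (b⁻¹ * ∫⁻ l, ∫⁻ r, ψ l r ∂ν ∂μ) := by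
          gcongr
          · exact min_le_left _ _
          · exact min_le_right _ _
      _ = μ Set.univ * (c * e) + (b * b⁻¹) * ((∫⁻ l, ∫⁻ r, ψ l r ∂ν ∂μ) / M) := by
          rw [div_eq_mul_inv, div_eq_mul_inv]; ring
      _ = _ := by rw [ENNReal.mul_inv_cancel hb0 hν, one_mul]
  calc c * J ≤ ((c - b / M) + w) * J := by gcongr
    _ = (c - b / M) * J + w * J := add_mul _ _ _
    _ ≤ (c - b / M) * μ Set.univ + (μ Set.univ * (c * e) + (∫⁻ l, ∫⁻ r, ψ l r ∂ν ∂μ) / M) := by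
        gcongr
    _ = _ := by ring

/-- `e` bounds the total variation distance between the first `k + 1` generations of the limit tree
of type `θ` and of the tree of type `θ` with `m` cubic vertices. The inequality is multiplied by the
total weight of the trees with `m` cubic vertices. -/
def IsErrorBound (k : ℕ) (e : ℕ → AngleType → ENNReal) : Prop :=
  ∀ (m : ℕ) (θ : AngleType) (φ : LTree → ENNReal), Measurable φ → (∀ t, φ t ≤ 1) →
    (∀ t, φ (trunc (k + 1) t) = φ t) →
    mass xc m θ * ∫⁻ t, φ t ∂(limitK θ) ≤ ∫⁻ t, φ t ∂(nuK xc m θ) + mass xc m θ * e m θ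

/-- The error bound one generation further, for trees with at least one cubic vertex. -/
def nextError (e : ℕ → AngleType → ENNReal) : ℕ → AngleType → ENNReal
  | 0, _ => 1
  | m + 1, θ => min 1 (2 * ∫⁻ q in splitRegion θ, rootError e m θ q ∂lebPairs)

lemma measurable_nextError {e : ℕ → AngleType → ENNReal} (hem : ∀ m, Measurable (e m)) (m : ℕ) :
    Measurable (nextError e m) := by
  rcases m with _ | m
  · exact measurable_const
  · refine measurable_const.min (Measurable.const_mul ?_ 2)
    simp only [← lintegral_indicator (measurableSet_splitRegion _)]
    have h : Measurable ({x : AngleType × (AngleType × AngleType) | x.2 ∈ splitRegion x.1}.indicator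
        (Function.uncurry (rootError e m))) :=
      (measurable_rootError hem m).indicator measurableSet_splitRegion_joint
    exact h.lintegral_prod_right'

lemma tendsto_nextError {e : ℕ → AngleType → ENNReal} (hem : ∀ m, Measurable (e m))
    (he1 : ∀ m θ, e m θ ≤ 1) (he : ∀ θ, Tendsto (fun m => e m θ) atTop (𝓝 0)) (θ : AngleType) :
    Tendsto (fun m => nextError e m θ) atTop (𝓝 0) := by
  rw [← tendsto_add_atTop_iff_nat 1]
  have h := ENNReal.Tendsto.const_mul (a := 2) (tendsto_lintegral_rootError hem he1 he θ)
    (Or.inr ENNReal.ofNat_ne_top)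
  rw [mul_zero] at h
  exact tendsto_of_tendsto_of_tendsto_of_le_of_le tendsto_const_nhds h (fun _ => zero_le)
    fun m => min_le_right _ _

lemma nextError_le_one (e : ℕ → AngleType → ENNReal) (m : ℕ) (θ : AngleType) :
    nextError e m θ ≤ 1 := by
  rcases m with _ | m
  · exact le_rfl
  · exact min_le_left _ _

/-- The contribution to the limit law of the trees whose left subtree is finite with `i` cubic
vertices. -/
lemma limRatio_mul_graftInt_le {k : ℕ} {e : ℕ → AngleType → ENNReal} (hE : IsErrorBound k e)
    {φ : LTree → ENNReal} (hφ : Measurable φ) (h1 : ∀ t, φ t ≤ 1)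
    (ht : ∀ t, φ (trunc (k + 2) t) = φ t) (m i : ℕ) (θ : AngleType) (q : AngleType × AngleType) :
    limRatio q.2 θ * graftInt (nuK xc i) limitK φ q
      ≤ mass xc i q.1 * ((limRatio q.2 θ - massRatio m i q.2 θ) + limRatio q.2 θ * e (m - i) q.2)
        + if 2 * i < m then graftInt (nuK xc i) (nuK xc (m - i)) φ q / mass xc (m + 1) θ else 0 := by
  split_ifs with hi
  · rw [massRatio, if_pos hi]
    refine mul_lintegral_lintegral_le
      (ψ := fun l r => φ (graft (Real.pi - q.2, Real.pi - q.1) l r))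
      (measurable_graft_section hφ _) (fun l r => h1 _)
      (mass_ne_top (m - i) q.2) fun l => ?_
    exact hE (m - i) q.2 (fun r => φ (graft (Real.pi - q.2, Real.pi - q.1) l r))
      ((measurable_graft_section hφ _).comp measurable_prodMk_left) (fun r => h1 _)
      fun r => graft_trunc_right ht _ l r
  · rw [massRatio, if_neg hi, tsub_zero, add_zero, mul_comm]
    have := lintegral_lintegral_le (μ := nuK xc i q.1) (ν := limitK q.2)
      (ψ := fun l r => φ (graft (Real.pi - q.2, Real.pi - q.1) l r)) fun l r => h1 _
    calc graftInt (nuK xc i) limitK φ q * limRatio q.2 θ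
        ≤ mass xc i q.1 * limRatio q.2 θ := by gcongr; exact this
      _ ≤ _ := by gcongr; exact le_self_add

/-- The contribution to the limit law of the trees whose right subtree is finite with `i` cubic
vertices. -/
lemma limRatio_mul_graftInt_le' {k : ℕ} {e : ℕ → AngleType → ENNReal} (hE : IsErrorBound k e)
    {φ : LTree → ENNReal} (hφ : Measurable φ) (h1 : ∀ t, φ t ≤ 1)
    (ht : ∀ t, φ (trunc (k + 2) t) = φ t) (m i : ℕ) (θ : AngleType) (q : AngleType × AngleType) :
    limRatio q.1 θ * graftInt limitK (nuK xc i) φ q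
      ≤ mass xc i q.2 * ((limRatio q.1 θ - massRatio m i q.1 θ) + limRatio q.1 θ * e (m - i) q.1)
        + if 2 * i < m then graftInt (nuK xc (m - i)) (nuK xc i) φ q / mass xc (m + 1) θ else 0 := by
  rw [graftInt, lintegral_lintegral_swap_graft hφ, graftInt, lintegral_lintegral_swap_graft hφ]
  split_ifs with hi
  · rw [massRatio, if_pos hi]
    refine mul_lintegral_lintegral_le
      (ψ := fun r l => φ (graft (Real.pi - q.2, Real.pi - q.1) l r))
      ((measurable_graft_section hφ _).comp measurable_swap) (fun l r => h1 _)
      (mass_ne_top (m - i) q.1) fun r => ?_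
    exact hE (m - i) q.1 (fun l => φ (graft (Real.pi - q.2, Real.pi - q.1) l r))
      ((measurable_graft_section hφ _).comp measurable_prodMk_right) (fun l => h1 _)
      fun l => graft_trunc_left ht _ l r
  · rw [massRatio, if_neg hi, tsub_zero, add_zero, mul_comm]
    have := lintegral_lintegral_le (μ := nuK xc i q.2) (ν := limitK q.1)
      (ψ := fun r l => φ (graft (Real.pi - q.2, Real.pi - q.1) l r)) fun l r => h1 _
    exact (mul_le_mul_left this _).trans (mul_le_mul_right le_self_add _)

lemma F_mul_lintegral_finInf {φ : LTree → ENNReal} (q : AngleType × AngleType) :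
    F q.1 * ∫⁻ l, ∫⁻ r, φ (graft (Real.pi - q.2, Real.pi - q.1) l r) ∂(limitK q.2) ∂(critLaw q.1)
      = ∑' i, graftInt (nuK xc i) limitK φ q := by
  rw [F_mul_lintegral_critLaw]
  rfl

lemma F_mul_lintegral_infFin {φ : LTree → ENNReal} (hφ : Measurable φ)
    (q : AngleType × AngleType) :
    F q.2 * ∫⁻ l, ∫⁻ r, φ (graft (Real.pi - q.2, Real.pi - q.1) l r) ∂(critLaw q.2) ∂(limitK q.1)
      = ∑' i, graftInt limitK (nuK xc i) φ q := by
  rw [lintegral_lintegral_swap_graft hφ, F_mul_lintegral_critLaw]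
  refine tsum_congr fun i => ?_
  rw [graftInt, lintegral_lintegral_swap_graft hφ]

/-- For `2 i < m`, the pairs `(i, m - i)` and `(m - i, i)` are distinct elements of the
antidiagonal. -/
lemma tsum_add_tsum_le_antidiagonal (G : ℕ × ℕ → ENNReal) (m : ℕ) :
    (∑' i, if 2 * i < m then G (i, m - i) else 0) + ∑' i, (if 2 * i < m then G (m - i, i) else 0)
      ≤ ∑ ij ∈ Finset.HasAntidiagonal.antidiagonal m, G ij := by
  have h : ∀ g : ℕ → ENNReal, (∑' i, if 2 * i < m then g i else 0)
      = ∑ i ∈ Finset.range (m + 1), if 2 * i < m then g i else 0 := fun g =>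
    tsum_eq_sum fun i hi => if_neg fun h => hi (Finset.mem_range.2 (by omega))
  rw [h, h, Finset.Nat.sum_antidiagonal_eq_sum_range_succ_mk]
  rw [← Finset.sum_range_reflect (fun i => if 2 * i < m then G (m - i, i) else 0) (m + 1),
    ← Finset.sum_add_distrib]
  refine Finset.sum_le_sum fun i hi => ?_
  have hi : i ≤ m := Nat.lt_succ_iff.1 (Finset.mem_range.1 hi)
  have h1 : m + 1 - 1 - i = m - i := by omega
  have h2 : m - (m - i) = i := by omega
  rw [h1, h2]
  by_cases h3 : 2 * i < m
  · rw [if_pos h3, if_neg (by omega), add_zero]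
  · rw [if_neg h3, zero_add]
    split_ifs
    exacts [le_rfl, zero_le]

/-- One step of the induction on the number of generations. Both laws are decomposed at the root;
the pairs `(i, m - i)` and `(m - i, i)` of sizes with `2 i < m` are compared with a finite left
subtree and a finite right subtree of size `i`, and the rest of the mass is part of the error. -/
theorem IsErrorBound.next {k : ℕ} {e : ℕ → AngleType → ENNReal} (hE : IsErrorBound k e)
    (hem : ∀ m, Measurable (e m)) : IsErrorBound (k + 1) (nextError e) := by
  intro m θ φ hφ h1 ht
  have hP : ∫⁻ t, φ t ∂(limitK θ) ≤ 1 :=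
    (lintegral_mono fun t => h1 t).trans (by simp)
  rcases m with _ | m
  · exact le_add_left (mul_le_mul_right hP _)
  set M := mass xc (m + 1) θ with hM
  by_cases hM0 : M = 0
  · rw [hM0, zero_mul]; exact zero_le
  have hMt : M ≠ ⊤ := mass_ne_top _ _
  -- an error bound of `1` is trivial, so the truncation at `1` is harmless
  suffices hmain : ∫⁻ t, φ t ∂(limitK θ) ≤ (∫⁻ t, φ t ∂(nuK xc (m + 1) θ)) / M
      + 2 * ∫⁻ q in splitRegion θ, rootError e m θ q ∂lebPairs by
    rw [nextError]
    rcases le_total 1 (2 * ∫⁻ q in splitRegion θ, rootError e m θ q ∂lebPairs) with h | h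
    · rw [min_eq_left h]
      exact le_add_left (mul_le_mul_right hP _)
    · rw [min_eq_right h]
      refine (mul_le_mul_right hmain M).trans (le_of_eq ?_)
      rw [mul_add, ENNReal.mul_div_cancel hM0 hMt]
  have hR : Measurable (rootError e m θ) := (measurable_rootError hem m).of_uncurry_left
  have hG : ∀ i j, Measurable (graftInt (nuK xc i) (nuK xc j) φ) := fun i j =>
    measurable_graftInt _ _ hφ
  have hRs : Measurable fun q : AngleType × AngleType => rootError e m θ q.swap :=
    hR.comp measurable_swap
  have hA : Measurable fun q => ∑' i, if 2 * i < m then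
      graftInt (nuK xc i) (nuK xc (m - i)) φ q / M else 0 := by
    refine Measurable.tsum fun i => ?_
    split_ifs
    exacts [(hG _ _).div_const _, measurable_const]
  have hB : Measurable fun q => ∑' i, if 2 * i < m then
      graftInt (nuK xc (m - i)) (nuK xc i) φ q / M else 0 := by
    refine Measurable.tsum fun i => ?_
    split_ifs
    exacts [(hG _ _).div_const _, measurable_const]
  rw [rootMarkov_limitK.lintegral_eq θ hφ]
  have hfst : ∫⁻ q in splitRegion θ, F q.1 * ENNReal.ofReal (Finf q.2 / Finf θ) * ∫⁻ l, ∫⁻ r,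
      φ (graft (Real.pi - q.2, Real.pi - q.1) l r) ∂(limitK q.2) ∂(critLaw q.1) ∂lebPairs
      ≤ (∫⁻ q in splitRegion θ, rootError e m θ q ∂lebPairs)
        + ∫⁻ q in splitRegion θ, (∑' i, if 2 * i < m then
          graftInt (nuK xc i) (nuK xc (m - i)) φ q / M else 0) ∂lebPairs := by
    rw [← lintegral_add_left hR]
    refine lintegral_mono fun q => ?_
    change F q.1 * limRatio q.2 θ * _ ≤ _
    rw [mul_comm (F q.1), mul_assoc, F_mul_lintegral_finInf, ← ENNReal.tsum_mul_left, rootError,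
      ← ENNReal.tsum_add]
    exact ENNReal.tsum_le_tsum fun i => limRatio_mul_graftInt_le hE hφ h1 ht m i θ q
  have hsnd : ∫⁻ q in splitRegion θ, ENNReal.ofReal (Finf q.1 / Finf θ) * F q.2 * ∫⁻ l, ∫⁻ r,
      φ (graft (Real.pi - q.2, Real.pi - q.1) l r) ∂(critLaw q.2) ∂(limitK q.1) ∂lebPairs
      ≤ (∫⁻ q in splitRegion θ, rootError e m θ q ∂lebPairs)
        + ∫⁻ q in splitRegion θ, (∑' i, if 2 * i < m then
          graftInt (nuK xc (m - i)) (nuK xc i) φ q / M else 0) ∂lebPairs := by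
    rw [← setLIntegral_splitRegion_swap θ hR, ← lintegral_add_left hRs]
    refine lintegral_mono fun q => ?_
    change limRatio q.1 θ * F q.2 * _ ≤ _
    rw [mul_assoc, F_mul_lintegral_infFin hφ, ← ENNReal.tsum_mul_left, rootError,
      ← ENNReal.tsum_add]
    exact ENNReal.tsum_le_tsum fun i => limRatio_mul_graftInt_le' hE hφ h1 ht m i θ q
  have hsum : (∫⁻ q in splitRegion θ, (∑' i, if 2 * i < m then
        graftInt (nuK xc i) (nuK xc (m - i)) φ q / M else 0) ∂lebPairs)
      + ∫⁻ q in splitRegion θ, (∑' i, if 2 * i < m then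
        graftInt (nuK xc (m - i)) (nuK xc i) φ q / M else 0) ∂lebPairs
      ≤ (∫⁻ t, φ t ∂(nuK xc (m + 1) θ)) / M := by
    rw [← lintegral_add_left hA, lintegral_nuK_succ xc m θ hφ,
      ← lintegral_finsetSum _ fun ij _ => hG ij.1 ij.2, div_eq_mul_inv,
      ← lintegral_mul_const _ (Finset.measurable_sum _ fun ij _ => hG ij.1 ij.2)]
    refine lintegral_mono fun q => ?_
    refine (tsum_add_tsum_le_antidiagonal
      (fun ij => graftInt (nuK xc ij.1) (nuK xc ij.2) φ q / M) m).trans (le_of_eq ?_)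
    rw [Finset.sum_mul]
    rfl
  calc _ ≤ _ := add_le_add hfst hsnd
    _ = _ := add_add_add_comm _ _ _ _
    _ ≤ (∫⁻ q in splitRegion θ, rootError e m θ q ∂lebPairs)
        + (∫⁻ q in splitRegion θ, rootError e m θ q ∂lebPairs)
        + (∫⁻ t, φ t ∂(nuK xc (m + 1) θ)) / M := by gcongr
    _ = _ := by rw [two_mul, add_comm]

lemma exists_isErrorBound (k : ℕ) : ∃ e : ℕ → AngleType → ENNReal, (∀ m, Measurable (e m)) ∧
    (∀ m θ, e m θ ≤ 1) ∧ (∀ θ, Tendsto (fun m => e m θ) atTop (𝓝 0)) ∧ IsErrorBound k e := by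
  induction k with
  | zero =>
    refine ⟨fun _ _ => 0, fun _ => measurable_const, fun _ _ => zero_le,
      fun _ => tendsto_const_nhds, fun m θ φ _ _ ht => ?_⟩
    have : φ = fun _ => φ fun _ => none := by
      funext t; rw [← ht t, trunc_one]
    rw [lintegral_of_trunc_one ht, mul_zero, add_zero, this, lintegral_const, mul_comm, mass]
  | succ k ih =>
    obtain ⟨e, hem, he1, he, hE⟩ := ih
    exact ⟨nextError e, measurable_nextError hem, nextError_le_one e, tendsto_nextError hem he1 he,
      hE.next hem⟩

/-- Conditioning the critical Boltzmann law on the number of leaves. -/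
lemma mass_mul_lintegral_condLaw {m : ℕ} {θ : AngleType} (hm : mass xc m θ ≠ 0)
    {φ : LTree → ENNReal} (hφ : Measurable φ) :
    mass xc m θ * ∫⁻ t, φ t ∂(condLaw θ (m + 2)) = ∫⁻ t, φ t ∂(nuK xc m θ) := by
  set s := {t | numLeaves t = (m + 2 : ℕ)} with hs
  have hsm : MeasurableSet s := measurableSet_numLeaves (m + 2)
  have key : ∀ φ : LTree → ENNReal, Measurable φ →
      F θ * ∫⁻ t in s, φ t ∂(critLaw θ) = ∫⁻ t, φ t ∂(nuK xc m θ) := by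
    intro φ hφ
    rw [← lintegral_indicator hsm, F_mul_lintegral_critLaw, tsum_eq_single m]
    · refine lintegral_congr_ae ?_
      filter_upwards [ae_nuK xc m θ hsm fun S hS y _ => by
        rw [numLeaves_label, hS]] with t ht
      exact Set.indicator_of_mem (s := s) ht φ
    · intro j hj
      refine (lintegral_congr_ae ?_).trans lintegral_zero
      filter_upwards [ae_nuK xc j θ (measurableSet_numLeaves (j + 2)) fun S hS y _ => by
        rw [numLeaves_label, hS]] with t ht
      refine Set.indicator_of_notMem (fun h => hj ?_) _
      have h2 : ((j + 2 : ℕ) : ℕ∞) = ((m + 2 : ℕ) : ℕ∞) := ht.symm.trans h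
      have := Nat.cast_injective h2
      omega
  have h1 : F θ * critLaw θ s = mass xc m θ := by
    have := key (fun _ => 1) measurable_const
    simpa only [lintegral_one, Measure.restrict_apply_univ, mass] using this
  have hs0 : critLaw θ s ≠ 0 := fun h => hm (by rw [← h1, h, mul_zero])
  rw [condLaw, ProbabilityTheory.cond, lintegral_smul_measure, ← key φ hφ, ← h1, smul_eq_mul,
    mul_assoc, ← mul_assoc (critLaw θ s), ENNReal.mul_inv_cancel hs0 (measure_ne_top _ _), one_mul]

lemma tvDist_nonneg {X : Type*} [MeasurableSpace X] (μ ν : Measure X) : 0 ≤ tvDist μ ν :=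
  Real.iSup_nonneg fun _ => abs_nonneg _

/-- For probability measures a one-sided comparison suffices, by passing to complements. -/
lemma tvDist_le {X : Type*} [MeasurableSpace X] {μ ν : Measure X} [IsProbabilityMeasure μ]
    [IsProbabilityMeasure ν] {ε : ENNReal} (hε : ε ≠ ⊤)
    (h : ∀ A, MeasurableSet A → ν A ≤ μ A + ε) : tvDist μ ν ≤ ε.toReal := by
  have : Nonempty {A : Set X // MeasurableSet A} := ⟨⟨∅, MeasurableSet.empty⟩⟩
  have hr : ∀ A, MeasurableSet A → ν.real A ≤ μ.real A + ε.toReal := fun A hA => by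
    rw [Measure.real, Measure.real, ← ENNReal.toReal_add (measure_ne_top _ _) hε]
    exact ENNReal.toReal_mono (ENNReal.add_ne_top.2 ⟨measure_ne_top _ _, hε⟩) (h A hA)
  refine ciSup_le fun A => abs_le.2 ⟨?_, ?_⟩
  · linarith [hr A.1 A.2]
  · have := hr A.1ᶜ A.2.compl
    rw [probReal_compl_eq_one_sub A.2, probReal_compl_eq_one_sub A.2] at this
    linarith

theorem localTendsto_limitK (θ : AngleType) : LocalTendsto (condLaw θ) (limitK θ) := by
  have key : ∀ k : ℕ, Tendsto (fun n => tvDist ((condLaw θ n).map (trunc (k + 1)))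
      ((limitK θ).map (trunc (k + 1)))) atTop (𝓝 0) := by
    intro k
    obtain ⟨e, -, he1, he, hE⟩ := exists_isErrorBound k
    rw [← tendsto_add_atTop_iff_nat 2]
    have hlim : Tendsto (fun m => (e m θ).toReal) atTop (𝓝 0) := by
      have := (ENNReal.tendsto_toReal ENNReal.zero_ne_top).comp (he θ)
      simpa [Function.comp_def] using this
    refine tendsto_of_tendsto_of_tendsto_of_le_of_le' tendsto_const_nhds hlim
      (Eventually.of_forall fun m => tvDist_nonneg _ _) ?_
    filter_upwards [eventually_mass_ne_zero θ] with m hm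
    have hmt := mass_ne_top m θ
    have hprob : IsProbabilityMeasure (condLaw θ (m + 2)) := ⟨by
      have := mass_mul_lintegral_condLaw hm (φ := fun _ => 1) measurable_const
      rw [lintegral_one, lintegral_one] at this
      refine (ENNReal.mul_right_inj hm hmt).1 ?_
      rw [this, mul_one, mass]⟩
    have h1 := Measure.isProbabilityMeasure_map (μ := condLaw θ (m + 2))
      (measurable_trunc (k + 1)).aemeasurable
    have h2 := Measure.isProbabilityMeasure_map (μ := limitK θ)
      (measurable_trunc (k + 1)).aemeasurable
    refine tvDist_le (ne_top_of_le_ne_top ENNReal.one_ne_top (he1 m θ)) fun A hA => ?_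
    have hB := measurable_trunc (k + 1) hA
    rw [Measure.map_apply (measurable_trunc _) hA, Measure.map_apply (measurable_trunc _) hA,
      ← lintegral_indicator_one hB, ← lintegral_indicator_one hB]
    have hφ : Measurable ((trunc (k + 1) ⁻¹' A).indicator (1 : LTree → ENNReal)) :=
      measurable_one.indicator hB
    have h3 := hE m θ _ hφ (fun t => Set.indicator_le_self' (fun _ _ => zero_le) t) fun t => by
      have hiff : trunc (k + 1) t ∈ trunc (k + 1) ⁻¹' A ↔ t ∈ trunc (k + 1) ⁻¹' A := by
        rw [Set.mem_preimage, Set.mem_preimage, trunc_trunc]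
      by_cases ht : t ∈ trunc (k + 1) ⁻¹' A
      · rw [Set.indicator_of_mem ht, Set.indicator_of_mem (hiff.2 ht), Pi.one_apply, Pi.one_apply]
      · rw [Set.indicator_of_notMem ht, Set.indicator_of_notMem (mt hiff.1 ht)]
    rw [← mass_mul_lintegral_condLaw hm hφ, ← mul_add] at h3
    exact (ENNReal.mul_le_mul_iff_right hm hmt).1 h3
  intro r
  rcases r with _ | k
  · have : trunc 0 = trunc 1 := by
      funext t u; simp [trunc]
    rw [this]
    exact key 0
  · exact key k

end AngleTree

end

theorem mainTheorem6 :
    ∃ P : Kernel AngleType LTree, IsMarkovKernel P ∧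
      (∀ θ : AngleType, ∀ᵐ t ∂(P θ), IsAllowed θ t ∧ OneSpine t) ∧
      RootMarkov P ∧
      (∀ Q : Kernel AngleType LTree, IsMarkovKernel Q → RootMarkov Q → Q = P) ∧
      (∀ θ : AngleType, LocalTendsto (condLaw θ) (P θ)) :=
  ⟨limitK, inferInstance, fun θ => (rootMarkov_limitK.ae_isAllowed θ).and
    (rootMarkov_limitK.ae_oneSpine θ), rootMarkov_limitK,
    fun _ _ hQ => hQ.unique rootMarkov_limitK, localTendsto_limitK⟩
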